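/- Let $a,b>0$ with $4b^2\ge a^2$. Let $\mathrm{Imm}$ be the set of smooth curves $c:[0,2\pi]\to\mathbb R^2$ with $c'(\theta)\ne 0$ for all $\theta$, and $\mathrm{Imm}/\mathrm{Tra}$ its quotient by translations, with the elastic metric $$G^{a,b}_c(h,k)=\int_0^{2\pi}\big(a^2\langle D_sh,n\rangle\langle D_sk,n\rangle+b^2\langle D_sh,v\rangle\langle D_sk,v\rangle\big)\,|c'|\,d\theta ,$$ where $v=c'/|c'|$, $n$ is $v$ rotated by $\pi/2$, and $D_sh=h'/|c'|$. Let $$R(c)=|c'|^{1/2}\big(a v_1,\;a v_2,\;\sqrt{4b^2-a^2}\big)$$ and let $\mathrm{im}\,R\subset C^\infty([0,2\pi],\mathbb R^3)$ be its image, with the $L^2$-metric $\int_0^{2\pi}\langle h,k\rangle\,d\theta$. Let $$C=\{q\in\mathbb R^3: (4b^2-a^2)(q_1^2+q_2^2)=a^2q_3^2,\ q_3\ge 0,\ q\neq 0\}$$ (so $q_3>0$ if $4b^2>a^2$, and $C$ is the punctured plane if $4b^2=a^2$), with the metric induced from $\mathbb R^3$. With $m=2b/a$, the map $$P(r,\varphi)=\Big(\tfrac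 rm\cos m\varphi,\ \tfrac rm\sin m\varphi,\ \tfrac{\sqrt{4b^2-a^2}}{2b}\,r\Big),\qquad r>0,\ \varphi\in\mathbb R,$$ is a covering of $C$, with period $\pi a/b$ in $\varphi$. Let $d\big((r,\varphi),(r',\varphi')\big)$ be the infimum of the lengths of the curves $P\circ\eta$ in $C$, over all smooth curves $\eta$ in $\{r>0\}$ from $(r,\varphi)$ to $(r',\varphi')$. Geodesics, over any nondegenerate interval of times, are the smooth paths (for paths of curves: smooth jointly in $t$ and $\theta$) that are critical points of the energy with fixed end points on every compact subinterval; geodesic distance is the infimum of the lengths of smooth paths. 1. $(\mathrm{Imm}/\mathrm{Tra},G^{a,b})$ is flat, and so is $\mathrm{im}\,R$ with the $L^2$-metric: locally, each is isometric, by a diffeomorphism, to an open subset of the vector space $C^\infty([0,2\pi],\mathbb R^2)$ with the constant $L^2$-metric. 2. A smooth path in $\mathrm{Imm}/\mathrm{Tra}$ is a geodesic if and only if its image under $R$ is a geodesic of $\mathrm{im}\,R$, and every geodesic of $\mathrm{im}\,R$ is the image of a geodesic of $\mathrm{Imm}/\mathrm{Tra}$. 3. A smooth path $q(t,\theta)$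 in $\mathrm{im}\,R$ is a geodesic if and only if for each $\theta\in[0,2\pi]$ the curve $t\mapsto q(t,\theta)$ is a geodesic of $C$. 4. For all $r,r'>0$ and $\varphi,\varphi'\in\mathbb R$, $$d\big((r,\varphi),(r',\varphi')\big)^2=r^2+r'^2-2rr'\cos\big(\min(|\varphi-\varphi'|,\pi)\big),$$ and the geodesic distance on $C$ between $P(r,\varphi)$ and $P(r',\varphi')$ is $\min_{k\in\mathbb Z}d\big((r,\varphi),(r',\varphi'+k\pi a/b)\big)$. 5. For every $c\in\mathrm{Imm}$ the curve $R(c)$ has a continuous lift $(r,\varphi)$, that is, $R(c)(\theta)=P(r(\theta),\varphi(\theta))$ for all $\theta$. Let $c,\bar c\in\mathrm{Imm}$, and let $(r,\varphi)$, $(\bar r,\bar\varphi)$ be any continuous lifts of $R(c)$ and $R(\bar c)$. Then $c$ and $\bar c$ can be joined by a smooth path in $\mathrm{Imm}/\mathrm{Tra}$, and their geodesic distance satisfies $$\mathrm{dist}(c,\bar c)^2=\min_{k\in\mathbb Z}\int_0^{2\pi}d\big((r(\theta),\varphi(\theta)),(\bar r(\theta),\bar\varphi(\theta)+k\pi a/b)\big)^2\,d\theta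 ,$$ where the winding index $k$ is chosen only once for all $\theta$. -/

import Mathlib

open Set Real MeasureTheory
open scoped ContDiff

noncomputable section

namespace ElasticCurves

/-- The plane and 3-space (and `ℝⁿ`) with the Euclidean norm. -/
abbrev E (n : ℕ) : Type := EuclideanSpace ℝ (Fin n)

/-- The parameter interval `[0, 2π]`. -/
def I : Set ℝ := Icc 0 (2 * π)

/-! A curve on `[0, 2π]` is represented by a function on `ℝ` of which only the values on `[0, 2π]`
matter; smoothness and derivatives are taken within `[0, 2π]`. -/

/-- `C^∞([0, 2π], ℝⁿ)`. -/
def smoothCurves (n : ℕ) : Set (ℝ → E n) := {f | ContDiffOn ℝ ∞ f I}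

/-- The parameter derivative `c'`. -/
def velocity {n : ℕ} (c : ℝ → E n) (θ : ℝ) : E n := derivWithin c I θ

/-- `Imm([0, 2π], ℝ²)`. -/
def immersions : Set (ℝ → E 2) := {c | c ∈ smoothCurves 2 ∧ ∀ θ ∈ I, velocity c θ ≠ 0}

/-- Two curves represent the same element of `Imm / Tra`. -/
def SameModTra (c d : ℝ → E 2) : Prop := ∃ p : E 2, ∀ θ ∈ I, d θ = c θ + p

/-- Two functions represent the same curve on `[0, 2π]`. -/
def SameCurve {n : ℕ} (f g : ℝ → E n) : Prop := EqOn f g I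

/-- The unit tangent `v`. -/
def unitTangent (c : ℝ → E 2) (θ : ℝ) : E 2 := ‖velocity c θ‖⁻¹ • velocity c θ

/-- The unit normal `n`: the unit tangent rotated by `π / 2`. -/
def unitNormal (c : ℝ → E 2) (θ : ℝ) : E 2 := !₂[-(unitTangent c θ 1), unitTangent c θ 0]

/-- The arc-length derivative `D_s h` along `c`. -/
def arcDeriv (c h : ℝ → E 2) (θ : ℝ) : E 2 := ‖velocity c θ‖⁻¹ • velocity h θ

/-- The elastic metric `G^{a,b}_c(h, k)`. -/
def elasticMetric (a b : ℝ) (c h k : ℝ → E 2) : ℝ :=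
  ∫ θ in (0 : ℝ)..(2 * π),
    (a ^ 2 * inner ℝ (arcDeriv c h θ) (unitNormal c θ) * inner ℝ (arcDeriv c k θ) (unitNormal c θ)
      + b ^ 2 * inner ℝ (arcDeriv c h θ) (unitTangent c θ)
          * inner ℝ (arcDeriv c k θ) (unitTangent c θ)) * ‖velocity c θ‖

/-- The `L²`-metric on `ℝⁿ`-valued curves; it does not depend on the base point `q`. -/
def l2Metric {n : ℕ} (_q h k : ℝ → E n) : ℝ := ∫ θ in (0 : ℝ)..(2 * π), inner ℝ (h θ) (k θ)

/-- The transform `R^{a,b}`. -/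
def RTransform (a b : ℝ) (c : ℝ → E 2) (θ : ℝ) : E 3 :=
  √‖velocity c θ‖ •
    !₂[a * unitTangent c θ 0, a * unitTangent c θ 1, √(4 * b ^ 2 - a ^ 2)]

/-- The image of `R^{a,b}`. -/
def imR (a b : ℝ) : Set (ℝ → E 3) := {q | ∃ c ∈ immersions, SameCurve q (RTransform a b c)}

/-! ### Riemannian notions on spaces of curves

In the following, `M` is a set of smooth curves, `rel` is the equivalence relation that says when
two elements of `M` represent the same point of the space in question, and `G c h k` is the
metric. They are used for `Imm / Tra` with the elastic metric, that is
`immersions, SameModTra, elasticMetric a b`, and for `im R` with the `L²`-metric, that is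
`imR a b, SameCurve, l2Metric`. -/

/-- A smooth path in `M` over the time set `J`, that is, a path that is jointly smooth in
`(t, θ)`. -/
def IsSmoothPath {n : ℕ} (M : Set (ℝ → E n)) (J : Set ℝ) (γ : ℝ → ℝ → E n) : Prop :=
  ContDiffOn ℝ ∞ (fun p : ℝ × ℝ => γ p.1 p.2) (J ×ˢ I) ∧ ∀ t ∈ J, γ t ∈ M

/-- The time derivative `∂γ/∂t (t, ·)` of a path over the time set `J`. -/
def timeDeriv {n : ℕ} (J : Set ℝ) (γ : ℝ → ℝ → E n) (t : ℝ) : ℝ → E n :=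
  fun θ => derivWithin (fun τ => γ τ θ) J t

/-- The energy of a path over `[t₀, t₁]`. -/
def energy {n : ℕ} (G : (ℝ → E n) → (ℝ → E n) → (ℝ → E n) → ℝ) (t₀ t₁ : ℝ)
    (γ : ℝ → ℝ → E n) : ℝ :=
  (1 / 2) * ∫ t in t₀..t₁, G (γ t) (timeDeriv (Icc t₀ t₁) γ t) (timeDeriv (Icc t₀ t₁) γ t)

/-- The length of a path over `[0, 1]`. -/
def pathLength {n : ℕ} (G : (ℝ → E n) → (ℝ → E n) → (ℝ → E n) → ℝ) (γ : ℝ → ℝ → E n) : ℝ :=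
  ∫ t in (0 : ℝ)..1, √(G (γ t) (timeDeriv (Icc 0 1) γ t) (timeDeriv (Icc 0 1) γ t))

/-- `γ` is a geodesic over the interval `J`: it is a smooth path and, on every compact
subinterval `[t₀, t₁]`, a critical point of the energy among the smooth variations
`Γ (s, t, θ)` with fixed end points. -/
def IsGeodesic {n : ℕ} (M : Set (ℝ → E n)) (rel : (ℝ → E n) → (ℝ → E n) → Prop)
    (G : (ℝ → E n) → (ℝ → E n) → (ℝ → E n) → ℝ) (J : Set ℝ) (γ : ℝ → ℝ → E n) : Prop :=
  IsSmoothPath M J γ ∧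
  ∀ t₀ ∈ J, ∀ t₁ ∈ J, t₀ < t₁ → ∀ ε > 0, ∀ Γ : ℝ → ℝ → ℝ → E n,
    ContDiffOn ℝ ∞ (fun p : ℝ × ℝ × ℝ => Γ p.1 p.2.1 p.2.2)
      (Ioo (-ε) ε ×ˢ (Icc t₀ t₁ ×ˢ I)) →
    (∀ s ∈ Ioo (-ε) ε, ∀ t ∈ Icc t₀ t₁, Γ s t ∈ M) →
    (∀ t ∈ Icc t₀ t₁, rel (Γ 0 t) (γ t)) →
    (∀ s ∈ Ioo (-ε) ε, rel (Γ s t₀) (γ t₀) ∧ rel (Γ s t₁) (γ t₁)) →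
    HasDerivAt (fun s => energy G t₀ t₁ (Γ s)) 0 0

/-- The lengths of the smooth paths over `[0, 1]` that join (the classes of) `c` and `d`. -/
def joiningLengths {n : ℕ} (M : Set (ℝ → E n)) (rel : (ℝ → E n) → (ℝ → E n) → Prop)
    (G : (ℝ → E n) → (ℝ → E n) → (ℝ → E n) → ℝ) (c d : ℝ → E n) : Set ℝ :=
  {L | ∃ γ, IsSmoothPath M (Icc 0 1) γ ∧ rel (γ 0) c ∧ rel (γ 1) d ∧ L = pathLength G γ}

/-- The geodesic distance between (the classes of) `c` and `d`. -/
def geodesicDist {n : ℕ} (M : Set (ℝ → E n)) (rel : (ℝ → E n) → (ℝ → E n) → Prop)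
    (G : (ℝ → E n) → (ℝ → E n) → (ℝ → E n) → ℝ) (c d : ℝ → E n) : ℝ :=
  sInf (joiningLengths M rel G c d)

/-- `U` is a relatively open subset of `M` in the `C^∞`-topology (uniform convergence of all
derivatives on `[0, 2π]`). -/
def IsOpenIn {n : ℕ} (M U : Set (ℝ → E n)) : Prop :=
  U ⊆ M ∧ ∀ f ∈ U, ∃ N : ℕ, ∃ ε > 0, ∀ g ∈ M,
    (∀ j ≤ N, ∀ θ ∈ I, ‖iteratedDerivWithin j (g - f) I θ‖ < ε) → g ∈ U

/-- The space `(M / rel, G)` is flat: every point has an open neighbourhood `U` with a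
diffeomorphism `D` onto an open subset of the vector space `C^∞([0, 2π], ℝ²)` that carries `G` to
the constant `L²`-metric. Smoothness of `D` and of its inverse means, as usual for maps between
open subsets of Fréchet spaces, that smooth curves are carried to smooth curves; that `D` is
isometric is expressed on the velocity vectors of smooth curves. -/
def IsFlat {n : ℕ} (M : Set (ℝ → E n)) (rel : (ℝ → E n) → (ℝ → E n) → Prop)
    (G : (ℝ → E n) → (ℝ → E n) → (ℝ → E n) → ℝ) : Prop :=
  ∀ c₀ ∈ M, ∃ U : Set (ℝ → E n), ∃ D : (ℝ → E n) → (ℝ → E 2),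
    c₀ ∈ U ∧ IsOpenIn M U ∧ (∀ c ∈ U, ∀ d ∈ M, rel c d → d ∈ U) ∧
    (∀ c ∈ U, ∀ d ∈ U, SameCurve (D c) (D d) ↔ rel c d) ∧
    IsOpenIn (smoothCurves 2) {g | ∃ c ∈ U, SameCurve g (D c)} ∧
    (∀ γ, IsSmoothPath U univ γ → IsSmoothPath (smoothCurves 2) univ (fun t => D (γ t))) ∧
    (∀ γ : ℝ → ℝ → E n, (∀ t, γ t ∈ U) →
      IsSmoothPath (smoothCurves 2) univ (fun t => D (γ t)) →
      ∃ γ', IsSmoothPath U univ γ' ∧ ∀ t, rel (γ' t) (γ t)) ∧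
    (∀ γ, IsSmoothPath U univ γ → ∀ t,
      l2Metric (D (γ t)) (timeDeriv univ (fun τ => D (γ τ)) t)
          (timeDeriv univ (fun τ => D (γ τ)) t)
        = G (γ t) (timeDeriv univ γ t) (timeDeriv univ γ t))

/-! ### The cone -/

/-- The cone `C^{a,b}` without its apex. If `4b² > a²`, then the last two conditions say that
`q₃ > 0`; if `4b² = a²`, the cone is the punctured plane `q₃ = 0`, `(q₁, q₂) ≠ 0`. -/
def cone (a b : ℝ) : Set (E 3) :=
  {q | (4 * b ^ 2 - a ^ 2) * (q 0 ^ 2 + q 1 ^ 2) = a ^ 2 * q 2 ^ 2 ∧ 0 ≤ q 2 ∧ q ≠ 0}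

/-- A geodesic of the cone with the metric induced by `ℝ³`, over the interval `J`: a smooth curve
in the cone that is, on every compact subinterval, a critical point of the energy among the smooth
variations in the cone with fixed end points. -/
def IsConeGeodesic (a b : ℝ) (J : Set ℝ) (x : ℝ → E 3) : Prop :=
  ContDiffOn ℝ ∞ x J ∧ (∀ t ∈ J, x t ∈ cone a b) ∧
  ∀ t₀ ∈ J, ∀ t₁ ∈ J, t₀ < t₁ → ∀ ε > 0, ∀ X : ℝ → ℝ → E 3,
    ContDiffOn ℝ ∞ (fun p : ℝ × ℝ => X p.1 p.2) (Ioo (-ε) ε ×ˢ Icc t₀ t₁) →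
    (∀ s ∈ Ioo (-ε) ε, ∀ t ∈ Icc t₀ t₁, X s t ∈ cone a b) →
    (∀ t ∈ Icc t₀ t₁, X 0 t = x t) →
    (∀ s ∈ Ioo (-ε) ε, X s t₀ = x t₀ ∧ X s t₁ = x t₁) →
    HasDerivAt (fun s => (1 / 2) * ∫ t in t₀..t₁, ‖derivWithin (X s) (Icc t₀ t₁) t‖ ^ 2) 0 0

/-- The length of a curve in `ℝ³` over `[0, 1]`. -/
def spaceLength (x : ℝ → E 3) : ℝ := ∫ t in (0 : ℝ)..1, ‖derivWithin x (Icc 0 1) t‖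

/-- The intrinsic distance of the cone: the infimum of the lengths of the smooth curves in the
cone that join `p` and `q`. -/
def coneDist (a b : ℝ) (p q : E 3) : ℝ :=
  sInf {L | ∃ x : ℝ → E 3, ContDiffOn ℝ ∞ x (Icc 0 1) ∧ (∀ t ∈ Icc (0 : ℝ) 1, x t ∈ cone a b) ∧
    x 0 = p ∧ x 1 = q ∧ L = spaceLength x}

/-- The covering `(r, φ) ↦ (r/m cos mφ, r/m sin mφ, √(4b² - a²)/(2b) r)`, `m = 2b/a`, of the cone
by the polar coordinate domain `r > 0`. -/
def polar (a b r φ : ℝ) : E 3 :=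
  !₂[r / (2 * b / a) * cos (2 * b / a * φ), r / (2 * b / a) * sin (2 * b / a * φ),
    √(4 * b ^ 2 - a ^ 2) / (2 * b) * r]

/-- The distance on the cone along prescribed polar lifts: the infimum of the lengths of the curves
in the cone that have a smooth polar lift from `(r, φ)` to `(r', φ')`. -/
def liftDist (a b r φ r' φ' : ℝ) : ℝ :=
  sInf {L | ∃ ρ ψ : ℝ → ℝ, ContDiffOn ℝ ∞ ρ (Icc 0 1) ∧ ContDiffOn ℝ ∞ ψ (Icc 0 1) ∧
    (∀ t ∈ Icc (0 : ℝ) 1, 0 < ρ t) ∧ ρ 0 = r ∧ ψ 0 = φ ∧ ρ 1 = r' ∧ ψ 1 = φ' ∧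
    L = spaceLength (fun t => polar a b (ρ t) (ψ t))}

/-- `(r, φ)` is a continuous lift of the curve `q` to polar coordinates of the cone. -/
def IsPolarLift (a b : ℝ) (q : ℝ → E 3) (r φ : ℝ → ℝ) : Prop :=
  ContinuousOn r I ∧ ContinuousOn φ I ∧ ∀ θ ∈ I, 0 < r θ ∧ polar a b (r θ) (φ θ) = q θ

end ElasticCurves

end

open ElasticCurves

/-!
The proof rests on one coordinate. With `ℓ = log r + i φ`, the polar covering of the cone is
`polarExp a b : ℂ → ℝ³`, and a direct computation (`hasDerivWithinAt_polarExp`) shows that the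
metric of the cone, pulled back by it, is the metric pulled back from `ℂ` by `exp`: the cone is
developed onto the plane by `exp ℓ = r e^{iφ}`. The transform `R` sends the velocity
`velocityExp a b ℓ` to the point `polarExp a b ℓ`, so an immersion is determined up to translation
by a lift `ℓ : [0, 2π] → ℂ`, every smooth `ℓ` occurs, and two lifts of one curve differ by one
constant multiple of the period `i π a / b`. In this coordinate both the elastic metric
(`elasticMetric_timeDeriv`) and the `L²`-metric on the image of `R` (`l2Metric_timeDeriv`) become
the constant `L²`-metric of the plane curves `exp ∘ ℓ`. The structure `PolarModel` collects these
facts, and everything else is deduced from it for both spaces at once.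

* Flatness: `c ↦ exp ∘ ℓ`, with `ℓ` the lift close to a given one, is an isometric chart
  (`PolarModel.isFlat`).
* Geodesics: the energy of a path is the Dirichlet energy of `exp ∘ ℓ`, and variations lift with
  their end points fixed. Hence the critical points are the paths for which `exp (ℓ t θ)` is affine
  in `t`, because shrinking the deviation from the affine path lowers the energy to first order
  (`PolarModel.isGeodesic_iff`). The same argument for a single point gives the geodesics of the
  cone (`isConeGeodesic_iff`), and the condition holds for a path of curves if and only if it holds
  for each `θ`.
* Distances: the lower bound `√(coverSq z w)` for lengths in the developed cone comes from a
  calibration (`exists_calibration`, `sqrt_coverSq_le_expLength`). It is the infimum, because a path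
  that is a straight segment after division of the angle by a factor slightly above
  `max 1 (|Δφ| / π)` has nearly this length (`segPath`, `segEnergy_stretch_zero`); if
  `|Δφ| ≥ π` the minimizing path runs through the apex and is only approximated. For curves these
  paths are used for every `θ` simultaneously, so the factor is chosen to depend smoothly on
  `Δφ` (`stretch`). The matching lower bound follows from Fubini and the Cauchy–Schwarz inequality
  (`sqrt_integral_coverSq_le`). The winding index is constant in `θ` because lifts are continuous,
  and the minimum over it is attained because all large indices give the same value.
-/

open Filter Topology

noncomputable section

namespace ElasticCurves

/-! ### Integrals and partial derivatives of smooth families -/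

section ParametricIntegral

-- `P` and `V` share a universe because the induction below replaces `V` by `P →L[ℝ] V`
universe u
variable {P V : Type u} [NormedAddCommGroup P] [NormedSpace ℝ P]
  [NormedAddCommGroup V] [NormedSpace ℝ V]

omit [NormedSpace ℝ P] [NormedSpace ℝ V] in
theorem intervalIntegrable_of_prod {F : P × ℝ → V} {S : Set P} {α β : ℝ} (h : α ≤ β)
    (hF : ContinuousOn F (S ×ˢ Icc α β)) {p : P} (hp : p ∈ S) :
    IntervalIntegrable (fun θ => F (p, θ)) volume α β := by
  apply ContinuousOn.intervalIntegrable
  rw [uIcc_of_le h]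
  exact hF.comp (by fun_prop) fun θ hθ => ⟨hp, hθ⟩

omit [NormedSpace ℝ P] [NormedSpace ℝ V] in
theorem exists_nhdsWithin_forall_dist_lt {F : P × ℝ → V} {S : Set P} {α β : ℝ}
    (hF : ContinuousOn F (S ×ˢ Icc α β)) {p : P} (hp : p ∈ S) {ε : ℝ} (hε : 0 < ε) :
    ∃ δ > 0, ∀ x ∈ S, dist x p < δ → ∀ θ ∈ Icc α β, ‖F (x, θ) - F (p, θ)‖ < ε := by
  obtain ⟨v, hv, h⟩ := isCompact_Icc.mem_uniformity_of_prod (f := fun p θ => F (p, θ))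
    (s := S) (k := Icc α β) (q := p) hF hp (Metric.dist_mem_uniformity hε)
  obtain ⟨δ, hδ, hv⟩ := Metric.mem_nhdsWithin_iff.1 hv
  refine ⟨δ, hδ, fun x hx hxp θ hθ => ?_⟩
  rw [← dist_eq_norm]
  exact h x (hv ⟨hxp, hx⟩) θ hθ

omit [NormedSpace ℝ P] in
theorem continuousOn_integral_of_prod {F : P × ℝ → V} {S : Set P} {α β : ℝ} (h : α ≤ β)
    (hF : ContinuousOn F (S ×ˢ Icc α β)) :
    ContinuousOn (fun p => ∫ θ in α..β, F (p, θ)) S := by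
  intro p hp
  rw [ContinuousWithinAt, Metric.tendsto_nhdsWithin_nhds]
  intro ε hε
  have hk : 0 < ε / (β - α + 1) := by
    have : 0 ≤ β - α := sub_nonneg.2 h
    positivity
  obtain ⟨δ, hδ, H⟩ := exists_nhdsWithin_forall_dist_lt hF hp hk
  refine ⟨δ, hδ, fun {x} hx hxp => ?_⟩
  rw [dist_eq_norm, ← intervalIntegral.integral_sub (intervalIntegrable_of_prod h hF hx)
    (intervalIntegrable_of_prod h hF hp)]
  refine (intervalIntegral.norm_integral_le_of_norm_le_const (C := ε / (β - α + 1))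
    fun θ hθ => (H x hx hxp θ ?_).le).trans_lt ?_
  · rw [uIoc_of_le h] at hθ
    exact ⟨hθ.1.le, hθ.2⟩
  · have : 0 ≤ β - α := sub_nonneg.2 h
    rw [abs_of_nonneg this, div_mul_eq_mul_div, div_lt_iff₀ (by positivity)]
    nlinarith

/-- Differentiation under the integral sign on a convex set of parameters, whose points may lie on
its boundary. -/
theorem hasFDerivWithinAt_integral_of_prod [CompleteSpace V] {F : P × ℝ → V}
    {F' : P × ℝ → P →L[ℝ] V} {S : Set P} {α β : ℝ} (h : α ≤ β) (hS : Convex ℝ S)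
    (hF : ContinuousOn F (S ×ˢ Icc α β)) (hF' : ContinuousOn F' (S ×ˢ Icc α β))
    (hd : ∀ p ∈ S, ∀ θ ∈ Icc α β, HasFDerivWithinAt (fun x => F (x, θ)) (F' (p, θ)) S p)
    {p : P} (hp : p ∈ S) :
    HasFDerivWithinAt (fun p => ∫ θ in α..β, F (p, θ)) (∫ θ in α..β, F' (p, θ)) S p := by
  rw [hasFDerivWithinAt_iff_isLittleO, Asymptotics.isLittleO_iff]
  intro ε hε
  have hk : 0 < ε / (β - α + 1) := by
    have : 0 ≤ β - α := sub_nonneg.2 h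
    positivity
  obtain ⟨δ, hδ, H⟩ := exists_nhdsWithin_forall_dist_lt hF' hp hk
  filter_upwards [inter_mem_nhdsWithin S (Metric.ball_mem_nhds p hδ)] with x hx
  have hint := intervalIntegrable_of_prod h hF' hp
  have e : (∫ θ in α..β, F (x, θ)) - (∫ θ in α..β, F (p, θ)) - (∫ θ in α..β, F' (p, θ)) (x - p)
      = ∫ θ in α..β, (F (x, θ) - F (p, θ) - F' (p, θ) (x - p)) := by
    rw [intervalIntegral.integral_sub, intervalIntegral.integral_sub
      (intervalIntegrable_of_prod h hF hx.1) (intervalIntegrable_of_prod h hF hp),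
      ContinuousLinearMap.intervalIntegral_apply hint]
    · exact (intervalIntegrable_of_prod h hF hx.1).sub (intervalIntegrable_of_prod h hF hp)
    · apply ContinuousOn.intervalIntegrable
      rw [uIcc_of_le h]
      exact (hF'.comp (by fun_prop) fun θ hθ => ⟨hp, hθ⟩).clm_apply continuousOn_const
  rw [e]
  refine (intervalIntegral.norm_integral_le_of_norm_le_const
    (C := ε / (β - α + 1) * ‖x - p‖) fun θ hθ => ?_).trans ?_
  · rw [uIoc_of_le h] at hθ
    have hθ' : θ ∈ Icc α β := ⟨hθ.1.le, hθ.2⟩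
    have hc : Convex ℝ (S ∩ Metric.ball p δ) := hS.inter (convex_ball p δ)
    exact hc.norm_image_sub_le_of_norm_hasFDerivWithin_le' (f := fun x => F (x, θ))
      (f' := fun x => F' (x, θ)) (φ := F' (p, θ))
      (fun y hy => (hd y hy.1 θ hθ').mono inter_subset_left)
      (fun y hy => (H y hy.1 hy.2 θ hθ').le) ⟨hp, Metric.mem_ball_self hδ⟩ hx
  · have : 0 ≤ β - α := sub_nonneg.2 h
    rw [abs_of_nonneg this, mul_right_comm]
    refine mul_le_mul_of_nonneg_right ?_ (norm_nonneg _)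
    rw [div_mul_eq_mul_div, div_le_iff₀ (by positivity)]
    nlinarith

theorem contDiffOn_integral_of_prod [CompleteSpace V] {F : P × ℝ → V} {S : Set P}
    {α β : ℝ} (h : α < β) (hS : Convex ℝ S) (hS' : (interior S).Nonempty)
    (hF : ContDiffOn ℝ ∞ F (S ×ˢ Icc α β)) :
    ContDiffOn ℝ ∞ (fun p => ∫ θ in α..β, F (p, θ)) S := by
  have hU : UniqueDiffOn ℝ S := uniqueDiffOn_convex hS hS'
  have hUU : UniqueDiffOn ℝ (S ×ˢ Icc α β) := hU.prod (uniqueDiffOn_Icc h)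
  refine contDiffOn_infty.2 fun n => ?_
  have hF' := contDiffOn_infty.1 hF n
  clear hF
  induction n generalizing V with
  | zero =>
    exact contDiffOn_zero.2 (continuousOn_integral_of_prod h.le hF'.continuousOn)
  | succ n ih =>
    have hd : ∀ p ∈ S, ∀ θ ∈ Icc α β, HasFDerivWithinAt (fun x => F (x, θ))
        ((fderivWithin ℝ F (S ×ˢ Icc α β) (p, θ)).comp (ContinuousLinearMap.inl ℝ P ℝ)) S p := by
      intro p hp θ hθ
      have h1 := (hF'.differentiableOn (by simp) (p, θ) ⟨hp, hθ⟩).hasFDerivWithinAt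
      have h2 : HasFDerivWithinAt (fun x : P => (x, θ)) (ContinuousLinearMap.inl ℝ P ℝ) S p :=
        (hasFDerivWithinAt_id p S).prodMk (hasFDerivWithinAt_const θ p S)
      exact HasFDerivWithinAt.comp p h1 h2 fun x hx => ⟨hx, hθ⟩
    have hc : ContDiffOn ℝ n (fun q : P × ℝ => (fderivWithin ℝ F (S ×ˢ Icc α β) q).comp
        (ContinuousLinearMap.inl ℝ P ℝ)) (S ×ˢ Icc α β) :=
      (hF'.fderivWithin hUU (by simp)).clm_comp contDiffOn_const
    have hD := fun p hp => hasFDerivWithinAt_integral_of_prod h.le hS hF'.continuousOn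
      hc.continuousOn hd (p := p) hp
    rw [show ((n + 1 : ℕ) : WithTop ℕ∞) = (n : WithTop ℕ∞) + 1 by norm_cast,
      contDiffOn_succ_iff_hasFDerivWithinAt_of_uniqueDiffOn hU]
    exact ⟨by simp, _, ih hc, hD⟩

/-- The primitive in the last variable of a smooth function is smooth in all variables. -/
theorem contDiffOn_primitive {F : P × ℝ → V} [CompleteSpace V] {S : Set P} {β : ℝ} (h : 0 < β)
    (hS : Convex ℝ S) (hS' : (interior S).Nonempty) (hF : ContDiffOn ℝ ∞ F (S ×ˢ Icc 0 β)) :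
    ContDiffOn ℝ ∞ (fun q : P × ℝ => ∫ θ in (0 : ℝ)..q.2, F (q.1, θ)) (S ×ˢ Icc 0 β) := by
  -- rescaling to `[0, 1]` turns the variable end point into a parameter
  have h1 : ∀ q : P × ℝ, ∫ θ in (0 : ℝ)..q.2, F (q.1, θ)
      = q.2 • ∫ u in (0 : ℝ)..1, F (q.1, q.2 * u) := by
    intro q
    rw [intervalIntegral.smul_integral_comp_mul_left (f := fun θ => F (q.1, θ))]
    simp
  simp_rw [h1]
  refine contDiffOn_snd.smul ?_
  refine contDiffOn_integral_of_prod (P := P × ℝ)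
    (F := fun q => F (q.1.1, q.1.2 * q.2)) one_pos (hS.prod (convex_Icc 0 β)) ?_ ?_
  · rw [interior_prod_eq, interior_Icc]
    exact hS'.prod (nonempty_Ioo.2 h)
  · refine hF.comp (by fun_prop) ?_
    rintro ⟨⟨p, θ⟩, u⟩ ⟨⟨hp, hθ⟩, hu⟩
    exact ⟨hp, mul_nonneg hθ.1 hu.1,
      (mul_le_of_le_one_right hθ.1 hu.2).trans hθ.2⟩

end ParametricIntegral

section Partial

variable {X V : Type*} [NormedAddCommGroup X] [NormedSpace ℝ X]
  [NormedAddCommGroup V] [NormedSpace ℝ V]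

theorem hasDerivWithinAt_line {f : X → V} {A : Set X} (hf : DifferentiableOn ℝ f A) {g : ℝ → X}
    {e : X} {B : Set ℝ} (hg : ∀ t, HasDerivAt g e t) (hgB : MapsTo g B A) {t : ℝ} (ht : t ∈ B) :
    HasDerivWithinAt (fun τ => f (g τ)) (fderivWithin ℝ f A (g t) e) B t :=
  (hf (g t) (hgB ht)).hasFDerivWithinAt.comp_hasDerivWithinAt t (hg t).hasDerivWithinAt hgB

variable {P : Type*} [NormedAddCommGroup P] [NormedSpace ℝ P]

theorem hasDerivWithinAt_snd {f : P × ℝ → V} {S : Set P} {B : Set ℝ}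
    (hf : DifferentiableOn ℝ f (S ×ˢ B)) {p : P} (hp : p ∈ S) {θ : ℝ} (hθ : θ ∈ B) :
    HasDerivWithinAt (fun θ => f (p, θ)) (fderivWithin ℝ f (S ×ˢ B) (p, θ) (0, 1)) B θ :=
  hasDerivWithinAt_line hf (g := fun θ => (p, θ))
    (fun θ => (hasDerivAt_const θ p).prodMk (hasDerivAt_id θ)) (fun _ h => ⟨hp, h⟩) hθ

theorem hasDerivWithinAt_fst {f : ℝ × P → V} {S : Set P} {B : Set ℝ}
    (hf : DifferentiableOn ℝ f (B ×ˢ S)) {p : P} (hp : p ∈ S) {t : ℝ} (ht : t ∈ B) :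
    HasDerivWithinAt (fun t => f (t, p)) (fderivWithin ℝ f (B ×ˢ S) (t, p) (1, 0)) B t :=
  hasDerivWithinAt_line hf (g := fun t => (t, p))
    (fun t => (hasDerivAt_id t).prodMk (hasDerivAt_const t p)) (fun _ h => ⟨h, hp⟩) ht

theorem contDiffOn_fderivWithin_apply_const {f : X → V} {A : Set X} (hf : ContDiffOn ℝ ∞ f A)
    (hA : UniqueDiffOn ℝ A) (e : X) : ContDiffOn ℝ ∞ (fun x => fderivWithin ℝ f A x e) A :=
  (hf.fderivWithin hA le_rfl).clm_apply contDiffOn_const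

theorem contDiffOn_derivWithin_snd {f : P × ℝ → V} {S : Set P} {B : Set ℝ}
    (hf : ContDiffOn ℝ ∞ f (S ×ˢ B)) (hS : UniqueDiffOn ℝ S) (hB : UniqueDiffOn ℝ B) :
    ContDiffOn ℝ ∞ (fun q : P × ℝ => derivWithin (fun θ => f (q.1, θ)) B q.2) (S ×ˢ B) :=
  (contDiffOn_fderivWithin_apply_const hf (hS.prod hB) (0, 1)).congr fun q hq =>
    (hasDerivWithinAt_snd (hf.differentiableOn (by simp)) hq.1 hq.2).derivWithin (hB _ hq.2)

theorem contDiffOn_derivWithin_fst {f : ℝ × P → V} {S : Set P} {B : Set ℝ}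
    (hf : ContDiffOn ℝ ∞ f (B ×ˢ S)) (hS : UniqueDiffOn ℝ S) (hB : UniqueDiffOn ℝ B) :
    ContDiffOn ℝ ∞ (fun q : ℝ × P => derivWithin (fun t => f (t, q.2)) B q.1) (B ×ˢ S) :=
  (contDiffOn_fderivWithin_apply_const hf (hB.prod hS) (1, 0)).congr fun q hq =>
    (hasDerivWithinAt_fst (hf.differentiableOn (by simp)) hq.2 hq.1).derivWithin (hB _ hq.1)

/-- Mixed partial derivatives on a product of intervals, end points included, commute. -/
theorem derivWithin_derivWithin_comm {f : ℝ × ℝ → V} {A B : Set ℝ}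
    (hf : ContDiffOn ℝ ∞ f (A ×ˢ B)) (hA : Convex ℝ A) (hA' : (interior A).Nonempty)
    (hB : Convex ℝ B) (hB' : (interior B).Nonempty) {t θ : ℝ} (ht : t ∈ A) (hθ : θ ∈ B) :
    derivWithin (fun θ => derivWithin (fun t => f (t, θ)) A t) B θ
      = derivWithin (fun t => derivWithin (fun θ => f (t, θ)) B θ) A t := by
  have uA := uniqueDiffOn_convex hA hA'
  have uB := uniqueDiffOn_convex hB hB'
  have uAB := uA.prod uB
  have hd : DifferentiableOn ℝ f (A ×ˢ B) := hf.differentiableOn (by simp)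
  have hq : ((t, θ) : ℝ × ℝ) ∈ A ×ˢ B := ⟨ht, hθ⟩
  have hd' : ∀ e, DifferentiableOn ℝ (fun q => fderivWithin ℝ f (A ×ˢ B) q e) (A ×ˢ B) := fun e =>
    (contDiffOn_fderivWithin_apply_const hf uAB e).differentiableOn (by simp)
  have hD : DifferentiableWithinAt ℝ (fderivWithin ℝ f (A ×ˢ B)) (A ×ˢ B) (t, θ) :=
    (hf.fderivWithin uAB (m := ∞) le_rfl).differentiableOn (by simp) _ hq
  have hap : ∀ e e', fderivWithin ℝ (fun q => fderivWithin ℝ f (A ×ˢ B) q e) (A ×ˢ B) (t, θ) e'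
      = fderivWithin ℝ (fderivWithin ℝ f (A ×ˢ B)) (A ×ˢ B) (t, θ) e' e := by
    intro e e'
    rw [fderivWithin_clm_apply (uAB _ hq) hD (differentiableWithinAt_const e)]
    simp
  -- both sides are values of the second derivative, which is symmetric at the points of the
  -- closure of the interior
  have e1 : EqOn (fun θ => derivWithin (fun t => f (t, θ)) A t)
      (fun θ => fderivWithin ℝ f (A ×ˢ B) (t, θ) (1, 0)) B := fun y hy =>
    (hasDerivWithinAt_fst hd hy ht).derivWithin (uA _ ht)
  have e2 : EqOn (fun t => derivWithin (fun θ => f (t, θ)) B θ)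
      (fun t => fderivWithin ℝ f (A ×ˢ B) (t, θ) (0, 1)) A := fun x hx =>
    (hasDerivWithinAt_snd hd hx hθ).derivWithin (uB _ hθ)
  rw [derivWithin_congr e1 (e1 hθ), derivWithin_congr e2 (e2 ht),
    (hasDerivWithinAt_snd (hd' (1, 0)) ht hθ).derivWithin (uB _ hθ),
    (hasDerivWithinAt_fst (hd' (0, 1)) hθ ht).derivWithin (uA _ ht), hap, hap]
  refine (ContDiffWithinAt.isSymmSndFDerivWithinAt (hf _ hq)
    (by simpa using WithTop.coe_le_coe.2 (le_top : (2 : ℕ∞) ≤ ⊤)) uAB ?_ hq) _ _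
  rw [interior_prod_eq, closure_prod_eq, hA.closure_interior_eq_closure_of_nonempty_interior hA',
    hB.closure_interior_eq_closure_of_nonempty_interior hB']
  exact ⟨subset_closure ht, subset_closure hθ⟩

end Partial

/-! ### Smooth logarithms -/

section Log

variable {X : Type*} [NormedAddCommGroup X] [NormedSpace ℝ X]

theorem contDiffAt_clog {z : ℂ} (hz : z ∈ Complex.slitPlane) :
    ContDiffAt ℝ ∞ Complex.log z :=
  (Complex.contDiffAt_log hz (n := ∞)).restrict_scalars ℝ

/-- A convex set is simply connected, so a nonvanishing function lifts through the covering
`exp`. -/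
theorem exists_continuousOn_log {A : Set X} (hA : Convex ℝ A) {f : X → ℂ}
    (hf : ContinuousOn f A) (h0 : ∀ x ∈ A, f x ≠ 0) :
    ∃ l : X → ℂ, ContinuousOn l A ∧ ∀ x ∈ A, Complex.exp (l x) = f x := by
  classical
  rcases A.eq_empty_or_nonempty with rfl | ⟨x₀, hx₀⟩
  · exact ⟨0, by simp, by simp⟩
  have : ContractibleSpace A := hA.contractibleSpace ⟨x₀, hx₀⟩
  have : LocallyPathConnectedSpace A := hA.locallyPathConnectedSpace
  obtain ⟨F, ⟨-, hF⟩, -⟩ := Complex.isCoveringMapOn_exp.existsUnique_continuousMap_lifts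
    ⟨A.domRestrict f, continuousOn_iff_continuous_domRestrict.mp hf⟩ (a₀ := ⟨x₀, hx₀⟩)
    (Complex.exp_log (h0 x₀ hx₀)) (fun x => h0 x x.2)
  refine ⟨fun x => if hx : x ∈ A then F ⟨x, hx⟩ else 0, ?_, fun x hx => ?_⟩
  · rw [continuousOn_iff_continuous_domRestrict]
    convert! map_continuous F
    ext x
    simp
  · simpa [hx] using congr($hF ⟨x, hx⟩)

/-- A continuous logarithm of a smooth function is smooth. -/
theorem contDiffOn_of_exp {A : Set X} {f l : X → ℂ}
    (hf : ContDiffOn ℝ ∞ f A) (hl : ContinuousOn l A) (h : ∀ x ∈ A, Complex.exp (l x) = f x) :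
    ContDiffOn ℝ ∞ l A := by
  intro x hx
  have h0 : f x ≠ 0 := h x hx ▸ Complex.exp_ne_zero _
  -- near `x`, the imaginary part of `l - l x` stays in `(-π, π)`, where `log` inverts `exp`
  have hev : ∀ᶠ y in 𝓝[A] x, (l y - l x).im ∈ Ioo (-π) π := by
    have hc : ContinuousWithinAt (fun y => (l y - l x).im) A x :=
      Complex.continuous_im.continuousAt.comp_continuousWithinAt
        ((hl x hx).sub continuousWithinAt_const)
    exact hc.eventually_mem (Ioo_mem_nhds (by simp [pi_pos]) (by simp [pi_pos]))
  have hg : ContDiffWithinAt ℝ ∞ (fun y => l x + Complex.log (f y * (f x)⁻¹)) A x := by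
    refine contDiffWithinAt_const.add (ContDiffAt.comp_contDiffWithinAt x (contDiffAt_clog ?_)
      ((hf x hx).mul contDiffWithinAt_const))
    simp [h0]
  refine hg.congr_of_eventuallyEq_of_mem ?_ hx
  filter_upwards [hev, self_mem_nhdsWithin] with y hy hyA
  rw [← h y hyA, ← h x hx, ← Complex.exp_neg, ← Complex.exp_add, ← sub_eq_add_neg,
    Complex.log_exp hy.1 hy.2.le]
  ring

theorem exists_contDiffOn_log {A : Set X} (hA : Convex ℝ A) {f : X → ℂ}
    (hf : ContDiffOn ℝ ∞ f A) (h0 : ∀ x ∈ A, f x ≠ 0) :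
    ∃ l : X → ℂ, ContDiffOn ℝ ∞ l A ∧ ∀ x ∈ A, Complex.exp (l x) = f x := by
  obtain ⟨l, hl, h⟩ := exists_continuousOn_log hA hf.continuousOn h0
  exact ⟨l, contDiffOn_of_exp hf hl h, h⟩

/-- A continuous function on a preconnected set with values in `p ℤ` is constant. -/
theorem eq_of_forall_exists_int_mul {X : Type*} [TopologicalSpace X] {A : Set X}
    (hA : IsPreconnected A) {f : X → ℝ} {p : ℝ} (hp : p ≠ 0) (hf : ContinuousOn f A)
    (h : ∀ x ∈ A, ∃ k : ℤ, f x = k * p) {x y : X} (hx : x ∈ A) (hy : y ∈ A) : f x = f y := by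
  have hI : IsPreconnected ((fun x => f x / p) '' A) := hA.image _ (hf.div_const p)
  obtain ⟨k, hk⟩ := h x hx
  obtain ⟨l, hl⟩ := h y hy
  have hkx : f x / p = k := by simp [hk, hp]
  have hly : f y / p = l := by simp [hl, hp]
  -- two different values would enclose a half-integer value of `f / p`
  have key : ∀ k l : ℤ, (k : ℝ) ∈ (fun x => f x / p) '' A → (l : ℝ) ∈ (fun x => f x / p) '' A →
      ¬ k < l := by
    intro k l hk hl hkl
    have hkl' : (k : ℝ) + 1 ≤ l := by exact_mod_cast hkl
    obtain ⟨z, hz, hz'⟩ := hI.Icc_subset hk hl (show (k : ℝ) + 1 / 2 ∈ Icc (k : ℝ) l from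
      ⟨by linarith, by linarith⟩)
    obtain ⟨n, hn⟩ := h z hz
    simp only [hn, mul_div_cancel_right₀ _ hp] at hz'
    have : (2 * n : ℤ) = 2 * k + 1 := by
      have : (2 * n : ℝ) = 2 * k + 1 := by linarith
      exact_mod_cast this
    omega
  have h1 : (k : ℝ) ∈ (fun x => f x / p) '' A := ⟨x, hx, hkx⟩
  have h2 : (l : ℝ) ∈ (fun x => f x / p) '' A := ⟨y, hy, hly⟩
  rw [hk, hl, le_antisymm (not_lt.1 (key l k h2 h1)) (not_lt.1 (key k l h1 h2))]

end Log

/-! ### Logarithmic coordinates of the cone -/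

/-- The polar covering of the cone in the logarithmic coordinate `ℓ = log r + i φ`. -/
def polarExp (a b : ℝ) (ℓ : ℂ) : E 3 := polar a b (Real.exp ℓ.re) ℓ.im

/-- The velocity vector whose image under the transform has the logarithmic coordinate `ℓ`. -/
def velocityExp (a b : ℝ) (ℓ : ℂ) : E 2 :=
  (Real.exp (2 * ℓ.re) / (4 * b ^ 2)) • !₂[cos (2 * b / a * ℓ.im), sin (2 * b / a * ℓ.im)]

variable {a b : ℝ}

theorem contDiff_polarExp : ContDiff ℝ ∞ (polarExp a b) := by
  rw [contDiff_euclidean]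
  have h1 : ContDiff ℝ ∞ (fun z : ℂ => z.re) := Complex.reCLM.contDiff
  have h2 : ContDiff ℝ ∞ (fun z : ℂ => z.im) := Complex.imCLM.contDiff
  intro i
  fin_cases i <;> simp [polarExp, polar] <;> fun_prop

theorem contDiff_velocityExp : ContDiff ℝ ∞ (velocityExp a b) := by
  rw [contDiff_euclidean]
  have h1 : ContDiff ℝ ∞ (fun z : ℂ => z.re) := Complex.reCLM.contDiff
  have h2 : ContDiff ℝ ∞ (fun z : ℂ => z.im) := Complex.imCLM.contDiff
  intro i
  fin_cases i <;> simp [velocityExp] <;> fun_prop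

theorem norm_sq_E3 (x : E 3) : ‖x‖ ^ 2 = x 0 ^ 2 + x 1 ^ 2 + x 2 ^ 2 := by
  simp [EuclideanSpace.norm_sq_eq, Fin.sum_univ_three]

theorem norm_sq_E2 (x : E 2) : ‖x‖ ^ 2 = x 0 ^ 2 + x 1 ^ 2 := by
  simp [EuclideanSpace.norm_sq_eq, Fin.sum_univ_two]

theorem hasDerivWithinAt_of_coords {n : ℕ} {f : ℝ → E n} {f' : E n} {B : Set ℝ} {t : ℝ}
    (h : ∀ i, HasDerivWithinAt (fun t => f t i) (f' i) B t) : HasDerivWithinAt f f' B t := by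
  refine hasFDerivWithinAt_euclidean.2 fun i => ?_
  convert! (h i).hasFDerivWithinAt

/-- The polar covering is isometric for the metric that the exponential pulls back from `ℂ`. -/
theorem hasDerivWithinAt_polarExp (ha : 0 < a) (hb : 0 < b) (hab : a ^ 2 ≤ 4 * b ^ 2)
    {f : ℝ → ℂ} {f' : ℂ} {B : Set ℝ} {t : ℝ} (hf : HasDerivWithinAt f f' B t) :
    ∃ v : E 3, HasDerivWithinAt (fun t => polarExp a b (f t)) v B t ∧
      ‖v‖ = ‖f' * Complex.exp (f t)‖ := by
  have hre : HasDerivWithinAt (fun t => (f t).re) f'.re B t :=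
    Complex.reCLM.hasFDerivAt.comp_hasDerivWithinAt t hf
  have him : HasDerivWithinAt (fun t => (f t).im) f'.im B t :=
    Complex.imCLM.hasFDerivAt.comp_hasDerivWithinAt t hf
  set m := 2 * b / a
  set x := (f t).re
  set y := (f t).im
  have hm : m ≠ 0 := by positivity
  have hr : HasDerivWithinAt (fun t => Real.exp (f t).re / m) (Real.exp x * f'.re / m) B t :=
    hre.exp.div_const m
  have hc : HasDerivWithinAt (fun t => cos (m * (f t).im)) (-sin (m * y) * (m * f'.im)) B t :=
    (him.const_mul m).cos
  have hs : HasDerivWithinAt (fun t => sin (m * (f t).im)) (cos (m * y) * (m * f'.im)) B t :=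
    (him.const_mul m).sin
  set κ := √(4 * b ^ 2 - a ^ 2) / (2 * b)
  -- the slope of the cone is such that the radial direction has unit speed
  have hκ : κ ^ 2 = 1 - 1 / m ^ 2 := by
    simp only [κ, m, div_pow]
    rw [sq_sqrt (by linarith)]
    field_simp
    ring
  refine ⟨!₂[Real.exp x * f'.re / m * cos (m * y)
      + Real.exp x / m * (-sin (m * y) * (m * f'.im)),
    Real.exp x * f'.re / m * sin (m * y) + Real.exp x / m * (cos (m * y) * (m * f'.im)),
    κ * (Real.exp x * f'.re)], hasDerivWithinAt_of_coords fun i => ?_, ?_⟩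
  · fin_cases i
    · exact hr.mul hc
    · exact hr.mul hs
    · exact hre.exp.const_mul κ
  · rw [← sq_eq_sq₀ (norm_nonneg _) (norm_nonneg _), norm_sq_E3, norm_mul, Complex.norm_exp,
      mul_pow, Complex.sq_norm, Complex.normSq_apply]
    simp only [Matrix.cons_val_zero, Matrix.cons_val_one, Matrix.cons_val]
    have h1 := sin_sq_add_cos_sq (m * y)
    rw [mul_pow κ, hκ]
    field_simp
    linear_combination (Real.exp x ^ 2 * (f'.re ^ 2 + m ^ 2 * f'.im ^ 2)) * h1

/-- The velocity of `velocityExp` along a curve: `2 x'` in the tangential and `m y'` in the normal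
direction, where `x + i y` is the logarithmic coordinate. -/
theorem hasDerivWithinAt_velocityExp {f : ℝ → ℂ} {f' : ℂ} {B : Set ℝ} {t : ℝ}
    (hf : HasDerivWithinAt f f' B t) :
    HasDerivWithinAt (fun t => velocityExp a b (f t))
      ((2 * f'.re) • velocityExp a b (f t) + (2 * b / a * f'.im) •
        !₂[-(velocityExp a b (f t) 1), velocityExp a b (f t) 0]) B t := by
  have hre : HasDerivWithinAt (fun t => (f t).re) f'.re B t :=
    Complex.reCLM.hasFDerivAt.comp_hasDerivWithinAt t hf
  have him : HasDerivWithinAt (fun t => (f t).im) f'.im B t :=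
    Complex.imCLM.hasFDerivAt.comp_hasDerivWithinAt t hf
  have hr := ((hre.const_mul 2).exp).div_const (4 * b ^ 2)
  have hc := (him.const_mul (2 * b / a)).cos
  have hs := (him.const_mul (2 * b / a)).sin
  refine hasDerivWithinAt_of_coords fun i => ?_
  fin_cases i
  · convert! hr.mul hc using 1
    simp [velocityExp]
    ring
  · convert! hr.mul hs using 1
    simp [velocityExp]
    ring

theorem norm_velocityExp (ℓ : ℂ) : ‖velocityExp a b ℓ‖ = Real.exp (2 * ℓ.re) / (4 * b ^ 2) := by
  rw [velocityExp, norm_smul, Real.norm_of_nonneg (by positivity)]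
  have : ‖(!₂[cos (2 * b / a * ℓ.im), sin (2 * b / a * ℓ.im)] : E 2)‖ = 1 := by
    rw [← sq_eq_sq₀ (norm_nonneg _) zero_le_one, norm_sq_E2]
    simp
  rw [this, mul_one]

theorem velocityExp_ne_zero (hb : 0 < b) (ℓ : ℂ) : velocityExp a b ℓ ≠ 0 := by
  rw [← norm_ne_zero_iff, norm_velocityExp]
  positivity

theorem velocityExp_smul (hb : 0 < b) (ℓ : ℂ) : ‖velocityExp a b ℓ‖⁻¹ • velocityExp a b ℓ
    = !₂[cos (2 * b / a * ℓ.im), sin (2 * b / a * ℓ.im)] := by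
  rw [norm_velocityExp, velocityExp, smul_smul, inv_mul_cancel₀ (by positivity), one_smul]

theorem polarExp_mem_cone (ha : 0 < a) (hb : 0 < b) (hab : a ^ 2 ≤ 4 * b ^ 2) (ℓ : ℂ) :
    polarExp a b ℓ ∈ cone a b := by
  have ha' := ha.ne'
  have hb' := hb.ne'
  have h1 := sin_sq_add_cos_sq (2 * b / a * ℓ.im)
  have h2 : √(4 * b ^ 2 - a ^ 2) ^ 2 = 4 * b ^ 2 - a ^ 2 := sq_sqrt (by linarith)
  refine ⟨?_, ?_, fun h => ?_⟩
  · simp only [polarExp, polar, PiLp.toLp_apply, Matrix.cons_val_zero, Matrix.cons_val_one,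
      Matrix.cons_val, mul_pow, div_pow, h2]
    generalize 2 * b / a * ℓ.im = y at h1
    field_simp
    linear_combination (4 * b ^ 2 - a ^ 2) * h1
  · simp only [polarExp, polar, PiLp.toLp_apply, Matrix.cons_val]
    positivity
  · have e0 : Real.exp ℓ.re / (2 * b / a) * cos (2 * b / a * ℓ.im) = 0 := congr($h 0)
    have e1 : Real.exp ℓ.re / (2 * b / a) * sin (2 * b / a * ℓ.im) = 0 := congr($h 1)
    have hne : Real.exp ℓ.re / (2 * b / a) ≠ 0 := by positivity
    simp only [mul_eq_zero, hne, false_or] at e0 e1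
    simp [e0, e1] at h1

theorem exp_mul_cos_sin_eq {x y x' y' : ℝ} (h0 : Real.exp x * cos y = Real.exp x' * cos y')
    (h1 : Real.exp x * sin y = Real.exp x' * sin y') : x = x' ∧ ∃ k : ℤ, y = y' + k * (2 * π) := by
  have : Complex.exp ⟨x, y⟩ = Complex.exp ⟨x', y'⟩ := by
    apply Complex.ext <;> simp [Complex.exp_re, Complex.exp_im, h0, h1]
  obtain ⟨k, hk⟩ := Complex.exp_eq_exp_iff_exists_int.1 this
  refine ⟨?_, k, ?_⟩
  · simpa using congr(($hk).re)
  · simpa using congr(($hk).im)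

theorem polarExp_eq_iff (ha : 0 < a) (hb : 0 < b) {z w : ℂ} :
    polarExp a b z = polarExp a b w ↔ z.re = w.re ∧ ∃ k : ℤ, z.im = w.im + k * (π * a / b) := by
  have hm : 2 * b / a ≠ 0 := by positivity
  constructor
  · intro h
    have e0 : Real.exp z.re / (2 * b / a) * cos (2 * b / a * z.im)
      = Real.exp w.re / (2 * b / a) * cos (2 * b / a * w.im) := congr($h 0)
    have e1 : Real.exp z.re / (2 * b / a) * sin (2 * b / a * z.im)
      = Real.exp w.re / (2 * b / a) * sin (2 * b / a * w.im) := congr($h 1)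
    simp only [div_mul_eq_mul_div (Real.exp _) (2 * b / a), div_left_inj' hm] at e0 e1
    obtain ⟨h1, k, hk⟩ := exp_mul_cos_sin_eq e0 e1
    refine ⟨h1, k, ?_⟩
    field_simp at hk ⊢
    linarith
  · rintro ⟨h1, k, hk⟩
    have : 2 * b / a * z.im = 2 * b / a * w.im + k * (2 * π) := by
      rw [hk]; field_simp
    simp only [polarExp, polar, this, h1, cos_add_int_mul_two_pi, sin_add_int_mul_two_pi]

theorem polarExp_add_period (ha : 0 < a) (hb : 0 < b) (z : ℂ) (k : ℤ) :
    polarExp a b (z + (k * (π * a / b) : ℝ) * Complex.I) = polarExp a b z :=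
  (polarExp_eq_iff ha hb).2 ⟨by simp, k, by simp⟩

/-- A smooth map from a convex set to the cone lifts to the logarithmic coordinate. -/
theorem exists_contDiffOn_polarExp {X : Type*} [NormedAddCommGroup X] [NormedSpace ℝ X]
    (ha : 0 < a) (hb : 0 < b) (hab : a ^ 2 ≤ 4 * b ^ 2) {A : Set X} (hA : Convex ℝ A)
    {f : X → E 3} (hf : ContDiffOn ℝ ∞ f A) (hc : ∀ x ∈ A, f x ∈ cone a b) :
    ∃ ℓ : X → ℂ, ContDiffOn ℝ ∞ ℓ A ∧ ∀ x ∈ A, polarExp a b (ℓ x) = f x := by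
  have hm : 0 < 2 * b / a := by positivity
  have hf' := contDiffOn_euclidean.1 hf
  have hw : ContDiffOn ℝ ∞ (fun x => (f x 0 : ℂ) + f x 1 * Complex.I) A :=
    (Complex.ofRealCLM.contDiff.comp_contDiffOn (hf' 0)).add
      ((Complex.ofRealCLM.contDiff.comp_contDiffOn (hf' 1)).mul contDiffOn_const)
  obtain ⟨l, hl, h⟩ := exists_contDiffOn_log hA hw (by
    intro x hx h0
    have e0 : f x 0 = 0 := by simpa using congr(($h0).re)
    have e1 : f x 1 = 0 := by simpa using congr(($h0).im)
    obtain ⟨h1, -, h2⟩ := hc x hx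
    have e2 : f x 2 = 0 := by simpa [e0, e1, ha.ne'] using h1.symm
    exact h2 (by ext i; fin_cases i <;> simp [e0, e1, e2]))
  have hre : ContDiffOn ℝ ∞ (fun x => (l x).re) A := Complex.reCLM.contDiff.comp_contDiffOn hl
  have him : ContDiffOn ℝ ∞ (fun x => (l x).im) A := Complex.imCLM.contDiff.comp_contDiffOn hl
  refine ⟨fun x => (((l x).re + Real.log (2 * b / a) : ℝ) : ℂ)
    + (((l x).im / (2 * b / a) : ℝ) : ℂ) * Complex.I, ?_, fun x hx => ?_⟩
  · exact (Complex.ofRealCLM.contDiff.comp_contDiffOn (hre.add contDiffOn_const)).add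
      ((Complex.ofRealCLM.contDiff.comp_contDiffOn (him.div_const _)).mul contDiffOn_const)
  · have e0 : Real.exp (l x).re * cos (l x).im = f x 0 := by
      have := congr(($(h x hx)).re)
      rw [Complex.exp_re] at this
      simpa using this
    have e1 : Real.exp (l x).re * sin (l x).im = f x 1 := by
      have := congr(($(h x hx)).im)
      rw [Complex.exp_im] at this
      simpa using this
    have e2 : f x 2 = √(4 * b ^ 2 - a ^ 2) / a * Real.exp (l x).re := by
      obtain ⟨h1, h2, -⟩ := hc x hx
      rw [← sq_eq_sq₀ h2 (by positivity), mul_pow, div_pow, sq_sqrt (by linarith)]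
      have := sin_sq_add_cos_sq (l x).im
      rw [← e0, ← e1] at h1
      field_simp
      linear_combination -h1 + (4 * b ^ 2 - a ^ 2) * Real.exp (l x).re ^ 2 * this
    have hre : Real.exp ((l x).re + Real.log (2 * b / a)) = Real.exp (l x).re * (2 * b / a) := by
      rw [Real.exp_add, Real.exp_log hm]
    have him : 2 * b / a * ((l x).im / (2 * b / a)) = (l x).im := mul_div_cancel₀ _ hm.ne'
    simp only [polarExp, Complex.add_re, Complex.add_im, Complex.re_ofReal_mul,
      Complex.im_ofReal_mul, Complex.ofReal_re, Complex.ofReal_im, Complex.I_re, Complex.I_im,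
      mul_zero, mul_one, add_zero, zero_add, polar, hre, him, mul_div_cancel_right₀ _ hm.ne']
    ext i
    fin_cases i
    · exact e0
    · exact e1
    · simp only [Fin.reduceFinMk, Matrix.cons_val, e2]
      field_simp

/-- `velocityExp` is chosen so that the transform becomes the polar covering. -/
theorem RTransform_eq_polarExp (ha : 0 < a) (hb : 0 < b) {c : ℝ → E 2} {θ : ℝ}
    {ℓ : ℂ} (h : velocity c θ = velocityExp a b ℓ) : RTransform a b c θ = polarExp a b ℓ := by
  have hs : √(Real.exp (2 * ℓ.re) / (4 * b ^ 2)) = Real.exp ℓ.re / (2 * b) := by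
    rw [Real.sqrt_eq_iff_mul_self_eq (by positivity) (by positivity), two_mul, Real.exp_add]
    field_simp
    ring
  simp only [RTransform, unitTangent, h, velocityExp_smul hb]
  rw [norm_velocityExp, hs]
  ext i
  fin_cases i <;> simp [polarExp, polar] <;> field_simp

theorem exists_velocityExp_eq (ha : 0 < a) (hb : 0 < b) {w : E 2} (hw : w ≠ 0) :
    ∃ ℓ, velocityExp a b ℓ = w := by
  set z : ℂ := ⟨w 0, w 1⟩
  have hz : ‖z‖ = ‖w‖ := by
    rw [← sq_eq_sq₀ (norm_nonneg _) (norm_nonneg _), norm_sq_E2, Complex.sq_norm,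
      Complex.normSq_apply]
    simp [z, sq]
  have hw' : 0 < ‖w‖ := norm_pos_iff.2 hw
  have h0 : ‖w‖ * cos z.arg = w 0 := by rw [← hz]; exact Complex.norm_mul_cos_arg z
  have h1 : ‖w‖ * sin z.arg = w 1 := by rw [← hz]; exact Complex.norm_mul_sin_arg z
  refine ⟨⟨Real.log (4 * b ^ 2 * ‖w‖) / 2, z.arg / (2 * b / a)⟩, ?_⟩
  have hm : 2 * b / a ≠ 0 := by positivity
  simp only [velocityExp, mul_div_cancel₀ _ (two_ne_zero' ℝ), mul_div_cancel₀ _ hm]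
  rw [Real.exp_log (by positivity), mul_div_cancel_left₀ _ (by positivity)]
  ext i
  fin_cases i
  · simpa using h0
  · simpa using h1

theorem velocityExp_eq_of_polarExp_eq (ha : 0 < a) (hb : 0 < b) {z w : ℂ}
    (h : polarExp a b z = polarExp a b w) : velocityExp a b z = velocityExp a b w := by
  obtain ⟨h1, k, hk⟩ := (polarExp_eq_iff ha hb).1 h
  have : 2 * b / a * z.im = 2 * b / a * w.im + k * (2 * π) := by
    rw [hk]; field_simp
  simp only [velocityExp, this, h1, cos_add_int_mul_two_pi, sin_add_int_mul_two_pi]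

/-- The velocity of an immersion is recovered from its image under the transform. -/
theorem velocity_eq_velocityExp (ha : 0 < a) (hb : 0 < b) {c : ℝ → E 2} {θ : ℝ}
    (hc : velocity c θ ≠ 0) {ℓ : ℂ} (h : RTransform a b c θ = polarExp a b ℓ) :
    velocity c θ = velocityExp a b ℓ := by
  obtain ⟨z, hz⟩ := exists_velocityExp_eq ha hb hc
  rw [RTransform_eq_polarExp ha hb hz.symm] at h
  rw [← hz, velocityExp_eq_of_polarExp_eq ha hb h]

theorem RTransform_mem_cone (ha : 0 < a) (hb : 0 < b) (hab : a ^ 2 ≤ 4 * b ^ 2) {c : ℝ → E 2}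
    {θ : ℝ} (hc : velocity c θ ≠ 0) : RTransform a b c θ ∈ cone a b := by
  obtain ⟨z, hz⟩ := exists_velocityExp_eq ha hb hc
  rw [RTransform_eq_polarExp ha hb hz.symm]
  exact polarExp_mem_cone ha hb hab z

/-! ### Distances in logarithmic coordinates -/

theorem hasDerivWithinAt_cexp_comp {f : ℝ → ℂ} {f' : ℂ} {B : Set ℝ} {t : ℝ}
    (hf : HasDerivWithinAt f f' B t) :
    HasDerivWithinAt (fun t => Complex.exp (f t)) (f' * Complex.exp (f t)) B t := by
  rw [mul_comm]
  exact hf.cexp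

theorem norm_derivWithin_polarExp {a b : ℝ} (ha : 0 < a) (hb : 0 < b) (hab : a ^ 2 ≤ 4 * b ^ 2)
    {f : ℝ → ℂ} {B : Set ℝ} {t : ℝ} (hB : UniqueDiffWithinAt ℝ B t)
    (hf : DifferentiableWithinAt ℝ f B t) :
    ‖derivWithin (fun t => polarExp a b (f t)) B t‖
      = ‖derivWithin (fun t => Complex.exp (f t)) B t‖ := by
  obtain ⟨v, hv, h⟩ := hasDerivWithinAt_polarExp ha hb hab hf.hasDerivWithinAt
  rw [hv.derivWithin hB, h, (hasDerivWithinAt_cexp_comp hf.hasDerivWithinAt).derivWithin hB]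

/-- The length of the curve `exp ∘ ℓ` over `[0, 1]`. -/
def expLength (ℓ : ℝ → ℂ) : ℝ :=
  ∫ t in (0 : ℝ)..1, ‖derivWithin (fun t => Complex.exp (ℓ t)) (Icc 0 1) t‖

/-- The law of cosines: the squared distance in the universal cover of the punctured plane, in
logarithmic coordinates. -/
def coverSq (z w : ℂ) : ℝ :=
  Real.exp z.re ^ 2 + Real.exp w.re ^ 2
    - 2 * Real.exp z.re * Real.exp w.re * cos (min |z.im - w.im| π)

theorem coverSq_nonneg (z w : ℂ) : 0 ≤ coverSq z w := by
  have h1 := Real.exp_pos z.re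
  have h2 := Real.exp_pos w.re
  have h3 := cos_le_one (min |z.im - w.im| π)
  have := mul_nonneg (mul_pos h1 h2).le (sub_nonneg.2 h3)
  unfold coverSq
  nlinarith [sq_nonneg (Real.exp z.re - Real.exp w.re)]

/-- The cosine, continued as a constant to both sides of `[-π, 0]`. -/
def cosClamp (x : ℝ) : ℝ := cos (max (-π) (min x 0))

theorem hasDerivAt_cosClamp (x : ℝ) : HasDerivAt cosClamp (-sin (max (-π) (min x 0))) x := by
  have hπ := pi_pos
  have hl : ∀ x ≤ -π, cosClamp x = -1 := fun x hx => by
    rw [cosClamp, min_eq_left (by linarith), max_eq_left hx, cos_neg, cos_pi]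
  have hm : ∀ x ∈ Icc (-π) 0, cosClamp x = cos x := fun x hx => by
    rw [cosClamp, min_eq_left hx.2, max_eq_right hx.1]
  have hr : ∀ x, 0 ≤ x → cosClamp x = 1 := fun x hx => by
    rw [cosClamp, min_eq_right hx, max_eq_right (by linarith), cos_zero]
  rcases lt_trichotomy x (-π) with h | rfl | h
  · rw [min_eq_left (by linarith), max_eq_left h.le, sin_neg, sin_pi, neg_zero, neg_zero]
    refine (hasDerivAt_const x (-1 : ℝ)).congr_of_eventuallyEq ?_
    filter_upwards [Iio_mem_nhds h] with y hy using hl y (le_of_lt hy)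
  · rw [min_eq_left (by linarith), max_eq_left le_rfl, sin_neg, sin_pi, neg_zero, neg_zero]
    have h1 : HasDerivWithinAt cosClamp 0 (Iic (-π)) (-π) :=
      (hasDerivWithinAt_const (-π) _ (-1 : ℝ)).congr_of_mem (fun y hy => hl y hy) self_mem_Iic
    have h2 : HasDerivWithinAt cosClamp 0 (Ici (-π)) (-π) := by
      have : HasDerivWithinAt cos 0 (Icc (-π) 0) (-π) := by
        simpa using (hasDerivAt_cos (-π)).hasDerivWithinAt (s := Icc (-π) 0)
      exact (this.congr_of_mem hm ⟨le_rfl, by linarith⟩).mono_of_mem_nhdsWithin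
        (Icc_mem_nhdsGE (by linarith))
    simpa using h1.union h2
  · rcases lt_trichotomy x 0 with h' | rfl | h'
    · rw [min_eq_left h'.le, max_eq_right h.le]
      refine (hasDerivAt_cos x).congr_of_eventuallyEq ?_
      filter_upwards [Ioo_mem_nhds h h'] with y hy using hm y (Ioo_subset_Icc_self hy)
    · rw [min_eq_left le_rfl, max_eq_right (by linarith), sin_zero, neg_zero]
      have h2 : HasDerivWithinAt cosClamp 0 (Ici 0) 0 :=
        (hasDerivWithinAt_const 0 _ (1 : ℝ)).congr_of_mem (fun y hy => hr y hy) self_mem_Ici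
      have h1 : HasDerivWithinAt cosClamp 0 (Iic 0) 0 := by
        have : HasDerivWithinAt cos 0 (Icc (-π) 0) 0 := by
          simpa using (hasDerivAt_cos 0).hasDerivWithinAt (s := Icc (-π) 0)
        exact (this.congr_of_mem hm ⟨by linarith, le_rfl⟩).mono_of_mem_nhdsWithin
          (Icc_mem_nhdsLE (by linarith))
      simpa using h1.union h2
    · rw [min_eq_right h'.le, max_eq_right (by linarith), sin_zero, neg_zero]
      refine (hasDerivAt_const x (1 : ℝ)).congr_of_eventuallyEq ?_
      filter_upwards [Ioi_mem_nhds h'] with y hy using hr y (le_of_lt hy)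

/-- For radii `r`, `r'` and an angle `Δ ≥ 0` there is a function `ρ g(ψ)` with gradient of norm at
most one whose increase from `(r, 0)` to `(r', Δ)` is the distance. For `Δ < π` it is, on the
half plane in which `g` is not constant, the linear function in the direction of the connecting
segment; for `Δ ≥ π` it is the linear function in the direction from the first point to the apex,
through which the shortest path runs. -/
theorem exists_calibration {r r' Δ : ℝ} (hr : 0 < r) (hr' : 0 < r') (hΔ : 0 ≤ Δ) :
    ∃ g g' : ℝ → ℝ, (∀ x, HasDerivAt g (g' x) x) ∧ (∀ x, g x ^ 2 + g' x ^ 2 ≤ 1) ∧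
      √(r ^ 2 + r' ^ 2 - 2 * r * r' * cos (min Δ π)) ≤ r' * g Δ - r * g 0 := by
  have hshift : ∀ β, ∃ g' : ℝ → ℝ, (∀ x, HasDerivAt (fun x => cosClamp (x - β)) (g' x) x) ∧
      (∀ x, cosClamp (x - β) ^ 2 + g' x ^ 2 ≤ 1) := fun β => by
    refine ⟨fun x => -sin (max (-π) (min (x - β) 0)), fun x => ?_, fun x => ?_⟩
    · exact (hasDerivAt_cosClamp (x - β)).comp_sub_const x β
    · simp only [cosClamp, even_two.neg_pow, cos_sq_add_sin_sq, le_refl]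
  have hπ := pi_pos
  rcases le_or_gt π Δ with h | h
  · obtain ⟨g', h1, h2⟩ := hshift π
    refine ⟨_, g', h1, h2, ?_⟩
    rw [min_eq_right h, cos_pi, show r ^ 2 + r' ^ 2 - 2 * r * r' * (-1) = (r + r') ^ 2 by ring,
      sqrt_sq (by positivity)]
    simp [cosClamp, h, hπ.le]
    linarith
  · set ζ : ℂ := ⟨r' * cos Δ - r, r' * sin Δ⟩
    have hζ : ‖ζ‖ = √(r ^ 2 + r' ^ 2 - 2 * r * r' * cos (min Δ π)) := by
      rw [min_eq_left h.le, Complex.norm_def, Complex.normSq_apply]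
      congr 1
      have := sin_sq_add_cos_sq Δ
      simp only [ζ]
      linear_combination r' ^ 2 * this
    obtain ⟨g', h1, h2⟩ := hshift ζ.arg
    refine ⟨_, g', h1, h2, ?_⟩
    rw [← hζ]
    have hsin : 0 ≤ sin Δ := sin_nonneg_of_nonneg_of_le_pi hΔ h.le
    have hβ0 : 0 ≤ ζ.arg := Complex.arg_nonneg_iff.2 (mul_nonneg hr'.le hsin)
    have hβπ : ζ.arg ≤ π := Complex.arg_le_pi ζ
    have hc : ‖ζ‖ * cos ζ.arg = r' * cos Δ - r := Complex.norm_mul_cos_arg ζ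
    have hs : ‖ζ‖ * sin ζ.arg = r' * sin Δ := Complex.norm_mul_sin_arg ζ
    have hn0 := norm_nonneg ζ
    have e1 := sin_sq_add_cos_sq ζ.arg
    have e2 := sin_sq_add_cos_sq Δ
    -- if the end points coincide, then the argument of `ζ` carries no information
    by_cases hz : ‖ζ‖ = 0
    · rw [hz] at hc hs ⊢
      have hsΔ : sin Δ = 0 := by nlinarith
      have hcΔ : cos Δ = 1 := by nlinarith
      have : Δ = 0 := by
        rcases hΔ.eq_or_lt with h0 | h0
        · exact h0.symm
        · exact absurd hsΔ (sin_pos_of_pos_of_lt_pi h0 h).ne'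
      subst this
      have : r = r' := by rw [hcΔ] at hc; linarith
      simp [this]
    have hnp : 0 < ‖ζ‖ := lt_of_le_of_ne hn0 (Ne.symm hz)
    have hβΔ : Δ ≤ ζ.arg := by
      by_contra! hlt
      have h3 : sin (ζ.arg - Δ) < 0 := sin_neg_of_neg_of_neg_pi_lt (by linarith) (by linarith)
      have h4 : ‖ζ‖ * sin (ζ.arg - Δ) = r * sin Δ := by
        rw [sin_sub]
        linear_combination cos Δ * hs - sin Δ * hc
      nlinarith [mul_nonneg hr.le hsin]
    have c1 : cosClamp (Δ - ζ.arg) = cos (Δ - ζ.arg) := by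
      rw [cosClamp, min_eq_left (by linarith), max_eq_right (by linarith)]
    have c0 : cosClamp (0 - ζ.arg) = cos ζ.arg := by
      rw [cosClamp, min_eq_left (by linarith), max_eq_right (by linarith), zero_sub, cos_neg]
    simp only [c1, c0, cos_sub]
    apply le_of_eq
    linear_combination cos ζ.arg * hc + sin ζ.arg * hs - ‖ζ‖ * e1

theorem contDiffOn_cexp {X : Type*} [NormedAddCommGroup X] [NormedSpace ℝ X] {A : Set X}
    {ℓ : X → ℂ} (h : ContDiffOn ℝ ∞ ℓ A) : ContDiffOn ℝ ∞ (fun x => Complex.exp (ℓ x)) A :=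
  ((Complex.contDiff_exp (𝕜 := ℂ) (n := ∞)).restrict_scalars ℝ).comp_contDiffOn h

theorem continuousOn_derivWithin_cexp {ℓ : ℝ → ℂ} {α β : ℝ} (h : α < β)
    (hℓ : ContDiffOn ℝ ∞ ℓ (Icc α β)) :
    ContinuousOn (derivWithin (fun t => Complex.exp (ℓ t)) (Icc α β)) (Icc α β) :=
  (contDiffOn_cexp hℓ).continuousOn_derivWithin (uniqueDiffOn_Icc h) (by simp)

/-- If `ρ g(ψ)` has gradient of norm at most one, then its increase along a curve bounds the
length of the curve from below. -/
theorem calibration_le_expLength {ℓ : ℝ → ℂ} (hℓ : ContDiffOn ℝ ∞ ℓ (Icc 0 1)) {g g' : ℝ → ℝ}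
    (hg : ∀ x, HasDerivAt g (g' x) x) (hgg : ∀ x, g x ^ 2 + g' x ^ 2 ≤ 1) :
    Real.exp (ℓ 1).re * g (ℓ 1).im - Real.exp (ℓ 0).re * g (ℓ 0).im ≤ expLength ℓ := by
  have hc := continuousOn_derivWithin_cexp one_pos hℓ
  have hd : ∀ t ∈ Icc (0 : ℝ) 1, HasDerivWithinAt ℓ (derivWithin ℓ (Icc 0 1) t) (Icc 0 1) t :=
    fun t ht => (hℓ.differentiableOn (by simp) t ht).hasDerivWithinAt
  set F : ℝ → ℝ := fun t => Real.exp (ℓ t).re * g (ℓ t).im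
  have hF : ∀ t ∈ Icc (0 : ℝ) 1, HasDerivWithinAt F
      (Real.exp (ℓ t).re * (derivWithin ℓ (Icc 0 1) t).re * g (ℓ t).im +
        Real.exp (ℓ t).re * (g' (ℓ t).im * (derivWithin ℓ (Icc 0 1) t).im)) (Icc 0 1) t := by
    intro t ht
    have hre : HasDerivWithinAt (fun t => (ℓ t).re) (derivWithin ℓ (Icc 0 1) t).re (Icc 0 1) t :=
      Complex.reCLM.hasFDerivAt.comp_hasDerivWithinAt t (hd t ht)
    have him : HasDerivWithinAt (fun t => (ℓ t).im) (derivWithin ℓ (Icc 0 1) t).im (Icc 0 1) t :=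
      Complex.imCLM.hasFDerivAt.comp_hasDerivWithinAt t (hd t ht)
    exact hre.exp.mul ((hg _).comp_hasDerivWithinAt t him)
  have := intervalIntegral.sub_le_integral_of_hasDeriv_right_of_le (g := F) zero_le_one
    (fun t ht => (hF t ht).continuousWithinAt)
    (fun t ht => ((hF t (Ioo_subset_Icc_self ht)).hasDerivAt
      (Icc_mem_nhds ht.1 ht.2)).hasDerivWithinAt)
    (φ := fun t => ‖derivWithin (fun t => Complex.exp (ℓ t)) (Icc 0 1) t‖)
    (hc.norm.integrableOn_Icc) (fun t ht => ?_)
  · exact this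
  · have ht' := Ioo_subset_Icc_self ht
    rw [(hasDerivWithinAt_cexp_comp (hd t ht')).derivWithin (uniqueDiffOn_Icc one_pos t ht'),
      norm_mul, Complex.norm_exp, Complex.norm_def, Complex.normSq_apply]
    set u := derivWithin ℓ (Icc 0 1) t
    set y := (ℓ t).im
    have h1 : u.re * g y + g' y * u.im ≤ √(u.re * u.re + u.im * u.im) := by
      apply Real.le_sqrt_of_sq_le
      nlinarith [hgg y, sq_nonneg (u.re * g' y - g y * u.im), sq_nonneg u.re, sq_nonneg u.im]
    nlinarith [Real.exp_pos (ℓ t).re]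

theorem sqrt_coverSq_le_expLength {ℓ : ℝ → ℂ} (hℓ : ContDiffOn ℝ ∞ ℓ (Icc 0 1)) :
    √(coverSq (ℓ 0) (ℓ 1)) ≤ expLength ℓ := by
  -- the calibration is shifted to the initial angle, and reflected if the angle decreases
  obtain ⟨g, g', h1, h2, h3⟩ := exists_calibration (Real.exp_pos (ℓ 0).re)
    (Real.exp_pos (ℓ 1).re) (abs_nonneg ((ℓ 0).im - (ℓ 1).im))
  refine h3.trans ?_
  rcases le_total (ℓ 0).im (ℓ 1).im with h | h
  · have := calibration_le_expLength hℓ (g := fun x => g (x - (ℓ 0).im))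
      (g' := fun x => g' (x - (ℓ 0).im)) (fun x => (h1 _).comp_sub_const x _)
      (fun x => h2 _)
    rw [abs_of_nonpos (by linarith), neg_sub]
    simpa using this
  · have := calibration_le_expLength hℓ (g := fun x => g ((ℓ 0).im - x))
      (g' := fun x => -g' ((ℓ 0).im - x)) (fun x => (h1 _).comp_const_sub _ x)
      (fun x => by simpa using h2 _)
    rw [abs_of_nonneg (by linarith)]
    simpa using this

/-! ### The connecting paths -/

/-- The path from `z` to `w` that is a straight segment, affinely parametrized, in the plane with
polar coordinates `(r, φ / κ)`. It does so only for `|Im (w - z)| < κ π`, when the segment avoids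
the origin; outside this range the branch cut of the logarithm makes the formula meaningless. -/
def segPath (κ : ℝ) (z w : ℂ) (t : ℝ) : ℂ :=
  z + ((Complex.log (1 + t * (Complex.exp ⟨(w - z).re, (w - z).im / κ⟩ - 1))).re : ℂ)
    + ((κ * (Complex.log (1 + t * (Complex.exp ⟨(w - z).re, (w - z).im / κ⟩ - 1))).im : ℝ) : ℂ)
      * Complex.I

/-- The integral over `[0, 1]` of the squared speed of `exp ∘ segPath κ z w`. -/
def segEnergy (κ : ℝ) (z w : ℂ) : ℝ :=
  Real.exp z.re ^ 2 + Real.exp w.re ^ 2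
    - 2 * Real.exp z.re * Real.exp w.re * cos ((w.im - z.im) / κ)
    + Real.exp z.re * Real.exp w.re * (κ ^ 2 - 1) * ((w.im - z.im) / κ)
      * sin ((w.im - z.im) / κ)

theorem exp_mem_slitPlane {x y : ℝ} (hy : |y| < π) : Complex.exp ⟨x, y⟩ ∈ Complex.slitPlane := by
  rw [Complex.mem_slitPlane_iff_arg]
  refine ⟨?_, Complex.exp_ne_zero _⟩
  rw [← Complex.log_im, Complex.log_exp (by simpa using (abs_lt.1 hy).1)
    (by simpa using (abs_lt.1 hy).2.le)]
  exact (abs_lt.1 hy).2.ne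

theorem segment_mem_slitPlane {ζ : ℂ} (hζ : ζ ∈ Complex.slitPlane) {t : ℝ}
    (ht : t ∈ Icc (0 : ℝ) 1) :
    1 + t * (ζ - 1) ∈ Complex.slitPlane := by
  have := Complex.starConvex_one_slitPlane hζ (sub_nonneg.2 ht.2) ht.1 (by ring)
  convert this using 1
  simp
  ring

theorem contDiffOn_segPath {X : Type*} [NormedAddCommGroup X] [NormedSpace ℝ X] {A : Set X}
    {κ τ : X → ℝ} {z w : X → ℂ} (hκ : ContDiffOn ℝ ∞ κ A) (hτ : ContDiffOn ℝ ∞ τ A)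
    (hz : ContDiffOn ℝ ∞ z A) (hw : ContDiffOn ℝ ∞ w A) (hκ0 : ∀ x ∈ A, 0 < κ x)
    (hlt : ∀ x ∈ A, |(w x - z x).im| < κ x * π) (hτA : ∀ x ∈ A, τ x ∈ Icc (0 : ℝ) 1) :
    ContDiffOn ℝ ∞ (fun x => segPath (κ x) (z x) (w x) (τ x)) A := by
  have hR : ∀ {f : X → ℝ}, ContDiffOn ℝ ∞ f A → ContDiffOn ℝ ∞ (fun x => (f x : ℂ)) A :=
    fun h => Complex.ofRealCLM.contDiff.comp_contDiffOn h
  have hre : ∀ {f : X → ℂ}, ContDiffOn ℝ ∞ f A → ContDiffOn ℝ ∞ (fun x => (f x).re) A :=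
    fun h => Complex.reCLM.contDiff.comp_contDiffOn h
  have him : ∀ {f : X → ℂ}, ContDiffOn ℝ ∞ f A → ContDiffOn ℝ ∞ (fun x => (f x).im) A :=
    fun h => Complex.imCLM.contDiff.comp_contDiffOn h
  have h1 : ContDiffOn ℝ ∞ (fun x => (⟨(w x - z x).re, (w x - z x).im / κ x⟩ : ℂ)) A := by
    have := (hR (hre (hw.sub hz))).add
      ((hR ((him (hw.sub hz)).div hκ fun x hx => (hκ0 x hx).ne')).mul
        (contDiffOn_const (c := Complex.I)))
    refine this.congr fun x _ => ?_
    exact Complex.mk_eq_add_mul_I _ _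
  have h2 : ContDiffOn ℝ ∞ (fun x => Complex.log
      (1 + τ x * (Complex.exp ⟨(w x - z x).re, (w x - z x).im / κ x⟩ - 1))) A := by
    intro x hx
    refine ContDiffAt.comp_contDiffWithinAt x (contDiffAt_clog ?_)
      ((contDiffOn_const.add ((hR hτ).mul ((contDiffOn_cexp h1).sub contDiffOn_const))) x hx)
    refine segment_mem_slitPlane (exp_mem_slitPlane ?_) (hτA x hx)
    rw [abs_div, abs_of_pos (hκ0 x hx), div_lt_iff₀ (hκ0 x hx), mul_comm π]
    exact hlt x hx
  exact (hz.add (hR (hre h2))).add ((hR (hκ.mul (him h2))).mul contDiffOn_const)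

theorem segPath_zero (κ : ℝ) (z w : ℂ) : segPath κ z w 0 = z := by simp [segPath]

theorem segPath_one {κ : ℝ} (hκ : 0 < κ) {z w : ℂ} (h : |(w - z).im| < κ * π) :
    segPath κ z w 1 = w := by
  have h' : |(w - z).im / κ| < π := by
    rwa [abs_div, abs_of_pos hκ, div_lt_iff₀ hκ, mul_comm π]
  rw [segPath, Complex.ofReal_one, one_mul, add_sub_cancel,
    Complex.log_exp (abs_lt.1 h').1 (abs_lt.1 h').2.le, mul_div_cancel₀ _ hκ.ne']
  apply Complex.ext <;> simp

theorem integral_norm_sq_segPath {κ : ℝ} (hκ : 0 < κ) {z w : ℂ} (h : |(w - z).im| < κ * π) :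
    ∫ t in (0 : ℝ)..1, ‖derivWithin (fun t => Complex.exp (segPath κ z w t)) (Icc 0 1) t‖ ^ 2
      = segEnergy κ z w := by
  have h' : |(w - z).im / κ| < π := by
    rwa [abs_div, abs_of_pos hκ, div_lt_iff₀ hκ, mul_comm π]
  set δ := (w - z).im / κ with hδ
  set ζ := Complex.exp ⟨(w - z).re, δ⟩ with hζ
  have hslit : ∀ t ∈ Icc (0 : ℝ) 1, 1 + t * (ζ - 1) ∈ Complex.slitPlane := fun t ht =>
    segment_mem_slitPlane (exp_mem_slitPlane h') ht
  set μ : ℝ → ℂ := fun t => (ζ - 1) / (1 + t * (ζ - 1))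
  have hlog : ∀ t ∈ Icc (0 : ℝ) 1,
      HasDerivAt (fun t : ℝ => Complex.log (1 + t * (ζ - 1))) (μ t) t := by
    intro t ht
    have : HasDerivAt (fun t : ℝ => 1 + (t : ℂ) * (ζ - 1)) (ζ - 1) t := by
      simpa using ((hasDerivAt_id t).ofReal_comp.mul_const (ζ - 1)).const_add 1
    exact this.clog_real (hslit t ht)
  have hre : ∀ t ∈ Icc (0 : ℝ) 1,
      HasDerivAt (fun t : ℝ => (Complex.log (1 + t * (ζ - 1))).re) (μ t).re t := fun t ht =>
    Complex.reCLM.hasFDerivAt.comp_hasDerivAt t (hlog t ht)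
  have him : ∀ t ∈ Icc (0 : ℝ) 1,
      HasDerivAt (fun t : ℝ => (Complex.log (1 + t * (ζ - 1))).im) (μ t).im t := fun t ht =>
    Complex.imCLM.hasFDerivAt.comp_hasDerivAt t (hlog t ht)
  have hseg : ∀ t ∈ Icc (0 : ℝ) 1, HasDerivAt (segPath κ z w)
      ((μ t).re + (κ * (μ t).im : ℝ) * Complex.I) t := by
    intro t ht
    have := ((hre t ht).ofReal_comp.const_add z).add
      (((him t ht).const_mul κ).ofReal_comp.mul_const Complex.I)
    exact this
  -- the angular momentum of the segment is constant, so the squared speed is affine in `Im μ`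
  have key : ∀ t ∈ Icc (0 : ℝ) 1,
      ‖derivWithin (fun t => Complex.exp (segPath κ z w t)) (Icc 0 1) t‖ ^ 2
        = Real.exp z.re ^ 2 * (Complex.normSq (ζ - 1) + (κ ^ 2 - 1) * ζ.im * (μ t).im) := by
    intro t ht
    rw [(hasDerivWithinAt_cexp_comp (hseg t ht).hasDerivWithinAt).derivWithin
      (uniqueDiffOn_Icc one_pos t ht), norm_mul, mul_pow, Complex.norm_exp, Complex.sq_norm]
    set u := 1 + t * (ζ - 1)
    have hu : u ≠ 0 := Complex.slitPlane_ne_zero (hslit t ht)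
    have hμ : ζ - 1 = μ t * u := (div_mul_cancel₀ _ hu).symm
    have e1 : (segPath κ z w t).re = z.re + (Complex.log u).re := by
      simp [segPath, u, ζ, δ]
    have e2 : Real.exp (Complex.log u).re ^ 2 = Complex.normSq u := by
      rw [Complex.log_re, Real.exp_log (norm_pos_iff.2 hu), Complex.sq_norm]
    have e3 : Complex.normSq u * (μ t).im = ζ.im := by
      have a1 : ζ.re - 1 = (μ t).re * u.re - (μ t).im * u.im := by simpa using congr(($hμ).re)
      have a2 : ζ.im = (μ t).re * u.im + (μ t).im * u.re := by simpa using congr(($hμ).im)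
      have a3 : u.re = 1 + t * (ζ.re - 1) := by simp [u]
      have a4 : u.im = t * ζ.im := by simp [u]
      rw [Complex.normSq_apply]
      linear_combination -u.re * a2 + a1 * u.im + (-ζ.re + 1) * a4 + ζ.im * a3
    rw [hμ, map_mul, e1, Real.exp_add, mul_pow, e2, ← e3, Complex.normSq_apply (μ t),
      Complex.normSq_apply ((μ t).re + (κ * (μ t).im : ℝ) * Complex.I)]
    simp
    ring
  have hμc : ContinuousOn (fun t => (μ t).im) (Icc 0 1) := by
    refine Complex.continuous_im.comp_continuousOn (continuousOn_const.div (by fun_prop) ?_)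
    exact fun t ht => Complex.slitPlane_ne_zero (hslit t ht)
  have hint : ∫ t in (0 : ℝ)..1, (μ t).im = δ := by
    have hu : uIcc (0 : ℝ) 1 = Icc 0 1 := uIcc_of_le zero_le_one
    rw [intervalIntegral.integral_eq_sub_of_hasDerivAt (fun t ht => him t (hu ▸ ht))
      (ContinuousOn.intervalIntegrable (hu ▸ hμc))]
    rw [Complex.ofReal_one, one_mul, add_sub_cancel, hζ,
      Complex.log_exp (abs_lt.1 h').1 (abs_lt.1 h').2.le]
    simp
  rw [intervalIntegral.integral_congr (g := fun t => Real.exp z.re ^ 2 *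
    (Complex.normSq (ζ - 1) + (κ ^ 2 - 1) * ζ.im * (μ t).im))
    (fun t ht => key t (uIcc_of_le (zero_le_one' ℝ) ▸ ht)),
    intervalIntegral.integral_const_mul, intervalIntegral.integral_add (by simp)
    ((ContinuousOn.intervalIntegrable (by rwa [uIcc_of_le zero_le_one])).const_mul _),
    intervalIntegral.integral_const_mul, hint]
  have hζre : ζ.re = Real.exp (w.re - z.re) * cos δ := by simp [ζ, Complex.exp_re]
  have hζim : ζ.im = Real.exp (w.re - z.re) * sin δ := by simp [ζ, Complex.exp_im]
  have hw : Real.exp w.re = Real.exp z.re * Real.exp (w.re - z.re) := by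
    rw [← Real.exp_add, add_sub_cancel]
  have hδ' : (w.im - z.im) / κ = δ := by simp [δ]
  rw [segEnergy, hδ', hw, Complex.normSq_apply]
  have := sin_sq_add_cos_sq δ
  simp [hζre, hζim]
  linear_combination (Real.exp z.re ^ 2 * Real.exp (w.re - z.re) ^ 2) * this

/-- A smooth approximation, with parameter `ε`, of the factor `max 1 (|Δ| / π)` by which an angle
`Δ` exceeds the angles that a straight segment can sweep. -/
def stretch (ε Δ : ℝ) : ℝ :=
  √((1 + (Δ / π) ^ 2 + √((1 - (Δ / π) ^ 2) ^ 2 + ε ^ 2)) / 2)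

theorem stretch_pos (ε Δ : ℝ) : 0 < stretch ε Δ := by
  unfold stretch; positivity

theorem continuous_stretch : Continuous (fun p : ℝ × ℝ => stretch p.1 p.2) := by
  unfold stretch; fun_prop

theorem contDiff_stretch {ε : ℝ} (hε : 0 < ε) : ContDiff ℝ ∞ (stretch ε) := by
  unfold stretch
  refine ContDiff.sqrt ?_ fun Δ => by positivity
  refine ContDiff.div_const (ContDiff.add (by fun_prop) (ContDiff.sqrt (by fun_prop) ?_)) _
  exact fun Δ => by positivity

theorem abs_lt_stretch_mul_pi {ε : ℝ} (hε : 0 < ε) (Δ : ℝ) : |Δ| < stretch ε Δ * π := by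
  rw [← div_lt_iff₀ pi_pos]
  refine Real.lt_sqrt_of_sq_lt ?_
  rw [div_pow, sq_abs, ← div_pow]
  have : |1 - (Δ / π) ^ 2| < √((1 - (Δ / π) ^ 2) ^ 2 + ε ^ 2) := by
    rw [← Real.sqrt_sq_eq_abs]
    exact Real.sqrt_lt_sqrt (sq_nonneg _) (by nlinarith)
  have := neg_le_abs (1 - (Δ / π) ^ 2)
  linarith

theorem stretch_zero (Δ : ℝ) : stretch 0 Δ = max 1 (|Δ| / π) := by
  have hu : 0 ≤ |Δ| / π := by positivity
  have hsq : (Δ / π) ^ 2 = (|Δ| / π) ^ 2 := by rw [div_pow, div_pow, sq_abs]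
  rw [stretch, hsq, zero_pow two_ne_zero, add_zero, Real.sqrt_sq_eq_abs]
  generalize |Δ| / π = v at hu
  rcases le_total v 1 with h | h
  · rw [max_eq_left h, abs_of_nonneg (by nlinarith)]
    norm_num
  · rw [max_eq_right h, abs_of_nonpos (by nlinarith),
      show (1 + v ^ 2 + -(1 - v ^ 2)) / 2 = v ^ 2 by ring, sqrt_sq hu]

/-- In the limit the factor is `1` for `|Δ| ≤ π`, where the straight segment is used, and `|Δ| / π`
otherwise, where the rescaled angle is `π` and the segment passes through the apex. -/
theorem segEnergy_stretch_zero (z w : ℂ) :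
    segEnergy (stretch 0 (w.im - z.im)) z w = coverSq z w := by
  rw [stretch_zero, segEnergy, coverSq, abs_sub_comm z.im]
  set Δ := w.im - z.im
  have hπ := pi_pos
  rcases le_or_gt |Δ| π with h | h
  · have : |Δ| / π ≤ 1 := (div_le_one hπ).2 h
    rw [max_eq_left this, min_eq_left h, cos_abs]
    simp
  · have h1 : 1 ≤ |Δ| / π := (one_le_div hπ).2 h.le
    have h0 : 0 < |Δ| := hπ.trans h
    rw [max_eq_right h1, min_eq_right h.le]
    have : Δ / (|Δ| / π) = π ∨ Δ / (|Δ| / π) = -π := by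
      rcases abs_choice Δ with h2 | h2
      · left; rw [h2] at h0 ⊢; field_simp
      · right; rw [h2] at h0 ⊢
        have : Δ ≠ 0 := by linarith
        field_simp
    rcases this with h2 | h2 <;> simp [h2]

theorem continuous_segEnergy_stretch : Continuous (fun p : ℝ × ℂ × ℂ =>
    segEnergy (stretch p.1 (p.2.2.im - p.2.1.im)) p.2.1 p.2.2) := by
  have h : Continuous fun p : ℝ × ℂ × ℂ => stretch p.1 (p.2.2.im - p.2.1.im) :=
    continuous_stretch.comp (g := fun p : ℝ × ℝ => stretch p.1 p.2)
      (f := fun p : ℝ × ℂ × ℂ => (p.1, p.2.2.im - p.2.1.im)) (by fun_prop)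
  have h' : Continuous fun p : ℝ × ℂ × ℂ =>
      (p.2.2.im - p.2.1.im) / stretch p.1 (p.2.2.im - p.2.1.im) :=
    Continuous.div (by fun_prop) h fun p => (stretch_pos _ _).ne'
  unfold segEnergy
  fun_prop

/-- The Cauchy–Schwarz inequality on the unit interval: length is bounded by energy. -/
theorem sq_integral_le {f : ℝ → ℝ} (hf : ContinuousOn f (Icc 0 1)) :
    (∫ t in (0 : ℝ)..1, f t) ^ 2 ≤ ∫ t in (0 : ℝ)..1, f t ^ 2 := by
  have hu : uIcc (0 : ℝ) 1 = Icc 0 1 := uIcc_of_le zero_le_one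
  have h1 : IntervalIntegrable f volume 0 1 := ContinuousOn.intervalIntegrable (hu ▸ hf)
  have h2 : IntervalIntegrable (fun t => f t ^ 2) volume 0 1 :=
    ContinuousOn.intervalIntegrable (hu ▸ hf.pow 2)
  set m := ∫ t in (0 : ℝ)..1, f t
  have h3 : 0 ≤ ∫ t in (0 : ℝ)..1, (f t - m) ^ 2 :=
    intervalIntegral.integral_nonneg zero_le_one fun t _ => sq_nonneg _
  have h4 : ∫ t in (0 : ℝ)..1, (f t - m) ^ 2 = (∫ t in (0 : ℝ)..1, f t ^ 2) - m ^ 2 := by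
    have : ∀ t, (f t - m) ^ 2 = f t ^ 2 - (2 * m * f t - m ^ 2) := fun t => by ring
    simp_rw [this]
    rw [intervalIntegral.integral_sub h2 ((h1.const_mul _).sub (by simp)),
      intervalIntegral.integral_sub (h1.const_mul _) (by simp),
      intervalIntegral.integral_const_mul]
    simp
    ring
  linarith

/-! ### The distance on the cone -/

section Lifts

variable {a b : ℝ}

/-- Two lifts of the same map differ by a constant multiple of the period. -/
theorem exists_int_forall_eq_add {X : Type*} [TopologicalSpace X] (ha : 0 < a) (hb : 0 < b)
    {A : Set X} (hA : IsPreconnected A) {f g : X → ℂ} (hf : ContinuousOn f A)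
    (hg : ContinuousOn g A) (h : ∀ x ∈ A, polarExp a b (f x) = polarExp a b (g x)) :
    ∃ k : ℤ, ∀ x ∈ A, f x = g x + (k * (π * a / b) : ℝ) * Complex.I := by
  rcases A.eq_empty_or_nonempty with rfl | ⟨x₀, hx₀⟩
  · exact ⟨0, by simp⟩
  have hp : π * a / b ≠ 0 := by positivity
  have h' := fun x hx => (polarExp_eq_iff ha hb).1 (h x hx)
  obtain ⟨k, hk⟩ := (h' x₀ hx₀).2
  refine ⟨k, fun x hx => ?_⟩
  have hc : (f x).im - (g x).im = (f x₀).im - (g x₀).im := by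
    refine eq_of_forall_exists_int_mul hA hp (f := fun x => (f x).im - (g x).im)
      ((Complex.continuous_im.comp_continuousOn hf).sub
        (Complex.continuous_im.comp_continuousOn hg)) (fun y hy => ?_) hx hx₀
    obtain ⟨l, hl⟩ := (h' y hy).2
    exact ⟨l, by rw [hl]; ring⟩
  apply Complex.ext
  · simpa using (h' x hx).1
  · simp
    linarith

/-- Uniqueness of lifts. -/
theorem eqOn_of_polarExp_eq {X : Type*} [TopologicalSpace X] (ha : 0 < a) (hb : 0 < b)
    {A : Set X} (hA : IsPreconnected A) {f g : X → ℂ} (hf : ContinuousOn f A)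
    (hg : ContinuousOn g A) (h : ∀ x ∈ A, polarExp a b (f x) = polarExp a b (g x)) {x₀ : X}
    (hx₀ : x₀ ∈ A) (h0 : f x₀ = g x₀) : EqOn f g A := by
  obtain ⟨k, hk⟩ := exists_int_forall_eq_add ha hb hA hf hg h
  have h1 := hk x₀ hx₀
  rw [h0, left_eq_add] at h1
  intro x hx
  rw [hk x hx, h1, add_zero]

/-- A lift on a preconnected part of a convex set extends to a smooth lift. -/
theorem exists_contDiffOn_polarExp_eqOn {X : Type*} [NormedAddCommGroup X] [NormedSpace ℝ X]
    (ha : 0 < a) (hb : 0 < b) (hab : a ^ 2 ≤ 4 * b ^ 2) {A B : Set X} (hA : Convex ℝ A)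
    (hB : IsPreconnected B) (hBA : B ⊆ A)
    {f : X → E 3} (hf : ContDiffOn ℝ ∞ f A) (hc : ∀ x ∈ A, f x ∈ cone a b) {ℓ₀ : X → ℂ}
    (hℓ₀ : ContinuousOn ℓ₀ B) (h : ∀ x ∈ B, polarExp a b (ℓ₀ x) = f x) :
    ∃ ℓ : X → ℂ, ContDiffOn ℝ ∞ ℓ A ∧ (∀ x ∈ A, polarExp a b (ℓ x) = f x) ∧ EqOn ℓ ℓ₀ B := by
  obtain ⟨ℓ, hℓ, hℓf⟩ := exists_contDiffOn_polarExp ha hb hab hA hf hc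
  obtain ⟨k, hk⟩ := exists_int_forall_eq_add ha hb hB hℓ₀ (hℓ.continuousOn.mono hBA)
    (fun x hx => by rw [h x hx, hℓf x (hBA hx)])
  refine ⟨fun x => ℓ x + (k * (π * a / b) : ℝ) * Complex.I, hℓ.add contDiffOn_const,
    fun x hx => ?_, fun x hx => (hk x hx).symm⟩
  rw [polarExp_add_period ha hb, hℓf x hx]

end Lifts

theorem tendsto_sqrt_segEnergy (z w : ℂ) :
    Tendsto (fun ε => √(segEnergy (stretch ε (w.im - z.im)) z w)) (𝓝[>] 0)
      (𝓝 (√(coverSq z w))) := by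
  rw [← segEnergy_stretch_zero]
  have : Continuous fun ε => √(segEnergy (stretch ε (w.im - z.im)) z w) :=
    (continuous_segEnergy_stretch.comp (g := fun p : ℝ × ℂ × ℂ =>
      segEnergy (stretch p.1 (p.2.2.im - p.2.1.im)) p.2.1 p.2.2)
      (f := fun ε => (ε, z, w)) (by fun_prop)).sqrt
  exact (this.tendsto 0).mono_left nhdsWithin_le_nhds

theorem expLength_le_sqrt {ℓ : ℝ → ℂ} (hℓ : ContDiffOn ℝ ∞ ℓ (Icc 0 1)) :
    expLength ℓ ≤ √(∫ t in (0 : ℝ)..1,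
      ‖derivWithin (fun t => Complex.exp (ℓ t)) (Icc 0 1) t‖ ^ 2) :=
  Real.le_sqrt_of_sq_le (sq_integral_le (continuousOn_derivWithin_cexp one_pos hℓ).norm)

theorem spaceLength_polarExp {a b : ℝ} (ha : 0 < a) (hb : 0 < b) (hab : a ^ 2 ≤ 4 * b ^ 2)
    {x : ℝ → E 3} {ℓ : ℝ → ℂ} (hℓ : ContDiffOn ℝ ∞ ℓ (Icc 0 1))
    (h : ∀ t ∈ Icc (0 : ℝ) 1, x t = polarExp a b (ℓ t)) : spaceLength x = expLength ℓ := by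
  refine intervalIntegral.integral_congr fun t ht => ?_
  rw [uIcc_of_le zero_le_one] at ht
  rw [derivWithin_congr h (h t ht), norm_derivWithin_polarExp ha hb hab
    (uniqueDiffOn_Icc one_pos t ht) (hℓ.differentiableOn (by simp) t ht)]

/-- The lower bound is the calibration; the connecting paths `segPath` approach it as `ε → 0`. -/
theorem liftDist_exp {a b : ℝ} (ha : 0 < a) (hb : 0 < b) (hab : a ^ 2 ≤ 4 * b ^ 2) (z w : ℂ) :
    liftDist a b (Real.exp z.re) z.im (Real.exp w.re) w.im = √(coverSq z w) := by
  set S := {L | ∃ ρ ψ : ℝ → ℝ, ContDiffOn ℝ ∞ ρ (Icc 0 1) ∧ ContDiffOn ℝ ∞ ψ (Icc 0 1) ∧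
    (∀ t ∈ Icc (0 : ℝ) 1, 0 < ρ t) ∧ ρ 0 = Real.exp z.re ∧ ψ 0 = z.im ∧ ρ 1 = Real.exp w.re ∧
    ψ 1 = w.im ∧ L = spaceLength (fun t => polar a b (ρ t) (ψ t))} with hS
  have hmem : ∀ ℓ : ℝ → ℂ, ContDiffOn ℝ ∞ ℓ (Icc 0 1) → ℓ 0 = z → ℓ 1 = w →
      expLength ℓ ∈ S := by
    intro ℓ hℓ h0 h1
    refine ⟨fun t => Real.exp (ℓ t).re, fun t => (ℓ t).im,
      (Complex.reCLM.contDiff.comp_contDiffOn hℓ).exp, Complex.imCLM.contDiff.comp_contDiffOn hℓ,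
      fun t _ => Real.exp_pos _, by simp [h0], by simp [h0], by simp [h1], by simp [h1], ?_⟩
    exact (spaceLength_polarExp ha hb hab hℓ fun t _ => rfl).symm
  have hlow : ∀ L ∈ S, √(coverSq z w) ≤ L := by
    rintro L ⟨ρ, ψ, hρ, hψ, hpos, r0, p0, r1, p1, rfl⟩
    set ℓ : ℝ → ℂ := fun t => (Real.log (ρ t) : ℂ) + ψ t * Complex.I
    have hℓ : ContDiffOn ℝ ∞ ℓ (Icc 0 1) :=
      (Complex.ofRealCLM.contDiff.comp_contDiffOn (hρ.log fun t ht => (hpos t ht).ne')).add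
        ((Complex.ofRealCLM.contDiff.comp_contDiffOn hψ).mul contDiffOn_const)
    have hz : ℓ 0 = z := by apply Complex.ext <;> simp [ℓ, r0, p0]
    have hw : ℓ 1 = w := by apply Complex.ext <;> simp [ℓ, r1, p1]
    rw [spaceLength_polarExp ha hb hab hℓ fun t ht => by
      simp [polarExp, ℓ, Real.exp_log (hpos t ht)]]
    simpa [hz, hw] using sqrt_coverSq_le_expLength hℓ
  have hub : ∀ ε > 0, liftDist a b (Real.exp z.re) z.im (Real.exp w.re) w.im
      ≤ √(segEnergy (stretch ε (w.im - z.im)) z w) := by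
    intro ε hε
    have hlt := abs_lt_stretch_mul_pi hε (w.im - z.im)
    have hpos := stretch_pos ε (w.im - z.im)
    have hℓ : ContDiffOn ℝ ∞ (segPath (stretch ε (w.im - z.im)) z w) (Icc 0 1) :=
      contDiffOn_segPath contDiffOn_const contDiffOn_id contDiffOn_const contDiffOn_const
        (fun _ _ => hpos) (fun _ _ => by simpa using hlt) fun _ h => h
    refine (csInf_le ⟨_, hlow⟩ (hmem _ hℓ (segPath_zero _ _ _)
      (segPath_one hpos (by simpa using hlt)))).trans ?_
    rw [← integral_norm_sq_segPath hpos (by simpa using hlt)]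
    exact expLength_le_sqrt hℓ
  refine le_antisymm (ge_of_tendsto (tendsto_sqrt_segEnergy z w)
    (eventually_nhdsWithin_of_forall hub)) (le_csInf ?_ hlow)
  have hlt := abs_lt_stretch_mul_pi one_pos (w.im - z.im)
  have hpos := stretch_pos 1 (w.im - z.im)
  exact ⟨_, hmem _ (contDiffOn_segPath (κ := fun _ => stretch 1 (w.im - z.im)) contDiffOn_const
    contDiffOn_id (z := fun _ => z) (w := fun _ => w) contDiffOn_const contDiffOn_const
    (fun _ _ => hpos) (fun _ _ => by simpa using hlt) fun _ h => h) (segPath_zero _ _ _)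
    (segPath_one hpos (by simpa using hlt))⟩

theorem liftDist_eq {a b : ℝ} (ha : 0 < a) (hb : 0 < b) (hab : a ^ 2 ≤ 4 * b ^ 2)
    {r φ r' φ' : ℝ} (hr : 0 < r) (hr' : 0 < r') :
    liftDist a b r φ r' φ' = √(coverSq ⟨Real.log r, φ⟩ ⟨Real.log r', φ'⟩) := by
  simpa [Real.exp_log hr, Real.exp_log hr'] using
    liftDist_exp ha hb hab ⟨Real.log r, φ⟩ ⟨Real.log r', φ'⟩

theorem liftDist_sq {a b : ℝ} (ha : 0 < a) (hb : 0 < b) (hab : a ^ 2 ≤ 4 * b ^ 2)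
    {r φ r' φ' : ℝ} (hr : 0 < r) (hr' : 0 < r') :
    liftDist a b r φ r' φ' ^ 2 = r ^ 2 + r' ^ 2 - 2 * r * r' * cos (min |φ - φ'| π) := by
  rw [liftDist_eq ha hb hab hr hr', sq_sqrt (coverSq_nonneg _ _), coverSq]
  simp [Real.exp_log hr, Real.exp_log hr']

/-- A function on `ℤ` that is constant outside a finite set attains its minimum. -/
theorem exists_forall_le_of_eq_of_le_abs {v : ℤ → ℝ} {V : ℝ} {K : ℕ}
    (h : ∀ k : ℤ, K ≤ |k| → v k = V) : ∃ k₀, ∀ k, v k₀ ≤ v k := by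
  obtain ⟨k₀, hk₀, hmin⟩ := (Finset.Icc (-K : ℤ) K).exists_min_image v ⟨0, by simp⟩
  refine ⟨k₀, fun k => ?_⟩
  by_cases hk : k ∈ Finset.Icc (-K : ℤ) K
  · exact hmin k hk
  · have hk' : (K : ℤ) ≤ |k| := by
      by_contra! hlt
      exact hk (Finset.mem_Icc.2 ⟨(abs_lt.1 hlt).1.le, (abs_lt.1 hlt).2.le⟩)
    rw [h k hk', ← h K (by simp)]
    exact hmin K (by simp)

/-- Beyond finitely many winding indices the angle exceeds `π`, uniformly for bounded angles. -/
theorem exists_nat_forall_pi_le {p : ℝ} (hp : 0 < p) (C : ℝ) :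
    ∃ K : ℕ, ∀ k : ℤ, K ≤ |k| → ∀ x : ℝ, |x| ≤ C → π ≤ |x - k * p| := by
  obtain ⟨K, hK⟩ := exists_nat_gt ((C + π) / p)
  refine ⟨K, fun k hk x hx => ?_⟩
  rw [div_lt_iff₀ hp] at hK
  have h1 : (K : ℝ) ≤ |(k : ℝ)| := by exact_mod_cast hk
  have h2 : |(k : ℝ) * p| = |(k : ℝ)| * p := by rw [abs_mul, abs_of_pos hp]
  have h3 := abs_sub_abs_le_abs_sub ((k : ℝ) * p) x
  rw [abs_sub_comm] at h3
  nlinarith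

/-- A curve in the cone lifts, starting at the given lift of its first point, to a path whose end is
some lift of its last point; the distance is thus the infimum over these, and all but finitely
many of them are at distance `r + r'`. -/
theorem isLeast_coneDist {a b : ℝ} (ha : 0 < a) (hb : 0 < b) (hab : a ^ 2 ≤ 4 * b ^ 2)
    {r φ r' φ' : ℝ} (hr : 0 < r) (hr' : 0 < r') :
    IsLeast (Set.range fun k : ℤ => liftDist a b r φ r' (φ' + k * (π * a / b)))
      (coneDist a b (polar a b r φ) (polar a b r' φ')) := by
  have hp : 0 < π * a / b := by positivity
  set S := {L | ∃ x : ℝ → E 3, ContDiffOn ℝ ∞ x (Icc 0 1) ∧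
    (∀ t ∈ Icc (0 : ℝ) 1, x t ∈ cone a b) ∧ x 0 = polar a b r φ ∧ x 1 = polar a b r' φ' ∧
    L = spaceLength x}
  have hz : polarExp a b ⟨Real.log r, φ⟩ = polar a b r φ := by
    simp [polarExp, Real.exp_log hr]
  have hw : polarExp a b ⟨Real.log r', φ'⟩ = polar a b r' φ' := by
    simp [polarExp, Real.exp_log hr']
  -- a curve in the cone has a lift that starts at the given point
  have hlift : ∀ L ∈ S, ∃ k : ℤ, liftDist a b r φ r' (φ' + k * (π * a / b)) ≤ L := by
    rintro L ⟨x, hx, hxc, h0, h1, rfl⟩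
    obtain ⟨ℓ, hℓ, hℓx, hℓ0⟩ := exists_contDiffOn_polarExp_eqOn ha hb hab (convex_Icc (0 : ℝ) 1)
      (B := {0}) isPreconnected_singleton (by simp) hx hxc (ℓ₀ := fun _ => ⟨Real.log r, φ⟩)
      continuousOn_const (by simp [hz, h0])
    have e0 : ℓ 0 = ⟨Real.log r, φ⟩ := hℓ0 rfl
    obtain ⟨e1, k, hk⟩ := (polarExp_eq_iff ha hb).1
      (show polarExp a b (ℓ 1) = polarExp a b ⟨Real.log r', φ'⟩ by
        rw [hℓx 1 (by simp), hw, h1])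
    refine ⟨k, ?_⟩
    rw [liftDist_eq ha hb hab hr hr', spaceLength_polarExp ha hb hab hℓ fun t ht => (hℓx t ht).symm]
    have := sqrt_coverSq_le_expLength hℓ
    rwa [e0, show ℓ 1 = ⟨Real.log r', φ' + k * (π * a / b)⟩ from Complex.ext e1 hk] at this
  have hbdd : BddBelow S := by
    refine ⟨0, fun L hL => ?_⟩
    obtain ⟨k, hk⟩ := hlift L hL
    exact le_trans (by rw [liftDist_eq ha hb hab hr hr']; exact sqrt_nonneg _) hk
  -- conversely, every lifted path is a curve in the cone
  have hsub : ∀ k : ℤ, {L | ∃ ρ ψ : ℝ → ℝ, ContDiffOn ℝ ∞ ρ (Icc 0 1) ∧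
      ContDiffOn ℝ ∞ ψ (Icc 0 1) ∧ (∀ t ∈ Icc (0 : ℝ) 1, 0 < ρ t) ∧ ρ 0 = r ∧ ψ 0 = φ ∧
      ρ 1 = r' ∧ ψ 1 = φ' + k * (π * a / b) ∧
      L = spaceLength (fun t => polar a b (ρ t) (ψ t))} ⊆ S := by
    rintro k L ⟨ρ, ψ, hρ, hψ, hpos, r0, p0, r1, p1, rfl⟩
    have hpolar : ∀ t ∈ Icc (0 : ℝ) 1, polar a b (ρ t) (ψ t)
        = polarExp a b (Real.log (ρ t) + ψ t * Complex.I) := fun t ht => by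
      simp [polarExp, Real.exp_log (hpos t ht)]
    refine ⟨_, ?_, fun t ht => ?_, by rw [r0, p0], ?_, rfl⟩
    · refine ContDiffOn.congr (contDiff_polarExp.comp_contDiffOn ?_) hpolar
      exact (Complex.ofRealCLM.contDiff.comp_contDiffOn (hρ.log fun t ht => (hpos t ht).ne')).add
        ((Complex.ofRealCLM.contDiff.comp_contDiffOn hψ).mul contDiffOn_const)
    · rw [hpolar t ht]
      exact polarExp_mem_cone ha hb hab _
    · rw [r1, p1, ← hw, ← polarExp_add_period ha hb _ k]
      simp [polarExp, Real.exp_log hr']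
  have hne : ∀ k : ℤ, {L | ∃ ρ ψ : ℝ → ℝ, ContDiffOn ℝ ∞ ρ (Icc 0 1) ∧
      ContDiffOn ℝ ∞ ψ (Icc 0 1) ∧ (∀ t ∈ Icc (0 : ℝ) 1, 0 < ρ t) ∧ ρ 0 = r ∧ ψ 0 = φ ∧
      ρ 1 = r' ∧ ψ 1 = φ' + k * (π * a / b) ∧
      L = spaceLength (fun t => polar a b (ρ t) (ψ t))}.Nonempty := fun k => by
    refine ⟨_, fun t => r + t * (r' - r), fun t => φ + t * (φ' + k * (π * a / b) - φ), by fun_prop,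
      by fun_prop, fun t ht => ?_, by simp, by simp, by simp, by simp, rfl⟩
    rcases ht.2.eq_or_lt with h | h
    · simpa [h] using hr'
    · nlinarith [mul_nonneg ht.1 hr'.le, mul_pos (sub_pos.2 h) hr]
  obtain ⟨K, hK⟩ := exists_nat_forall_pi_le hp |φ - φ'|
  obtain ⟨k₀, hk₀⟩ := exists_forall_le_of_eq_of_le_abs (K := K) (V := r + r')
    (v := fun k : ℤ => liftDist a b r φ r' (φ' + k * (π * a / b))) (fun k hk => by
      rw [liftDist_eq ha hb hab hr hr', coverSq]
      have := hK k hk (φ - φ') le_rfl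
      rw [show φ - φ' - k * (π * a / b) = φ - (φ' + k * (π * a / b)) by ring] at this
      rw [min_eq_right this, cos_pi, Real.exp_log hr, Real.exp_log hr',
        show r ^ 2 + r' ^ 2 - 2 * r * r' * (-1) = (r + r') ^ 2 by ring, sqrt_sq (by positivity)])
  have hle : ∀ k : ℤ, coneDist a b (polar a b r φ) (polar a b r' φ')
      ≤ liftDist a b r φ r' (φ' + k * (π * a / b)) := fun k =>
    csInf_le_csInf hbdd (hne k) (hsub k)
  refine ⟨⟨k₀, le_antisymm ?_ (hle k₀)⟩, ?_⟩
  · refine le_csInf ((hne 0).mono (hsub 0)) fun L hL => ?_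
    obtain ⟨k, hk⟩ := hlift L hL
    exact (hk₀ k).trans hk
  · rintro _ ⟨k, rfl⟩
    exact hle k

/-! ### The energy in logarithmic coordinates and its critical points -/

theorem convex_I : Convex ℝ I := convex_Icc _ _

theorem interior_I_nonempty : (interior I).Nonempty := by
  rw [I, interior_Icc]
  exact nonempty_Ioo.2 two_pi_pos

theorem uniqueDiffOn_I : UniqueDiffOn ℝ I := uniqueDiffOn_Icc two_pi_pos

theorem uIcc_two_pi : uIcc 0 (2 * π) = I := uIcc_of_le two_pi_pos.le

theorem integral_I_congr {V : Type*} [NormedAddCommGroup V] [NormedSpace ℝ V] {f g : ℝ → V}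
    (h : ∀ θ ∈ I, f θ = g θ) : ∫ θ in (0 : ℝ)..2 * π, f θ = ∫ θ in (0 : ℝ)..2 * π, g θ :=
  intervalIntegral.integral_congr fun θ hθ => h θ (uIcc_two_pi ▸ hθ)

theorem integral_Icc_congr {V : Type*} [NormedAddCommGroup V] [NormedSpace ℝ V] {f g : ℝ → V}
    {α β : ℝ} (hαβ : α ≤ β) (h : ∀ θ ∈ Icc α β, f θ = g θ) :
    ∫ θ in α..β, f θ = ∫ θ in α..β, g θ :=
  intervalIntegral.integral_congr fun θ hθ => h θ (uIcc_of_le hαβ ▸ hθ)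

theorem integral_swap_of_continuousOn {f : ℝ × ℝ → ℝ} {α β : ℝ} (h : α ≤ β)
    (hf : ContinuousOn f (Icc α β ×ˢ I)) :
    ∫ t in α..β, ∫ θ in (0 : ℝ)..2 * π, f (t, θ)
      = ∫ θ in (0 : ℝ)..2 * π, ∫ t in α..β, f (t, θ) := by
  simp_rw [intervalIntegral.integral_of_le h, intervalIntegral.integral_of_le two_pi_pos.le]
  refine integral_integral_swap (f := fun t θ => f (t, θ)) ?_
  rw [Measure.prod_restrict]
  exact (hf.integrableOn_compact (isCompact_Icc.prod isCompact_Icc)).mono_set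
    (prod_mono Ioc_subset_Icc_self Ioc_subset_Icc_self)

/-- Twice the energy density: the squared `L²`-norm of the time derivative. -/
def speedSq (J : Set ℝ) (Z : ℝ → ℝ → ℂ) (t : ℝ) : ℝ :=
  ∫ θ in (0 : ℝ)..2 * π, ‖derivWithin (fun τ => Z τ θ) J t‖ ^ 2

/-- The energy of a path of plane curves over `[t₀, t₁]`. -/
def planeEnergy (t₀ t₁ : ℝ) (Z : ℝ → ℝ → ℂ) : ℝ :=
  (1 / 2) * ∫ t in t₀..t₁, speedSq (Icc t₀ t₁) Z t

variable {t₀ t₁ : ℝ}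

theorem speedSq_congr {J : Set ℝ} {Z W : ℝ → ℝ → ℂ} (h : ∀ t ∈ J, ∀ θ ∈ I, Z t θ = W t θ)
    {t : ℝ} (ht : t ∈ J) : speedSq J Z t = speedSq J W t :=
  integral_I_congr fun θ hθ => by rw [derivWithin_congr (fun τ hτ => h τ hτ θ hθ) (h t ht θ hθ)]

theorem planeEnergy_congr (h01 : t₀ ≤ t₁) {Z W : ℝ → ℝ → ℂ}
    (h : ∀ t ∈ Icc t₀ t₁, ∀ θ ∈ I, Z t θ = W t θ) : planeEnergy t₀ t₁ Z = planeEnergy t₀ t₁ W := by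
  rw [planeEnergy, planeEnergy, integral_Icc_congr h01 fun t ht => speedSq_congr h ht]

theorem contDiffOn_timeDeriv {Z : ℝ → ℝ → ℂ} {J : Set ℝ} (hJ : UniqueDiffOn ℝ J)
    (hZ : ContDiffOn ℝ ∞ (fun q : ℝ × ℝ => Z q.1 q.2) (J ×ˢ I)) :
    ContDiffOn ℝ ∞ (fun q : ℝ × ℝ => derivWithin (fun τ => Z τ q.2) J q.1) (J ×ˢ I) :=
  contDiffOn_derivWithin_fst hZ uniqueDiffOn_I hJ

theorem contDiffOn_slice {Z : ℝ → ℝ → ℂ} {J : Set ℝ}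
    (hZ : ContDiffOn ℝ ∞ (fun q : ℝ × ℝ => Z q.1 q.2) (J ×ˢ I)) {θ : ℝ} (hθ : θ ∈ I) :
    ContDiffOn ℝ ∞ (fun t => Z t θ) J :=
  hZ.comp (f := fun t : ℝ => (t, θ)) (by fun_prop) fun _ h => ⟨h, hθ⟩

theorem planeEnergy_eq_swap (h01 : t₀ < t₁) {Z : ℝ → ℝ → ℂ}
    (hZ : ContDiffOn ℝ ∞ (fun q : ℝ × ℝ => Z q.1 q.2) (Icc t₀ t₁ ×ˢ I)) :
    planeEnergy t₀ t₁ Z = (1 / 2) * ∫ θ in (0 : ℝ)..2 * π, ∫ t in t₀..t₁,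
      ‖derivWithin (fun τ => Z τ θ) (Icc t₀ t₁) t‖ ^ 2 := by
  have := (contDiffOn_timeDeriv (uniqueDiffOn_Icc h01) hZ).continuousOn.norm.fun_pow 2
  rw [planeEnergy, ← integral_swap_of_continuousOn h01.le this]
  rfl

theorem planeEnergy_nonneg (h01 : t₀ ≤ t₁) (Z : ℝ → ℝ → ℂ) : 0 ≤ planeEnergy t₀ t₁ Z := by
  refine mul_nonneg (by norm_num) (intervalIntegral.integral_nonneg h01 fun t _ => ?_)
  exact intervalIntegral.integral_nonneg two_pi_pos.le fun θ _ => sq_nonneg _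

/-- A path affine in time is orthogonal, for the energy, to the paths that vanish at both ends. -/
theorem planeEnergy_affine_add (h01 : t₀ < t₁) {Z η : ℝ → ℝ → ℂ} {u v : ℝ → ℂ}
    (hZ : ContDiffOn ℝ ∞ (fun q : ℝ × ℝ => Z q.1 q.2) (Icc t₀ t₁ ×ˢ I))
    (hη : ContDiffOn ℝ ∞ (fun q : ℝ × ℝ => η q.1 q.2) (Icc t₀ t₁ ×ˢ I))
    (hZuv : ∀ t ∈ Icc t₀ t₁, ∀ θ ∈ I, Z t θ = u θ + (t - t₀ : ℝ) • v θ)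
    (h0 : ∀ θ ∈ I, η t₀ θ = 0) (h1 : ∀ θ ∈ I, η t₁ θ = 0) (c : ℝ) :
    planeEnergy t₀ t₁ (fun t θ => Z t θ + c • η t θ)
      = planeEnergy t₀ t₁ Z + c ^ 2 * planeEnergy t₀ t₁ η := by
  have uJ := uniqueDiffOn_Icc h01
  have hηc := (contDiffOn_timeDeriv uJ hη).continuousOn
  have hZc := (contDiffOn_timeDeriv uJ hZ).continuousOn
  have hslice : ∀ {W : ℝ → ℝ → ℂ}, ContDiffOn ℝ ∞ (fun q : ℝ × ℝ => W q.1 q.2) (Icc t₀ t₁ ×ˢ I) →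
      ∀ θ ∈ I, ContinuousOn (fun t => derivWithin (fun τ => W τ θ) (Icc t₀ t₁) t) (Icc t₀ t₁) :=
    fun hW θ hθ => (contDiffOn_timeDeriv uJ hW).continuousOn.comp (f := fun t : ℝ => (t, θ))
      (by fun_prop) fun _ h => ⟨h, hθ⟩
  have hII : ∀ {f : ℝ → ℝ}, ContinuousOn f (Icc t₀ t₁) → IntervalIntegrable f volume t₀ t₁ :=
    fun hf => ContinuousOn.intervalIntegrable (by rwa [uIcc_of_le h01.le])
  have hθ : ∀ θ ∈ I, ∫ t in t₀..t₁,
      ‖derivWithin (fun τ => Z τ θ + c • η τ θ) (Icc t₀ t₁) t‖ ^ 2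
      = (∫ t in t₀..t₁, ‖derivWithin (fun τ => Z τ θ) (Icc t₀ t₁) t‖ ^ 2)
        + c ^ 2 * ∫ t in t₀..t₁, ‖derivWithin (fun τ => η τ θ) (Icc t₀ t₁) t‖ ^ 2 := by
    intro θ hθ
    have dZ : ∀ t ∈ Icc t₀ t₁, HasDerivWithinAt (fun τ => Z τ θ) (v θ) (Icc t₀ t₁) t := by
      intro t ht
      have : HasDerivAt (fun t : ℝ => u θ + (t - t₀ : ℝ) • v θ) (v θ) t := by
        simpa using (((hasDerivAt_id t).sub_const t₀).smul_const (v θ)).const_add (u θ)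
      exact this.hasDerivWithinAt.congr_of_mem (fun τ hτ => hZuv τ hτ θ hθ) ht
    have dη : ∀ t ∈ Icc t₀ t₁, HasDerivWithinAt (fun τ => η τ θ)
        (derivWithin (fun τ => η τ θ) (Icc t₀ t₁) t) (Icc t₀ t₁) t := fun t ht =>
      ((contDiffOn_slice hη hθ).differentiableOn (by simp) t ht).hasDerivWithinAt
    have cη := hslice hη θ hθ
    have e : ∀ t ∈ Icc t₀ t₁, ‖derivWithin (fun τ => Z τ θ + c • η τ θ) (Icc t₀ t₁) t‖ ^ 2
        = ‖derivWithin (fun τ => Z τ θ) (Icc t₀ t₁) t‖ ^ 2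
          + (2 * c * inner ℝ (v θ) (derivWithin (fun τ => η τ θ) (Icc t₀ t₁) t)
          + c ^ 2 * ‖derivWithin (fun τ => η τ θ) (Icc t₀ t₁) t‖ ^ 2) := by
      intro t ht
      rw [((dZ t ht).fun_add ((dη t ht).fun_const_smul c)).derivWithin (uJ t ht),
        (dZ t ht).derivWithin (uJ t ht), norm_add_sq_real, inner_smul_right, norm_smul, mul_pow,
        Real.norm_eq_abs, sq_abs]
      ring
    -- the velocity `v` is constant, so the mixed term is a boundary term
    have hin : ∫ t in t₀..t₁, inner ℝ (v θ) (derivWithin (fun τ => η τ θ) (Icc t₀ t₁) t) = 0 := by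
      have hF : ∀ t ∈ Icc t₀ t₁, HasDerivWithinAt (fun t => inner ℝ (v θ) (η t θ))
          (inner ℝ (v θ) (derivWithin (fun τ => η τ θ) (Icc t₀ t₁) t)) (Icc t₀ t₁) t := fun t ht =>
        by simpa using (hasDerivWithinAt_const t _ (v θ)).inner ℝ (dη t ht)
      rw [intervalIntegral.integral_eq_sub_of_hasDerivAt_of_le h01.le
        (f := fun t => inner ℝ (v θ) (η t θ)) (fun t ht => (hF t ht).continuousWithinAt)
        (fun t ht => (hF t (Ioo_subset_Icc_self ht)).hasDerivAt (Icc_mem_nhds ht.1 ht.2))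
        (hII (continuousOn_const.inner cη))]
      simp [h0 θ hθ, h1 θ hθ]
    have i1 : IntervalIntegrable (fun t => 2 * c * inner ℝ (v θ)
        (derivWithin (fun τ => η τ θ) (Icc t₀ t₁) t)) volume t₀ t₁ :=
      hII (continuousOn_const.mul (continuousOn_const.inner cη))
    have i2 : IntervalIntegrable (fun t => c ^ 2 * ‖derivWithin (fun τ => η τ θ) (Icc t₀ t₁) t‖ ^ 2)
        volume t₀ t₁ := hII (continuousOn_const.mul (cη.norm.fun_pow 2))
    rw [integral_Icc_congr h01.le e, intervalIntegral.integral_add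
      (hII ((hslice hZ θ hθ).norm.fun_pow 2)) (i1.add i2), intervalIntegral.integral_add i1 i2,
      intervalIntegral.integral_const_mul, hin, intervalIntegral.integral_const_mul]
    ring
  have hsum : ContDiffOn ℝ ∞ (fun q : ℝ × ℝ => Z q.1 q.2 + c • η q.1 q.2) (Icc t₀ t₁ ×ˢ I) :=
    hZ.add (contDiffOn_const.fun_smul hη)
  have hcont : ∀ {W : ℝ → ℝ → ℂ},
      ContDiffOn ℝ ∞ (fun q : ℝ × ℝ => W q.1 q.2) (Icc t₀ t₁ ×ˢ I) →
      IntervalIntegrable (fun θ => ∫ t in t₀..t₁,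
        ‖derivWithin (fun τ => W τ θ) (Icc t₀ t₁) t‖ ^ 2) volume 0 (2 * π) := fun {W} hW => by
    apply ContinuousOn.intervalIntegrable
    rw [uIcc_two_pi]
    refine continuousOn_integral_of_prod (P := ℝ)
      (F := fun q => ‖derivWithin (fun τ => W τ q.1) (Icc t₀ t₁) q.2‖ ^ 2) h01.le ?_
    exact ((contDiffOn_timeDeriv uJ hW).continuousOn.norm.pow 2).comp
      (f := fun q : ℝ × ℝ => (q.2, q.1)) (by fun_prop) fun q hq => ⟨hq.2, hq.1⟩
  rw [planeEnergy_eq_swap h01 hsum, planeEnergy_eq_swap h01 hZ, planeEnergy_eq_swap h01 hη,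
    integral_I_congr hθ, intervalIntegral.integral_add (hcont hZ) ((hcont hη).const_mul _),
    intervalIntegral.integral_const_mul]
  ring

theorem eq_zero_of_planeEnergy_eq_zero (h01 : t₀ < t₁) {η : ℝ → ℝ → ℂ}
    (hη : ContDiffOn ℝ ∞ (fun q : ℝ × ℝ => η q.1 q.2) (Icc t₀ t₁ ×ˢ I))
    (h0 : ∀ θ ∈ I, η t₀ θ = 0) (h : planeEnergy t₀ t₁ η = 0) :
    ∀ t ∈ Icc t₀ t₁, ∀ θ ∈ I, η t θ = 0 := by
  have uJ := uniqueDiffOn_Icc h01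
  have hc := (contDiffOn_timeDeriv uJ hη).continuousOn
  have hc2 := hc.norm.pow 2
  have hd : ∀ t ∈ Icc t₀ t₁, ∀ θ ∈ I, derivWithin (fun τ => η τ θ) (Icc t₀ t₁) t = 0 := by
    by_contra! hne
    obtain ⟨t, ht, θ, hθ, hne⟩ := hne
    have p1 : 0 < speedSq (Icc t₀ t₁) η t := by
      refine intervalIntegral.integral_pos two_pi_pos ?_ (fun _ _ => sq_nonneg _)
        ⟨θ, hθ, by positivity⟩
      exact hc2.comp (f := fun θ : ℝ => (t, θ)) (by fun_prop) fun _ h => ⟨ht, h⟩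
    have p2 : 0 < ∫ t in t₀..t₁, speedSq (Icc t₀ t₁) η t := by
      refine intervalIntegral.integral_pos h01 ?_ (fun t _ =>
        intervalIntegral.integral_nonneg two_pi_pos.le fun θ _ => sq_nonneg _) ⟨t, ht, p1⟩
      exact continuousOn_integral_of_prod two_pi_pos.le hc2
    rw [planeEnergy] at h
    linarith
  intro t ht θ hθ
  have := (convex_Icc t₀ t₁).is_const_of_fderivWithin_eq_zero (𝕜 := ℝ) (f := fun t => η t θ)
    ((contDiffOn_slice hη hθ).differentiableOn (by simp)) (fun t ht => by
      ext
      simpa [fderivWithin_derivWithin] using hd t ht θ hθ) ht (left_mem_Icc.2 h01.le)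
  rw [this, h0 θ hθ]

/-- The energy of a smooth family of paths depends smoothly on the parameter. -/
theorem differentiableAt_planeEnergy (h01 : t₀ < t₁) {ε : ℝ} (hε : 0 < ε) {Z : ℝ → ℝ → ℝ → ℂ}
    (hZ : ContDiffOn ℝ ∞ (fun q : (ℝ × ℝ) × ℝ => Z q.1.1 q.1.2 q.2)
      ((Ioo (-ε) ε ×ˢ Icc t₀ t₁) ×ˢ I)) :
    DifferentiableAt ℝ (fun s => planeEnergy t₀ t₁ (Z s)) 0 := by
  have uJ := uniqueDiffOn_Icc h01
  have uS : UniqueDiffOn ℝ (Ioo (-ε) ε) := isOpen_Ioo.uniqueDiffOn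
  have cS : Convex ℝ (Ioo (-ε) ε) := convex_Ioo _ _
  have nS : (interior (Ioo (-ε) ε)).Nonempty := by
    rw [interior_Ioo]; exact ⟨0, by simp [hε]⟩
  have nJ : (interior (Icc t₀ t₁)).Nonempty := by
    rw [interior_Icc]; exact nonempty_Ioo.2 h01
  have hd : ContDiffOn ℝ ∞ (fun q : (ℝ × ℝ) × ℝ =>
      derivWithin (fun τ => Z q.1.1 τ q.2) (Icc t₀ t₁) q.1.2) ((Ioo (-ε) ε ×ˢ Icc t₀ t₁) ×ˢ I) := by
    refine (contDiffOn_fderivWithin_apply_const hZ ((uS.prod uJ).prod uniqueDiffOn_I)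
      ((0, 1), 0)).congr fun q hq => ?_
    refine HasDerivWithinAt.derivWithin (hasDerivWithinAt_line (hZ.differentiableOn (by simp))
      (g := fun τ => ((q.1.1, τ), q.2)) (e := ((0, 1), 0)) (B := Icc t₀ t₁)
      (fun τ => ((hasDerivAt_const τ q.1.1).prodMk (hasDerivAt_id τ)).prodMk
        (hasDerivAt_const τ q.2)) (fun τ hτ => ⟨⟨hq.1.1, hτ⟩, hq.2⟩) hq.1.2) (uJ _ hq.1.2)
  have h1 : ContDiffOn ℝ ∞ (fun p : ℝ × ℝ => speedSq (Icc t₀ t₁) (Z p.1) p.2)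
      (Ioo (-ε) ε ×ˢ Icc t₀ t₁) := by
    refine contDiffOn_integral_of_prod (P := ℝ × ℝ) (F := fun q : (ℝ × ℝ) × ℝ =>
      ‖derivWithin (fun τ => Z q.1.1 τ q.2) (Icc t₀ t₁) q.1.2‖ ^ 2) two_pi_pos
      (cS.prod (convex_Icc _ _)) ?_ (hd.norm_sq ℝ)
    rw [interior_prod_eq]
    exact nS.prod nJ
  have h2 : ContDiffOn ℝ ∞ (fun s => planeEnergy t₀ t₁ (Z s)) (Ioo (-ε) ε) :=
    contDiffOn_const.mul (contDiffOn_integral_of_prod (P := ℝ)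
      (F := fun q => speedSq (Icc t₀ t₁) (Z q.1) q.2) h01 cS nS h1)
  exact (h2.differentiableOn (by simp)).differentiableAt (Ioo_mem_nhds (by simpa) hε)

/-- `Z` is affine in time on the compact interval `[t₀, t₁]`, for every `θ ∈ [0, 2π]`. It is stated
by means of the end points: the slope is the difference quotient. -/
def AffineOnIcc (t₀ t₁ : ℝ) (Z : ℝ → ℝ → ℂ) : Prop :=
  ∀ θ ∈ I, ∀ t ∈ Icc t₀ t₁,
    Z t θ = Z t₀ θ + (t - t₀ : ℝ) • ((t₁ - t₀)⁻¹ • (Z t₁ θ - Z t₀ θ))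

/-- Affine paths are critical points of the energy: they are even minimizers. -/
theorem hasDerivAt_planeEnergy_of_affine (h01 : t₀ < t₁) {ε : ℝ} (hε : 0 < ε)
    {Z : ℝ → ℝ → ℝ → ℂ}
    (hZ : ContDiffOn ℝ ∞ (fun q : (ℝ × ℝ) × ℝ => Z q.1.1 q.1.2 q.2)
      ((Ioo (-ε) ε ×ˢ Icc t₀ t₁) ×ˢ I))
    (h0 : ∀ s ∈ Ioo (-ε) ε, ∀ θ ∈ I, Z s t₀ θ = Z 0 t₀ θ)
    (h1 : ∀ s ∈ Ioo (-ε) ε, ∀ θ ∈ I, Z s t₁ θ = Z 0 t₁ θ) (haff : AffineOnIcc t₀ t₁ (Z 0)) :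
    HasDerivAt (fun s => planeEnergy t₀ t₁ (Z s)) 0 0 := by
  have hmin : IsLocalMin (fun s => planeEnergy t₀ t₁ (Z s)) 0 := by
    filter_upwards [Ioo_mem_nhds (show -ε < 0 by simpa) hε] with s hs
    have hsl : ∀ s ∈ Ioo (-ε) ε,
        ContDiffOn ℝ ∞ (fun q : ℝ × ℝ => Z s q.1 q.2) (Icc t₀ t₁ ×ˢ I) := fun s hs =>
      hZ.comp (f := fun q : ℝ × ℝ => ((s, q.1), q.2)) (by fun_prop) fun q hq =>
        ⟨⟨hs, hq.1⟩, hq.2⟩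
    have z0 := hsl 0 (by simp [hε])
    have := planeEnergy_affine_add (η := fun t θ => Z s t θ - Z 0 t θ) h01 z0
      ((hsl s hs).sub z0) (fun t ht θ hθ => haff θ hθ t ht)
      (fun θ hθ => by simp [h0 s hs θ hθ]) (fun θ hθ => by simp [h1 s hs θ hθ]) 1
    simp only [one_smul, add_sub_cancel] at this
    rw [this]
    have := planeEnergy_nonneg h01.le (fun t θ => Z s t θ - Z 0 t θ)
    linarith
  have hd := (differentiableAt_planeEnergy h01 hε hZ).hasDerivAt
  rwa [hmin.hasDerivAt_eq_zero hd] at hd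

/-- The difference of a path and its affine interpolation. -/
def affineDefect (t₀ t₁ : ℝ) (Z : ℝ → ℝ → ℂ) (t θ : ℝ) : ℂ :=
  Z t θ - (Z t₀ θ + (t - t₀ : ℝ) • ((t₁ - t₀)⁻¹ • (Z t₁ θ - Z t₀ θ)))

theorem contDiffOn_affineDefect (h01 : t₀ ≤ t₁) {Z : ℝ → ℝ → ℂ}
    (hZ : ContDiffOn ℝ ∞ (fun q : ℝ × ℝ => Z q.1 q.2) (Icc t₀ t₁ ×ˢ I)) :
    ContDiffOn ℝ ∞ (fun q : ℝ × ℝ => affineDefect t₀ t₁ Z q.1 q.2) (Icc t₀ t₁ ×ˢ I) := by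
  have hs : ∀ t ∈ Icc t₀ t₁, ContDiffOn ℝ ∞ (fun q : ℝ × ℝ => Z t q.2) (Icc t₀ t₁ ×ˢ I) :=
    fun t ht => hZ.comp (f := fun q : ℝ × ℝ => (t, q.2)) (by fun_prop) fun q hq => ⟨ht, hq.2⟩
  have z0 := hs t₀ (left_mem_Icc.2 h01)
  have z1 := hs t₁ (right_mem_Icc.2 h01)
  exact hZ.sub (z0.add (ContDiffOn.fun_smul (f := fun q : ℝ × ℝ => q.1 - t₀) (by fun_prop)
    (contDiffOn_const.fun_smul (z1.sub z0))))

theorem affineDefect_left (Z : ℝ → ℝ → ℂ) (θ : ℝ) : affineDefect t₀ t₁ Z t₀ θ = 0 := by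
  simp [affineDefect]

theorem affineDefect_right (h01 : t₀ < t₁) (Z : ℝ → ℝ → ℂ) (θ : ℝ) :
    affineDefect t₀ t₁ Z t₁ θ = 0 := by
  rw [affineDefect, smul_smul, mul_inv_cancel₀ (sub_ne_zero.2 h01.ne'), one_smul]
  ring

/-- Along the variation that shrinks the deviation `η` from the affine path, the energy has the
derivative `-2 planeEnergy η`, so the deviation of a critical point vanishes. -/
theorem affineOnIcc_of_hasDerivAt (h01 : t₀ < t₁) {Z : ℝ → ℝ → ℂ}
    (hZ : ContDiffOn ℝ ∞ (fun q : ℝ × ℝ => Z q.1 q.2) (Icc t₀ t₁ ×ˢ I))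
    (h : HasDerivAt (fun s : ℝ => planeEnergy t₀ t₁
      (fun t θ => Z t θ - s • affineDefect t₀ t₁ Z t θ)) 0 0) : AffineOnIcc t₀ t₁ Z := by
  have hη := contDiffOn_affineDefect h01.le hZ
  set η := affineDefect t₀ t₁ Z
  have hA : ContDiffOn ℝ ∞ (fun q : ℝ × ℝ => Z q.1 q.2 - η q.1 q.2) (Icc t₀ t₁ ×ˢ I) := hZ.sub hη
  have hE : ∀ s : ℝ, planeEnergy t₀ t₁ (fun t θ => Z t θ - s • η t θ)
      = planeEnergy t₀ t₁ (fun t θ => Z t θ - η t θ) + (1 - s) ^ 2 * planeEnergy t₀ t₁ η := by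
    intro s
    rw [← planeEnergy_affine_add h01 hA hη (u := fun θ => Z t₀ θ)
      (v := fun θ => (t₁ - t₀)⁻¹ • (Z t₁ θ - Z t₀ θ)) (fun t _ θ _ => by
        simp only [η, affineDefect]; ring) (fun θ _ => affineDefect_left Z θ)
      (fun θ _ => affineDefect_right h01 Z θ)]
    congr 1
    ext t θ
    rw [sub_smul, one_smul]
    ring
  simp_rw [hE] at h
  have h' : HasDerivAt (fun s : ℝ => planeEnergy t₀ t₁ (fun t θ => Z t θ - η t θ)
      + (1 - s) ^ 2 * planeEnergy t₀ t₁ η) (-2 * planeEnergy t₀ t₁ η) 0 := by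
    have := ((((hasDerivAt_id (0 : ℝ)).const_sub 1).pow 2).mul_const
      (planeEnergy t₀ t₁ η)).const_add (planeEnergy t₀ t₁ (fun t θ => Z t θ - η t θ))
    convert! this using 1
    simp
  have h0 : planeEnergy t₀ t₁ η = 0 := by
    have := h.unique h'
    linarith
  intro θ hθ t ht
  exact sub_eq_zero.1 (eq_zero_of_planeEnergy_eq_zero h01 hη
    (fun θ _ => affineDefect_left Z θ) h0 t ht θ hθ)

/-- The variation of a path `exp ℓ` that shrinks its deviation from the affine path, in logarithmic
coordinates. -/
def shrink (t₀ t₁ : ℝ) (ℓ : ℝ → ℝ → ℂ) (s t θ : ℝ) : ℂ :=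
  ℓ t θ + Complex.log (1 - s • (affineDefect t₀ t₁ (fun t θ => Complex.exp (ℓ t θ)) t θ
    / Complex.exp (ℓ t θ)))

/-- For small `s` the shrinking variation avoids the origin uniformly in `t` and `θ`, so it has a
smooth logarithmic coordinate. -/
theorem exists_shrink (h01 : t₀ < t₁) {ℓ : ℝ → ℝ → ℂ}
    (hℓ : ContDiffOn ℝ ∞ (fun q : ℝ × ℝ => ℓ q.1 q.2) (Icc t₀ t₁ ×ˢ I)) :
    ∃ ε > 0, ContDiffOn ℝ ∞ (fun q : (ℝ × ℝ) × ℝ => shrink t₀ t₁ ℓ q.1.1 q.1.2 q.2)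
        ((Ioo (-ε) ε ×ˢ Icc t₀ t₁) ×ˢ I) ∧
      ∀ s ∈ Ioo (-ε) ε, ∀ t ∈ Icc t₀ t₁, ∀ θ ∈ I, Complex.exp (shrink t₀ t₁ ℓ s t θ)
        = Complex.exp (ℓ t θ)
          - s • affineDefect t₀ t₁ (fun t θ => Complex.exp (ℓ t θ)) t θ := by
  have hZ := contDiffOn_cexp hℓ
  have hη := contDiffOn_affineDefect h01.le (Z := fun t θ => Complex.exp (ℓ t θ)) hZ
  set η := affineDefect t₀ t₁ (fun t θ => Complex.exp (ℓ t θ))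
  have hq : ContDiffOn ℝ ∞ (fun q : ℝ × ℝ => η q.1 q.2 / Complex.exp (ℓ q.1 q.2))
      (Icc t₀ t₁ ×ˢ I) := by
    simp_rw [div_eq_mul_inv, ← Complex.exp_neg]
    exact hη.mul (contDiffOn_cexp hℓ.neg)
  obtain ⟨K, hK⟩ := (isCompact_Icc.prod isCompact_Icc).exists_bound_of_continuousOn
    hq.continuousOn
  have hmem : ∀ s ∈ Ioo (-(1 / (|K| + 1))) (1 / (|K| + 1)), ∀ t ∈ Icc t₀ t₁, ∀ θ ∈ I,
      1 - s • (η t θ / Complex.exp (ℓ t θ)) ∈ Complex.slitPlane := by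
    intro s hs t ht θ hθ
    have hn : ‖s • (η t θ / Complex.exp (ℓ t θ))‖ < 1 := by
      rw [norm_smul, Real.norm_eq_abs]
      have h1 : |s| < 1 / (|K| + 1) := abs_lt.2 hs
      have h2 := (hK (t, θ) ⟨ht, hθ⟩).trans (le_abs_self K)
      rw [lt_div_iff₀ (by positivity)] at h1
      nlinarith [abs_nonneg s, norm_nonneg (η t θ / Complex.exp (ℓ t θ))]
    rw [sub_eq_add_neg]
    exact Complex.mem_slitPlane_of_norm_lt_one (by rwa [norm_neg])
  refine ⟨1 / (|K| + 1), by positivity, ?_, fun s hs t ht θ hθ => ?_⟩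
  · have hmaps : MapsTo (fun q : (ℝ × ℝ) × ℝ => (q.1.2, q.2))
        ((Ioo (-(1 / (|K| + 1))) (1 / (|K| + 1)) ×ˢ Icc t₀ t₁) ×ˢ I) (Icc t₀ t₁ ×ˢ I) :=
      fun q hq => ⟨hq.1.2, hq.2⟩
    have hℓ' := hℓ.comp (f := fun q : (ℝ × ℝ) × ℝ => (q.1.2, q.2)) (by fun_prop) hmaps
    have hq' := hq.comp (f := fun q : (ℝ × ℝ) × ℝ => (q.1.2, q.2)) (by fun_prop) hmaps
    refine hℓ'.add fun q hq => ?_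
    refine ContDiffAt.comp_contDiffWithinAt q (contDiffAt_clog (hmem _ hq.1.1 _ hq.1.2 _ hq.2))
      ((contDiffOn_const.sub
        (ContDiffOn.fun_smul (f := fun q : (ℝ × ℝ) × ℝ => q.1.1) (by fun_prop) hq')) q hq)
  · rw [shrink, Complex.exp_add,
      Complex.exp_log (Complex.slitPlane_ne_zero (hmem s hs t ht θ hθ)), mul_sub, mul_one,
      mul_smul_comm, mul_div_cancel₀ _ (Complex.exp_ne_zero _)]

theorem shrink_zero (ℓ : ℝ → ℝ → ℂ) (t θ : ℝ) : shrink t₀ t₁ ℓ 0 t θ = ℓ t θ := by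
  simp [shrink]

theorem shrink_left (ℓ : ℝ → ℝ → ℂ) (s θ : ℝ) : shrink t₀ t₁ ℓ s t₀ θ = ℓ t₀ θ := by
  simp [shrink, affineDefect_left]

theorem shrink_right (h01 : t₀ < t₁) (ℓ : ℝ → ℝ → ℂ) (s θ : ℝ) :
    shrink t₀ t₁ ℓ s t₁ θ = ℓ t₁ θ := by
  simp [shrink, affineDefect_right h01]

/-! ### Spaces of curves modelled on the cone -/

/-- The space `(M / rel, G)` of curves is identified by `T` with the space of curves in the cone
that have a smooth logarithmic lift `ℓ`, and `G` is the `L²`-metric of the plane curves `exp ℓ`.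
Families of curves are indexed by the points of a convex set `S` with interior points. -/
structure PolarModel (a b : ℝ) {n : ℕ} (M : Set (ℝ → E n)) (rel : (ℝ → E n) → (ℝ → E n) → Prop)
    (G : (ℝ → E n) → (ℝ → E n) → (ℝ → E n) → ℝ) (T : (ℝ → E n) → ℝ → E 3) : Prop where
  /-- `T` preserves smoothness of families. -/
  contDiffOn_transform : ∀ {P : Type} [NormedAddCommGroup P] [NormedSpace ℝ P] {S : Set P},
    Convex ℝ S → (interior S).Nonempty → ∀ {γ : P → ℝ → E n},
    ContDiffOn ℝ ∞ (fun q : P × ℝ => γ q.1 q.2) (S ×ˢ I) → (∀ p ∈ S, γ p ∈ M) →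
    ContDiffOn ℝ ∞ (fun q : P × ℝ => T (γ q.1) q.2) (S ×ˢ I)
  /-- The curves `T c` lie in the cone. -/
  mem_cone : ∀ {c}, c ∈ M → ∀ θ ∈ I, T c θ ∈ cone a b
  /-- `T` is well defined and injective on classes. -/
  rel_iff : ∀ {c d}, c ∈ M → d ∈ M → (rel c d ↔ ∀ θ ∈ I, T c θ = T d θ)
  /-- Every smooth family of logarithmic lifts comes from a smooth family of curves. -/
  exists_family : ∀ {P : Type} [NormedAddCommGroup P] [NormedSpace ℝ P] {S : Set P},
    Convex ℝ S → (interior S).Nonempty → ∀ {ℓ : P × ℝ → ℂ}, ContDiffOn ℝ ∞ ℓ (S ×ˢ I) →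
    ∃ γ : P → ℝ → E n, ContDiffOn ℝ ∞ (fun q : P × ℝ => γ q.1 q.2) (S ×ˢ I) ∧
      (∀ p ∈ S, γ p ∈ M) ∧ ∀ p ∈ S, ∀ θ ∈ I, T (γ p) θ = polarExp a b (ℓ (p, θ))
  /-- In the logarithmic coordinate, `G` is the `L²`-metric of `exp ℓ` on velocities of paths. -/
  metric_eq : ∀ {J : Set ℝ}, Convex ℝ J → (interior J).Nonempty → ∀ {γ : ℝ → ℝ → E n},
    IsSmoothPath M J γ → ∀ {ℓ : ℝ → ℝ → ℂ},
    ContDiffOn ℝ ∞ (fun q : ℝ × ℝ => ℓ q.1 q.2) (J ×ˢ I) →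
    (∀ t ∈ J, ∀ θ ∈ I, T (γ t) θ = polarExp a b (ℓ t θ)) → ∀ t ∈ J,
    G (γ t) (timeDeriv J γ t) (timeDeriv J γ t) = speedSq J (fun t θ => Complex.exp (ℓ t θ)) t
  /-- `T` is continuous from the `C^∞`-topology to the topology of uniform convergence. -/
  continuous_transform : ∀ {c}, c ∈ M → ∀ δ > 0, ∃ N : ℕ, ∃ ε > 0, ∀ g ∈ M,
    (∀ j ≤ N, ∀ θ ∈ I, ‖iteratedDerivWithin j (g - c) I θ‖ < ε) → ∀ θ ∈ I, ‖T g θ - T c θ‖ < δ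

namespace PolarModel

variable {a b : ℝ} {n : ℕ} {M : Set (ℝ → E n)} {rel : (ℝ → E n) → (ℝ → E n) → Prop}
  {G : (ℝ → E n) → (ℝ → E n) → (ℝ → E n) → ℝ} {T : (ℝ → E n) → ℝ → E 3}

/-- Smooth families lift, extending a given lift over `B`. Without a prescribed part, take
`B = ∅`. -/
theorem exists_lift (h : PolarModel a b M rel G T) (ha : 0 < a) (hb : 0 < b)
    (hab : a ^ 2 ≤ 4 * b ^ 2) {P : Type} [NormedAddCommGroup P] [NormedSpace ℝ P] {S : Set P}
    (hS : Convex ℝ S) (hS' : (interior S).Nonempty) {γ : P → ℝ → E n}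
    (hγ : ContDiffOn ℝ ∞ (fun q : P × ℝ => γ q.1 q.2) (S ×ˢ I)) (hM : ∀ p ∈ S, γ p ∈ M)
    {B : Set (P × ℝ)} (hB : IsPreconnected B) (hBS : B ⊆ S ×ˢ I) {ℓ₀ : P × ℝ → ℂ}
    (hℓ₀ : ContinuousOn ℓ₀ B) (h₀ : ∀ q ∈ B, polarExp a b (ℓ₀ q) = T (γ q.1) q.2) :
    ∃ ℓ : P × ℝ → ℂ, ContDiffOn ℝ ∞ ℓ (S ×ˢ I) ∧
      (∀ p ∈ S, ∀ θ ∈ I, T (γ p) θ = polarExp a b (ℓ (p, θ))) ∧ EqOn ℓ ℓ₀ B := by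
  obtain ⟨ℓ, h1, h2, h3⟩ := exists_contDiffOn_polarExp_eqOn ha hb hab (hS.prod convex_I) hB hBS
    (h.contDiffOn_transform hS hS' hγ hM) (fun q hq => h.mem_cone (hM _ hq.1) _ hq.2) hℓ₀ h₀
  exact ⟨ℓ, h1, fun p hp θ hθ => (h2 (p, θ) ⟨hp, hθ⟩).symm, h3⟩

theorem energy_eq (h : PolarModel a b M rel G T) {t₀ t₁ : ℝ} (h01 : t₀ < t₁)
    {γ : ℝ → ℝ → E n} (hγ : IsSmoothPath M (Icc t₀ t₁) γ) {ℓ : ℝ → ℝ → ℂ}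
    (hℓ : ContDiffOn ℝ ∞ (fun q : ℝ × ℝ => ℓ q.1 q.2) (Icc t₀ t₁ ×ˢ I))
    (hT : ∀ t ∈ Icc t₀ t₁, ∀ θ ∈ I, T (γ t) θ = polarExp a b (ℓ t θ)) :
    energy G t₀ t₁ γ = planeEnergy t₀ t₁ (fun t θ => Complex.exp (ℓ t θ)) := by
  rw [energy, planeEnergy, integral_Icc_congr h01.le
    (h.metric_eq (convex_Icc _ _) (by rw [interior_Icc]; exact nonempty_Ioo.2 h01) hγ hℓ hT)]

/-- Geodesics are the paths whose logarithmic lift exponentiates to a path affine in time. -/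
theorem isGeodesic_iff (h : PolarModel a b M rel G T) (ha : 0 < a) (hb : 0 < b)
    (hab : a ^ 2 ≤ 4 * b ^ 2) {J : Set ℝ} (hJ : Convex ℝ J) {γ : ℝ → ℝ → E n}
    (hγ : IsSmoothPath M J γ) {ℓ : ℝ → ℝ → ℂ}
    (hℓ : ContDiffOn ℝ ∞ (fun q : ℝ × ℝ => ℓ q.1 q.2) (J ×ˢ I))
    (hT : ∀ t ∈ J, ∀ θ ∈ I, T (γ t) θ = polarExp a b (ℓ t θ)) :
    IsGeodesic M rel G J γ ↔ ∀ t₀ ∈ J, ∀ t₁ ∈ J, t₀ < t₁ →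
      AffineOnIcc t₀ t₁ (fun t θ => Complex.exp (ℓ t θ)) := by
  constructor
  · rintro ⟨-, hcrit⟩ t₀ ht₀ t₁ ht₁ h01
    have hsub : Icc t₀ t₁ ⊆ J := hJ.ordConnected.out ht₀ ht₁
    have hℓ' := hℓ.mono (prod_mono hsub Subset.rfl)
    have hJn : (interior (Icc t₀ t₁)).Nonempty := by rw [interior_Icc]; exact nonempty_Ioo.2 h01
    obtain ⟨ε, hε, hs, hexp⟩ := exists_shrink h01 hℓ'
    obtain ⟨Γ, hΓ, hΓM, hΓT⟩ := h.exists_family (P := ℝ × ℝ)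
      ((convex_Ioo (-ε) ε).prod (convex_Icc t₀ t₁)) (by
        rw [interior_prod_eq, interior_Ioo]
        exact Set.Nonempty.prod ⟨0, by simp [hε]⟩ hJn) hs
    have h0 : (0 : ℝ) ∈ Ioo (-ε) ε := by simp [hε]
    have l0 := left_mem_Icc.2 h01.le
    have r1 := right_mem_Icc.2 h01.le
    have hE := hcrit t₀ ht₀ t₁ ht₁ h01 ε hε (fun s t => Γ (s, t))
      (hΓ.comp (f := fun p : ℝ × ℝ × ℝ => ((p.1, p.2.1), p.2.2)) (by fun_prop)
        fun p hp => ⟨⟨hp.1, hp.2.1⟩, hp.2.2⟩)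
      (fun s hs t ht => hΓM (s, t) ⟨hs, ht⟩)
      (fun t ht => (h.rel_iff (hΓM (0, t) ⟨h0, ht⟩) (hγ.2 t (hsub ht))).2 fun θ hθ => by
        rw [hΓT (0, t) ⟨h0, ht⟩ θ hθ, hT t (hsub ht) θ hθ]
        simp only [shrink_zero])
      (fun s hs => ⟨(h.rel_iff (hΓM (s, t₀) ⟨hs, l0⟩) (hγ.2 t₀ ht₀)).2 fun θ hθ => by
          rw [hΓT (s, t₀) ⟨hs, l0⟩ θ hθ, hT t₀ ht₀ θ hθ]
          simp only [shrink_left],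
        (h.rel_iff (hΓM (s, t₁) ⟨hs, r1⟩) (hγ.2 t₁ ht₁)).2 fun θ hθ => by
          rw [hΓT (s, t₁) ⟨hs, r1⟩ θ hθ, hT t₁ ht₁ θ hθ]
          simp only [shrink_right h01]⟩)
    refine affineOnIcc_of_hasDerivAt h01 (contDiffOn_cexp hℓ') (hE.congr_of_eventuallyEq ?_)
    filter_upwards [Ioo_mem_nhds h0.1 h0.2] with s hs'
    rw [h.energy_eq h01 ⟨hΓ.comp (f := fun q : ℝ × ℝ => ((s, q.1), q.2)) (by fun_prop)
        fun p hp => ⟨⟨hs', hp.1⟩, hp.2⟩, fun t ht => hΓM (s, t) ⟨hs', ht⟩⟩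
      (ℓ := fun t θ => shrink t₀ t₁ ℓ s t θ)
      (hs.comp (f := fun q : ℝ × ℝ => ((s, q.1), q.2)) (by fun_prop)
        fun p hp => ⟨⟨hs', hp.1⟩, hp.2⟩) (fun t ht θ hθ => hΓT (s, t) ⟨hs', ht⟩ θ hθ)]
    exact planeEnergy_congr h01.le fun t ht θ hθ => (hexp s hs' t ht θ hθ).symm
  · intro haff
    refine ⟨hγ, fun t₀ ht₀ t₁ ht₁ h01 ε hε Γ hΓ hΓM hΓ0 hΓe => ?_⟩
    have hsub : Icc t₀ t₁ ⊆ J := hJ.ordConnected.out ht₀ ht₁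
    have hJn : (interior (Icc t₀ t₁)).Nonempty := by rw [interior_Icc]; exact nonempty_Ioo.2 h01
    have h0 : (0 : ℝ) ∈ Ioo (-ε) ε := by simp [hε]
    have l0 := left_mem_Icc.2 h01.le
    have r1 := right_mem_Icc.2 h01.le
    have hSn : (interior (Ioo (-ε) ε ×ˢ Icc t₀ t₁)).Nonempty := by
      rw [interior_prod_eq, interior_Ioo]
      exact Set.Nonempty.prod ⟨0, h0⟩ hJn
    -- the lift of the variation that extends the given lift at `s = 0`
    obtain ⟨Λ, hΛ, hΛT, hΛ0⟩ := h.exists_lift ha hb hab (P := ℝ × ℝ)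
      (γ := fun p => Γ p.1 p.2) ((convex_Ioo (-ε) ε).prod (convex_Icc t₀ t₁)) hSn
      (hΓ.comp (f := fun q : (ℝ × ℝ) × ℝ => (q.1.1, q.1.2, q.2)) (by fun_prop)
        fun q hq => ⟨hq.1.1, hq.1.2, hq.2⟩) (fun p hp => hΓM p.1 hp.1 p.2 hp.2)
      (B := ({0} ×ˢ Icc t₀ t₁) ×ˢ I)
      ((isPreconnected_singleton.prod isPreconnected_Icc).prod convex_I.isPreconnected)
      (prod_mono (prod_mono (by simpa using hε) Subset.rfl) Subset.rfl)
      (ℓ₀ := fun q => ℓ q.1.2 q.2)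
      (hℓ.continuousOn.comp (f := fun q : (ℝ × ℝ) × ℝ => (q.1.2, q.2)) (by fun_prop)
        fun q hq => ⟨hsub hq.1.2, hq.2⟩) (by
        rintro ⟨⟨s, t⟩, θ⟩ ⟨⟨hs, ht⟩, hθ⟩
        obtain rfl : s = 0 := hs
        rw [← hT t (hsub ht) θ hθ]
        exact ((h.rel_iff (hΓM 0 h0 t ht) (hγ.2 t (hsub ht))).1 (hΓ0 t ht) θ hθ).symm)
    -- where the curve is fixed, so is its lift, by uniqueness of lifts in the direction of `s`
    have hend : ∀ t ∈ Icc t₀ t₁, t ∈ J → (∀ s ∈ Ioo (-ε) ε, rel (Γ s t) (γ t)) →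
        ∀ s ∈ Ioo (-ε) ε, ∀ θ ∈ I, Λ ((s, t), θ) = Λ ((0, t), θ) := by
      intro t ht htJ hr s hs θ hθ
      refine eqOn_of_polarExp_eq ha hb isPreconnected_Ioo (f := fun s => Λ ((s, t), θ))
        (g := fun _ => Λ ((0, t), θ)) (hΛ.continuousOn.comp (f := fun s : ℝ => ((s, t), θ))
          (by fun_prop) fun s hs => ⟨⟨hs, ht⟩, hθ⟩) continuousOn_const (fun s hs => ?_) h0 rfl hs
      rw [← hΛT (s, t) ⟨hs, ht⟩ θ hθ, ← hΛT (0, t) ⟨h0, ht⟩ θ hθ]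
      rw [(h.rel_iff (hΓM s hs t ht) (hγ.2 t htJ)).1 (hr s hs) θ hθ,
        (h.rel_iff (hΓM 0 h0 t ht) (hγ.2 t htJ)).1 (hr 0 h0) θ hθ]
    have hΛz : ∀ t ∈ Icc t₀ t₁, ∀ θ ∈ I, Λ ((0, t), θ) = ℓ t θ := fun t ht θ hθ =>
      hΛ0 (show ((0, t), θ) ∈ _ from ⟨⟨rfl, ht⟩, hθ⟩)
    have key := hasDerivAt_planeEnergy_of_affine h01 hε
      (Z := fun s t θ => Complex.exp (Λ ((s, t), θ))) (contDiffOn_cexp hΛ)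
      (fun s hs θ hθ => by rw [hend t₀ l0 ht₀ (fun s hs => (hΓe s hs).1) s hs θ hθ])
      (fun s hs θ hθ => by rw [hend t₁ r1 ht₁ (fun s hs => (hΓe s hs).2) s hs θ hθ])
      (fun θ hθ t ht => by
        simp only [hΛz t ht θ hθ, hΛz t₀ l0 θ hθ, hΛz t₁ r1 θ hθ]
        exact haff t₀ ht₀ t₁ ht₁ h01 θ hθ t ht)
    refine key.congr_of_eventuallyEq ?_
    filter_upwards [Ioo_mem_nhds h0.1 h0.2] with s hs
    exact h.energy_eq h01 ⟨hΓ.comp (f := fun q : ℝ × ℝ => (s, q.1, q.2)) (by fun_prop)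
        fun p hp => ⟨hs, hp.1, hp.2⟩, fun t ht => hΓM s hs t ht⟩
      (hΛ.comp (f := fun q : ℝ × ℝ => ((s, q.1), q.2)) (by fun_prop)
        fun p hp => ⟨⟨hs, hp.1⟩, hp.2⟩) (fun t ht θ hθ => hΛT (s, t) ⟨hs, ht⟩ θ hθ)

end PolarModel

/-! ### Geodesics of the cone -/

theorem planeEnergy_const (t₀ t₁ : ℝ) (Z : ℝ → ℂ) : planeEnergy t₀ t₁ (fun t _ => Z t)
    = 2 * π * ((1 / 2) * ∫ t in t₀..t₁, ‖derivWithin Z (Icc t₀ t₁) t‖ ^ 2) := by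
  simp only [planeEnergy, speedSq, intervalIntegral.integral_const, smul_eq_mul, sub_zero,
    intervalIntegral.integral_const_mul]
  ring

theorem coneEnergy_eq {a b : ℝ} (ha : 0 < a) (hb : 0 < b) (hab : a ^ 2 ≤ 4 * b ^ 2)
    {t₀ t₁ : ℝ} (h01 : t₀ < t₁) {x : ℝ → E 3} {ℓ : ℝ → ℂ} (hℓ : ContDiffOn ℝ ∞ ℓ (Icc t₀ t₁))
    (hx : ∀ t ∈ Icc t₀ t₁, x t = polarExp a b (ℓ t)) :
    (1 / 2) * ∫ t in t₀..t₁, ‖derivWithin x (Icc t₀ t₁) t‖ ^ 2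
      = (2 * π)⁻¹ * planeEnergy t₀ t₁ (fun t _ => Complex.exp (ℓ t)) := by
  rw [planeEnergy_const, inv_mul_cancel_left₀ two_pi_pos.ne']
  congr 1
  refine integral_Icc_congr h01.le fun t ht => ?_
  rw [derivWithin_congr hx (hx t ht), norm_derivWithin_polarExp ha hb hab
    (uniqueDiffOn_Icc h01 t ht) (hℓ.differentiableOn (by simp) t ht)]

/-- The geodesics of the cone are the straight segments of the developed cone. A curve in the cone
is treated as a path of curves that are constant in `θ`. -/
theorem isConeGeodesic_iff {a b : ℝ} (ha : 0 < a) (hb : 0 < b) (hab : a ^ 2 ≤ 4 * b ^ 2)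
    {J : Set ℝ} (hJ : Convex ℝ J) {x : ℝ → E 3} {ℓ : ℝ → ℂ} (hℓ : ContDiffOn ℝ ∞ ℓ J)
    (hx : ∀ t ∈ J, x t = polarExp a b (ℓ t)) :
    IsConeGeodesic a b J x ↔ ∀ t₀ ∈ J, ∀ t₁ ∈ J, t₀ < t₁ →
      AffineOnIcc t₀ t₁ (fun t _ => Complex.exp (ℓ t)) := by
  have zI : (0 : ℝ) ∈ I := left_mem_Icc.2 two_pi_pos.le
  constructor
  · rintro ⟨-, -, hcrit⟩ t₀ ht₀ t₁ ht₁ h01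
    have hsub : Icc t₀ t₁ ⊆ J := hJ.ordConnected.out ht₀ ht₁
    have hℓ' : ContDiffOn ℝ ∞ (fun q : ℝ × ℝ => ℓ q.1) (Icc t₀ t₁ ×ˢ I) :=
      hℓ.comp (f := fun q : ℝ × ℝ => q.1) (by fun_prop) fun q hq => hsub hq.1
    obtain ⟨ε, hε, hs, hexp⟩ := exists_shrink (ℓ := fun t _ => ℓ t) h01 hℓ'
    set Λ := shrink t₀ t₁ (fun t _ => ℓ t)
    have h0 : (0 : ℝ) ∈ Ioo (-ε) ε := by simp [hε]
    have hΛ : ContDiffOn ℝ ∞ (fun p : ℝ × ℝ => Λ p.1 p.2 0) (Ioo (-ε) ε ×ˢ Icc t₀ t₁) :=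
      hs.comp (f := fun p : ℝ × ℝ => (p, 0)) (by fun_prop) fun p hp => ⟨hp, zI⟩
    have hE := hcrit t₀ ht₀ t₁ ht₁ h01 ε hε (fun s t => polarExp a b (Λ s t 0))
      (contDiff_polarExp.comp_contDiffOn hΛ)
      (fun s hs t ht => polarExp_mem_cone ha hb hab _)
      (fun t ht => by simp only [Λ, shrink_zero, hx t (hsub ht)])
      (fun s hs => by simp only [Λ, shrink_left, shrink_right h01, hx t₀ ht₀, hx t₁ ht₁, true_and])
    have hE' := hE.const_mul (2 * π)
    rw [mul_zero] at hE'
    refine affineOnIcc_of_hasDerivAt h01 (contDiffOn_cexp hℓ') (hE'.congr_of_eventuallyEq ?_)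
    filter_upwards [Ioo_mem_nhds h0.1 h0.2] with s hs'
    rw [coneEnergy_eq ha hb hab h01 (ℓ := fun t => Λ s t 0)
      (hΛ.comp (f := fun t : ℝ => (s, t)) (by fun_prop) fun t ht => ⟨hs', ht⟩) fun t _ => rfl,
      mul_inv_cancel_left₀ two_pi_pos.ne']
    refine planeEnergy_congr h01.le fun t ht θ hθ => ?_
    rw [hexp s hs' t ht 0 zI]
    rfl
  · intro haff
    refine ⟨(contDiff_polarExp.comp_contDiffOn hℓ).congr hx, fun t ht => ?_,
      fun t₀ ht₀ t₁ ht₁ h01 ε hε X hX hXc hX0 hXe => ?_⟩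
    · rw [hx t ht]
      exact polarExp_mem_cone ha hb hab _
    have hsub : Icc t₀ t₁ ⊆ J := hJ.ordConnected.out ht₀ ht₁
    have h0 : (0 : ℝ) ∈ Ioo (-ε) ε := by simp [hε]
    have l0 := left_mem_Icc.2 h01.le
    have r1 := right_mem_Icc.2 h01.le
    obtain ⟨Λ, hΛ, hΛX, hΛ0⟩ := exists_contDiffOn_polarExp_eqOn ha hb hab
      ((convex_Ioo (-ε) ε).prod (convex_Icc t₀ t₁)) (B := {0} ×ˢ Icc t₀ t₁)
      (isPreconnected_singleton.prod isPreconnected_Icc)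
      (prod_mono (by simpa using hε) Subset.rfl) hX (fun p hp => hXc p.1 hp.1 p.2 hp.2)
      (ℓ₀ := fun p => ℓ p.2) (hℓ.continuousOn.comp (f := fun p : ℝ × ℝ => p.2) (by fun_prop)
        fun p hp => hsub hp.2) (by
        rintro ⟨s, t⟩ ⟨hs, ht⟩
        obtain rfl : s = 0 := hs
        simp only
        rw [hX0 t ht, hx t (hsub ht)])
    -- where the point is fixed, so is its lift, by uniqueness of lifts in the direction of `s`
    have hend : ∀ t ∈ Icc t₀ t₁, (∀ s ∈ Ioo (-ε) ε, X s t = x t) →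
        ∀ s ∈ Ioo (-ε) ε, Λ (s, t) = Λ (0, t) := by
      intro t ht hr s hs
      refine eqOn_of_polarExp_eq ha hb isPreconnected_Ioo (f := fun s => Λ (s, t))
        (g := fun _ => Λ (0, t)) (hΛ.continuousOn.comp (f := fun s : ℝ => (s, t))
          (by fun_prop) fun s hs => ⟨hs, ht⟩) continuousOn_const (fun s hs => ?_) h0 rfl hs
      rw [hΛX (s, t) ⟨hs, ht⟩, hΛX (0, t) ⟨h0, ht⟩, hr s hs, hr 0 h0]
    have hΛz : ∀ t ∈ Icc t₀ t₁, Λ (0, t) = ℓ t := fun t ht => hΛ0 (show (0, t) ∈ _ from ⟨rfl, ht⟩)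
    have key := hasDerivAt_planeEnergy_of_affine h01 hε
      (Z := fun s t _ => Complex.exp (Λ (s, t)))
      (contDiffOn_cexp (hΛ.comp (f := fun q : (ℝ × ℝ) × ℝ => q.1) (by fun_prop) fun q hq => hq.1))
      (fun s hs θ hθ => by rw [hend t₀ l0 (fun s hs => (hXe s hs).1) s hs])
      (fun s hs θ hθ => by rw [hend t₁ r1 (fun s hs => (hXe s hs).2) s hs])
      (fun θ hθ t ht => by
        simp only [hΛz t ht, hΛz t₀ l0, hΛz t₁ r1]
        exact haff t₀ ht₀ t₁ ht₁ h01 θ hθ t ht)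
    have key' := key.const_mul (2 * π)⁻¹
    rw [mul_zero] at key'
    refine key'.congr_of_eventuallyEq ?_
    filter_upwards [Ioo_mem_nhds h0.1 h0.2] with s hs
    exact coneEnergy_eq ha hb hab h01 (hΛ.comp (f := fun t : ℝ => (s, t)) (by fun_prop)
      fun t ht => ⟨hs, ht⟩) fun t ht => (hΛX (s, t) ⟨hs, ht⟩).symm

/-! ### The geodesic distance between curves -/

/-- The Cauchy–Schwarz inequality on `[0, 2π]`. -/
theorem integral_mul_le_sqrt_mul_sqrt {f g : ℝ → ℝ} (hf : ContinuousOn f I)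
    (hg : ContinuousOn g I) : ∫ θ in (0 : ℝ)..2 * π, f θ * g θ
      ≤ √(∫ θ in (0 : ℝ)..2 * π, f θ ^ 2) * √(∫ θ in (0 : ℝ)..2 * π, g θ ^ 2) := by
  have hII : ∀ {f : ℝ → ℝ}, ContinuousOn f I → IntervalIntegrable f volume 0 (2 * π) :=
    fun hf => ContinuousOn.intervalIntegrable (by rwa [uIcc_two_pi])
  have hA : 0 ≤ ∫ θ in (0 : ℝ)..2 * π, f θ ^ 2 :=
    intervalIntegral.integral_nonneg two_pi_pos.le fun θ _ => sq_nonneg _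
  rw [← Real.sqrt_mul hA]
  refine Real.le_sqrt_of_sq_le ?_
  -- the quadratic polynomial `∫ (x f - g)²` in `x` has nonpositive discriminant
  have key : ∀ x : ℝ, 0 ≤ (∫ θ in (0 : ℝ)..2 * π, f θ ^ 2) * (x * x)
      + (-2 * ∫ θ in (0 : ℝ)..2 * π, f θ * g θ) * x + ∫ θ in (0 : ℝ)..2 * π, g θ ^ 2 := by
    intro x
    have h0 : 0 ≤ ∫ θ in (0 : ℝ)..2 * π, (x * f θ - g θ) ^ 2 :=
      intervalIntegral.integral_nonneg two_pi_pos.le fun θ _ => sq_nonneg _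
    have : ∀ θ, (x * f θ - g θ) ^ 2 = x * x * f θ ^ 2 + (-2 * x * (f θ * g θ) + g θ ^ 2) :=
      fun θ => by ring
    simp_rw [this] at h0
    rw [intervalIntegral.integral_add ((hII (hf.fun_pow 2)).const_mul _)
      (((hII (hf.fun_mul hg)).const_mul _).add (hII (hg.fun_pow 2))),
      intervalIntegral.integral_add ((hII (hf.fun_mul hg)).const_mul _) (hII (hg.fun_pow 2)),
      intervalIntegral.integral_const_mul, intervalIntegral.integral_const_mul] at h0
    linarith
  have := discrim_le_zero key
  rw [discrim] at this
  nlinarith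

theorem continuous_coverSq : Continuous (fun p : ℂ × ℂ => coverSq p.1 p.2) := by
  unfold coverSq
  fun_prop

/-- The `L²`-norm of the pointwise distances is a lower bound for the length: integrate the
pointwise inequality against the pointwise distance and use the Cauchy–Schwarz inequality. -/
theorem sqrt_integral_coverSq_le {ℓ : ℝ → ℝ → ℂ}
    (hℓ : ContDiffOn ℝ ∞ (fun q : ℝ × ℝ => ℓ q.1 q.2) (Icc 0 1 ×ˢ I)) :
    √(∫ θ in (0 : ℝ)..2 * π, coverSq (ℓ 0 θ) (ℓ 1 θ))
      ≤ ∫ t in (0 : ℝ)..1, √(speedSq (Icc 0 1) (fun t θ => Complex.exp (ℓ t θ)) t) := by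
  have hend : ∀ t ∈ Icc (0 : ℝ) 1, ContinuousOn (fun θ => ℓ t θ) I := fun t ht =>
    hℓ.continuousOn.comp (f := fun θ : ℝ => (t, θ)) (by fun_prop) fun _ h => ⟨ht, h⟩
  have hcov : ContinuousOn (fun θ => coverSq (ℓ 0 θ) (ℓ 1 θ)) I :=
    continuous_coverSq.comp_continuousOn (f := fun θ => (ℓ 0 θ, ℓ 1 θ))
      ((hend 0 ⟨le_rfl, zero_le_one⟩).prodMk (hend 1 ⟨zero_le_one, le_rfl⟩))
  have hd := (contDiffOn_timeDeriv (uniqueDiffOn_Icc one_pos) (Z := fun t θ => Complex.exp (ℓ t θ))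
    (contDiffOn_cexp hℓ)).continuousOn
  set f : ℝ → ℝ := fun θ => √(coverSq (ℓ 0 θ) (ℓ 1 θ))
  set g : ℝ → ℝ → ℝ := fun t θ => ‖derivWithin (fun τ => Complex.exp (ℓ τ θ)) (Icc 0 1) t‖
  have hf : ContinuousOn f I := hcov.sqrt
  have hg : ContinuousOn (fun q : ℝ × ℝ => g q.1 q.2) (Icc 0 1 ×ˢ I) := hd.norm
  have hgt : ∀ t ∈ Icc (0 : ℝ) 1, ContinuousOn (g t) I := fun t ht =>
    hg.comp (f := fun θ : ℝ => (t, θ)) (by fun_prop) fun _ h => ⟨ht, h⟩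
  have hfg : ContinuousOn (fun q : ℝ × ℝ => f q.2 * g q.1 q.2) (Icc 0 1 ×ˢ I) :=
    (hf.comp (f := fun q : ℝ × ℝ => q.2) (by fun_prop) fun q hq => hq.2).mul hg
  have hsq : ∫ θ in (0 : ℝ)..2 * π, coverSq (ℓ 0 θ) (ℓ 1 θ) = ∫ θ in (0 : ℝ)..2 * π, f θ ^ 2 :=
    integral_I_congr fun θ _ => (sq_sqrt (coverSq_nonneg _ _)).symm
  rw [hsq]
  set X := √(∫ θ in (0 : ℝ)..2 * π, f θ ^ 2)
  set L := ∫ t in (0 : ℝ)..1, √(speedSq (Icc 0 1) (fun t θ => Complex.exp (ℓ t θ)) t)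
  have hL : 0 ≤ L := intervalIntegral.integral_nonneg zero_le_one fun t _ => sqrt_nonneg _
  have hspeed : ContinuousOn (speedSq (Icc 0 1) (fun t θ => Complex.exp (ℓ t θ))) (Icc 0 1) :=
    continuousOn_integral_of_prod (P := ℝ) (F := fun q : ℝ × ℝ => g q.1 q.2 ^ 2)
      two_pi_pos.le (hg.fun_pow 2)
  have hXL : X ^ 2 ≤ X * L := by
    calc X ^ 2 = ∫ θ in (0 : ℝ)..2 * π, f θ ^ 2 :=
          sq_sqrt (intervalIntegral.integral_nonneg two_pi_pos.le fun θ _ => sq_nonneg _)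
      _ ≤ ∫ θ in (0 : ℝ)..2 * π, ∫ t in (0 : ℝ)..1, f θ * g t θ := by
          refine intervalIntegral.integral_mono_on two_pi_pos.le
            (ContinuousOn.intervalIntegrable (by rw [uIcc_two_pi]; exact hf.fun_pow 2))
            (ContinuousOn.intervalIntegrable ?_) fun θ hθ => ?_
          · rw [uIcc_two_pi]
            exact continuousOn_integral_of_prod (P := ℝ)
              (F := fun q : ℝ × ℝ => f q.1 * g q.2 q.1) zero_le_one
              (hfg.comp (f := fun q : ℝ × ℝ => (q.2, q.1)) (by fun_prop)
                fun q hq => ⟨hq.2, hq.1⟩)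
          · rw [intervalIntegral.integral_const_mul, sq]
            have hθ' := sqrt_coverSq_le_expLength (contDiffOn_slice hℓ hθ)
            rw [expLength] at hθ'
            exact mul_le_mul_of_nonneg_left hθ' (sqrt_nonneg _)
      _ = ∫ t in (0 : ℝ)..1, ∫ θ in (0 : ℝ)..2 * π, f θ * g t θ :=
          (integral_swap_of_continuousOn (α := 0) (β := 1) (f := fun q => f q.2 * g q.1 q.2)
            zero_le_one hfg).symm
      _ ≤ ∫ t in (0 : ℝ)..1,
            X * √(speedSq (Icc 0 1) (fun t θ => Complex.exp (ℓ t θ)) t) := by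
          refine intervalIntegral.integral_mono_on zero_le_one
            (ContinuousOn.intervalIntegrable ?_) (ContinuousOn.intervalIntegrable ?_)
            fun t ht => integral_mul_le_sqrt_mul_sqrt hf (hgt t ht)
          · rw [uIcc_of_le zero_le_one]
            exact continuousOn_integral_of_prod (P := ℝ)
              (F := fun q : ℝ × ℝ => f q.2 * g q.1 q.2) two_pi_pos.le hfg
          · rw [uIcc_of_le zero_le_one]
            exact continuousOn_const.mul hspeed.sqrt
      _ = X * L := intervalIntegral.integral_const_mul _ _
  rcases (sqrt_nonneg _ : 0 ≤ X).eq_or_lt with h0 | h0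
  · exact h0.symm.le.trans hL
  · rw [sq] at hXL
    exact le_of_mul_le_mul_left hXL h0

/-- The family of connecting paths `segPath` between two curves of logarithmic coordinates. -/
def segFamily (ε : ℝ) (z w : ℝ → ℂ) (q : ℝ × ℝ) : ℂ :=
  segPath (stretch ε ((w q.2).im - (z q.2).im)) (z q.2) (w q.2) q.1

theorem contDiffOn_segFamily {ε : ℝ} (hε : 0 < ε) {z w : ℝ → ℂ} (hz : ContDiffOn ℝ ∞ z I)
    (hw : ContDiffOn ℝ ∞ w I) : ContDiffOn ℝ ∞ (segFamily ε z w) (Icc 0 1 ×ˢ I) := by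
  have hz' : ContDiffOn ℝ ∞ (fun q : ℝ × ℝ => z q.2) (Icc (0 : ℝ) 1 ×ˢ I) :=
    hz.comp (f := fun q : ℝ × ℝ => q.2) (by fun_prop) fun q hq => hq.2
  have hw' : ContDiffOn ℝ ∞ (fun q : ℝ × ℝ => w q.2) (Icc (0 : ℝ) 1 ×ˢ I) :=
    hw.comp (f := fun q : ℝ × ℝ => q.2) (by fun_prop) fun q hq => hq.2
  refine contDiffOn_segPath ((contDiff_stretch hε).comp_contDiffOn
    ((Complex.imCLM.contDiff.comp_contDiffOn hw').sub
      (Complex.imCLM.contDiff.comp_contDiffOn hz'))) contDiffOn_fst hz' hw'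
    (fun _ _ => stretch_pos _ _) (fun q _ => ?_) fun q hq => hq.1
  simpa using abs_lt_stretch_mul_pi hε ((w q.2).im - (z q.2).im)

theorem integral_speedSq_segFamily {ε : ℝ} (hε : 0 < ε) {z w : ℝ → ℂ} (hz : ContDiffOn ℝ ∞ z I)
    (hw : ContDiffOn ℝ ∞ w I) :
    ∫ t in (0 : ℝ)..1, speedSq (Icc 0 1) (fun t θ => Complex.exp (segFamily ε z w (t, θ))) t
      = ∫ θ in (0 : ℝ)..2 * π, segEnergy (stretch ε ((w θ).im - (z θ).im)) (z θ) (w θ) := by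
  have hd := (contDiffOn_timeDeriv (uniqueDiffOn_Icc one_pos)
    (Z := fun t θ => Complex.exp (segFamily ε z w (t, θ)))
    (contDiffOn_cexp (contDiffOn_segFamily hε hz hw))).continuousOn
  have := integral_swap_of_continuousOn (α := 0) (β := 1) (f := fun q : ℝ × ℝ => ‖derivWithin
    (fun τ => Complex.exp (segFamily ε z w (τ, q.2))) (Icc 0 1) q.1‖ ^ 2) zero_le_one
    (hd.norm.fun_pow 2)
  simp only [speedSq]
  rw [this]
  refine integral_I_congr fun θ _ => ?_
  have hlt : |(w θ - z θ).im| < stretch ε ((w θ).im - (z θ).im) * π := by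
    simpa using abs_lt_stretch_mul_pi hε ((w θ).im - (z θ).im)
  simp only [segFamily]
  exact integral_norm_sq_segPath (stretch_pos _ _) hlt

theorem tendsto_integral_segEnergy {z w : ℝ → ℂ} (hz : ContinuousOn z I) (hw : ContinuousOn w I) :
    Tendsto (fun ε => √(∫ θ in (0 : ℝ)..2 * π,
      segEnergy (stretch ε ((w θ).im - (z θ).im)) (z θ) (w θ))) (𝓝[>] 0)
      (𝓝 √(∫ θ in (0 : ℝ)..2 * π, coverSq (z θ) (w θ))) := by
  simp_rw [← segEnergy_stretch_zero]
  have hc : ContinuousOn (fun ε : ℝ => ∫ θ in (0 : ℝ)..2 * π,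
      segEnergy (stretch ε ((w θ).im - (z θ).im)) (z θ) (w θ)) univ := by
    refine continuousOn_integral_of_prod (P := ℝ) (F := fun q : ℝ × ℝ =>
      segEnergy (stretch q.1 ((w q.2).im - (z q.2).im)) (z q.2) (w q.2)) two_pi_pos.le ?_
    exact continuous_segEnergy_stretch.comp_continuousOn
      (f := fun q : ℝ × ℝ => (q.1, z q.2, w q.2)) (continuousOn_fst.prodMk
        ((hz.comp continuousOn_snd fun q hq => hq.2).prodMk
          (hw.comp continuousOn_snd fun q hq => hq.2)))
  exact ((continuousOn_univ.1 hc).sqrt.tendsto 0).mono_left nhdsWithin_le_nhds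

namespace PolarModel

variable {a b : ℝ} {n : ℕ} {M : Set (ℝ → E n)} {rel : (ℝ → E n) → (ℝ → E n) → Prop}
  {G : (ℝ → E n) → (ℝ → E n) → (ℝ → E n) → ℝ} {T : (ℝ → E n) → ℝ → E 3}

theorem contDiffOn_transform_single (h : PolarModel a b M rel G T)
    (hM : ∀ c ∈ M, c ∈ smoothCurves n) {c : ℝ → E n} (hc : c ∈ M) : ContDiffOn ℝ ∞ (T c) I := by
  have := h.contDiffOn_transform (P := ℝ) (γ := fun _ => c) convex_univ
    (by simp) ((hM c hc).comp (f := fun q : ℝ × ℝ => q.2) (by fun_prop) fun q hq => hq.2)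
    fun _ _ => hc
  exact this.comp (f := fun θ : ℝ => ((0 : ℝ), θ)) (by fun_prop) fun θ hθ => ⟨mem_univ _, hθ⟩

theorem exists_lift_single (h : PolarModel a b M rel G T) (hM : ∀ c ∈ M, c ∈ smoothCurves n)
    (ha : 0 < a) (hb : 0 < b) (hab : a ^ 2 ≤ 4 * b ^ 2) {c : ℝ → E n} (hc : c ∈ M) :
    ∃ ℓ : ℝ → ℂ, ContDiffOn ℝ ∞ ℓ I ∧ ∀ θ ∈ I, polarExp a b (ℓ θ) = T c θ :=
  exists_contDiffOn_polarExp ha hb hab convex_I (h.contDiffOn_transform_single hM hc)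
    (h.mem_cone hc)

/-- A continuous lift differs from a smooth one by a constant. -/
theorem contDiffOn_of_lift (h : PolarModel a b M rel G T) (hM : ∀ c ∈ M, c ∈ smoothCurves n)
    (ha : 0 < a) (hb : 0 < b) (hab : a ^ 2 ≤ 4 * b ^ 2) {c : ℝ → E n} (hc : c ∈ M) {ℓ : ℝ → ℂ}
    (hℓ : ContinuousOn ℓ I) (hT : ∀ θ ∈ I, polarExp a b (ℓ θ) = T c θ) : ContDiffOn ℝ ∞ ℓ I := by
  obtain ⟨ℓ', hℓ', hT'⟩ := h.exists_lift_single hM ha hb hab hc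
  obtain ⟨k, hk⟩ := exists_int_forall_eq_add ha hb convex_I.isPreconnected hℓ hℓ'.continuousOn
    fun θ hθ => by rw [hT θ hθ, hT' θ hθ]
  exact (hℓ'.add contDiffOn_const).congr hk

theorem pathLength_eq (h : PolarModel a b M rel G T) {γ : ℝ → ℝ → E n}
    (hγ : IsSmoothPath M (Icc 0 1) γ) {ℓ : ℝ → ℝ → ℂ}
    (hℓ : ContDiffOn ℝ ∞ (fun q : ℝ × ℝ => ℓ q.1 q.2) (Icc 0 1 ×ˢ I))
    (hT : ∀ t ∈ Icc (0 : ℝ) 1, ∀ θ ∈ I, T (γ t) θ = polarExp a b (ℓ t θ)) :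
    pathLength G γ
      = ∫ t in (0 : ℝ)..1, √(speedSq (Icc 0 1) (fun t θ => Complex.exp (ℓ t θ)) t) := by
  refine integral_Icc_congr zero_le_one fun t ht => ?_
  rw [h.metric_eq (convex_Icc _ _) (by simp) hγ hℓ hT t ht]

/-- Every path between two curves is at least as long as the `L²`-distance of its lifted ends. -/
theorem exists_int_le_of_mem_joiningLengths (h : PolarModel a b M rel G T) (ha : 0 < a)
    (hb : 0 < b) (hab : a ^ 2 ≤ 4 * b ^ 2) {c d : ℝ → E n} (hc : c ∈ M) (hd : d ∈ M)
    {z w : ℝ → ℂ} (hz : ContinuousOn z I) (hw : ContinuousOn w I)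
    (hzT : ∀ θ ∈ I, polarExp a b (z θ) = T c θ) (hwT : ∀ θ ∈ I, polarExp a b (w θ) = T d θ)
    {L : ℝ} (hL : L ∈ joiningLengths M rel G c d) :
    ∃ k : ℤ, √(∫ θ in (0 : ℝ)..2 * π,
      coverSq (z θ) (w θ + (k * (π * a / b) : ℝ) * Complex.I)) ≤ L := by
  obtain ⟨γ, hγ, h0, h1, rfl⟩ := hL
  have m0 : (0 : ℝ) ∈ Icc (0 : ℝ) 1 := by simp
  have m1 : (1 : ℝ) ∈ Icc (0 : ℝ) 1 := by simp
  obtain ⟨ℓ, hℓ, hℓT, hℓ0⟩ := h.exists_lift ha hb hab (P := ℝ) (convex_Icc (0 : ℝ) 1) (by simp)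
    hγ.1 hγ.2 (B := {0} ×ˢ I) (isPreconnected_singleton.prod convex_I.isPreconnected)
    (prod_mono (by simp) Subset.rfl) (ℓ₀ := fun q => z q.2)
    (hz.comp continuousOn_snd fun q hq => hq.2) (by
      rintro ⟨t, θ⟩ ⟨ht, hθ⟩
      obtain rfl : t = 0 := ht
      rw [hzT θ hθ, (h.rel_iff (hγ.2 0 m0) hc).1 h0 θ hθ])
  obtain ⟨k, hk⟩ := exists_int_forall_eq_add ha hb convex_I.isPreconnected
    (f := fun θ => ℓ (1, θ)) (hℓ.continuousOn.comp (f := fun θ : ℝ => ((1 : ℝ), θ)) (by fun_prop)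
      fun θ hθ => ⟨m1, hθ⟩) hw fun θ hθ => by
        rw [← hℓT 1 m1 θ hθ, hwT θ hθ, (h.rel_iff (hγ.2 1 m1) hd).1 h1 θ hθ]
  refine ⟨k, ?_⟩
  rw [h.pathLength_eq hγ (ℓ := fun t θ => ℓ (t, θ)) hℓ hℓT]
  convert sqrt_integral_coverSq_le (ℓ := fun t θ => ℓ (t, θ)) hℓ using 2
  refine integral_I_congr fun θ hθ => ?_
  rw [hk θ hθ, hℓ0 (show ((0 : ℝ), θ) ∈ _ from ⟨rfl, hθ⟩)]

/-- Every `θ` is moved along its connecting path simultaneously; the length of the resulting path of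
curves is bounded by its energy. -/
theorem exists_mem_joiningLengths_le (h : PolarModel a b M rel G T) {c d : ℝ → E n} (hc : c ∈ M)
    (hd : d ∈ M) {z w : ℝ → ℂ} (hz : ContDiffOn ℝ ∞ z I) (hw : ContDiffOn ℝ ∞ w I)
    (hzT : ∀ θ ∈ I, polarExp a b (z θ) = T c θ) (hwT : ∀ θ ∈ I, polarExp a b (w θ) = T d θ)
    {ε : ℝ} (hε : 0 < ε) : ∃ L ∈ joiningLengths M rel G c d, L ≤ √(∫ θ in (0 : ℝ)..2 * π,
      segEnergy (stretch ε ((w θ).im - (z θ).im)) (z θ) (w θ)) := by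
  have hℓ := contDiffOn_segFamily hε hz hw
  obtain ⟨γ, hγ, hγM, hγT⟩ := h.exists_family (P := ℝ) (convex_Icc (0 : ℝ) 1) (by simp) hℓ
  have m0 : (0 : ℝ) ∈ Icc (0 : ℝ) 1 := by simp
  have m1 : (1 : ℝ) ∈ Icc (0 : ℝ) 1 := by simp
  refine ⟨pathLength G γ, ⟨γ, ⟨hγ, hγM⟩, (h.rel_iff (hγM 0 m0) hc).2 fun θ hθ => ?_,
    (h.rel_iff (hγM 1 m1) hd).2 fun θ hθ => ?_, rfl⟩, ?_⟩
  · rw [hγT 0 m0 θ hθ, segFamily, segPath_zero, hzT θ hθ]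
  · rw [hγT 1 m1 θ hθ, segFamily, segPath_one (stretch_pos _ _)
      (by simpa using abs_lt_stretch_mul_pi hε ((w θ).im - (z θ).im)), hwT θ hθ]
  · rw [h.pathLength_eq ⟨hγ, hγM⟩ (ℓ := fun t θ => segFamily ε z w (t, θ)) hℓ hγT,
      ← integral_speedSq_segFamily hε hz hw]
    have hspeed : ContinuousOn (speedSq (Icc 0 1)
        (fun t θ => Complex.exp (segFamily ε z w (t, θ)))) (Icc 0 1) :=
      continuousOn_integral_of_prod (P := ℝ) two_pi_pos.le
        (((contDiffOn_timeDeriv (uniqueDiffOn_Icc one_pos)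
          (Z := fun t θ => Complex.exp (segFamily ε z w (t, θ)))
          (contDiffOn_cexp hℓ)).continuousOn.norm).fun_pow 2)
    refine (Real.le_sqrt_of_sq_le (sq_integral_le hspeed.sqrt)).trans (le_of_eq ?_)
    congr 1
    refine integral_Icc_congr zero_le_one fun t _ => sq_sqrt ?_
    exact intervalIntegral.integral_nonneg two_pi_pos.le fun θ _ => sq_nonneg _

/-- The geodesic distance is the least `L²`-distance of lifts, over the winding index. -/
theorem isLeast_geodesicDist (h : PolarModel a b M rel G T) (hM : ∀ c ∈ M, c ∈ smoothCurves n)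
    (ha : 0 < a) (hb : 0 < b) (hab : a ^ 2 ≤ 4 * b ^ 2) {c d : ℝ → E n} (hc : c ∈ M) (hd : d ∈ M)
    {z w : ℝ → ℂ} (hz : ContinuousOn z I) (hw : ContinuousOn w I)
    (hzT : ∀ θ ∈ I, polarExp a b (z θ) = T c θ) (hwT : ∀ θ ∈ I, polarExp a b (w θ) = T d θ) :
    (joiningLengths M rel G c d).Nonempty ∧
    IsLeast (Set.range fun k : ℤ => √(∫ θ in (0 : ℝ)..2 * π,
      coverSq (z θ) (w θ + (k * (π * a / b) : ℝ) * Complex.I))) (geodesicDist M rel G c d) := by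
  have hp : 0 < π * a / b := by positivity
  have hz' := h.contDiffOn_of_lift hM ha hb hab hc hz hzT
  have hw' := h.contDiffOn_of_lift hM ha hb hab hd hw hwT
  have hlow : ∀ L ∈ joiningLengths M rel G c d, ∃ k : ℤ, √(∫ θ in (0 : ℝ)..2 * π,
      coverSq (z θ) (w θ + (k * (π * a / b) : ℝ) * Complex.I)) ≤ L := fun L hL =>
    h.exists_int_le_of_mem_joiningLengths ha hb hab hc hd hz hw hzT hwT hL
  have hbdd : BddBelow (joiningLengths M rel G c d) :=
    ⟨0, fun L hL => let ⟨_, hk⟩ := hlow L hL; (sqrt_nonneg _).trans hk⟩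
  have hne : (joiningLengths M rel G c d).Nonempty :=
    let ⟨L, hL, _⟩ := h.exists_mem_joiningLengths_le hc hd hz' hw' hzT hwT one_pos
    ⟨L, hL⟩
  have hle : ∀ k : ℤ, geodesicDist M rel G c d ≤ √(∫ θ in (0 : ℝ)..2 * π,
      coverSq (z θ) (w θ + (k * (π * a / b) : ℝ) * Complex.I)) := by
    intro k
    have hwk : ContDiffOn ℝ ∞ (fun θ => w θ + (k * (π * a / b) : ℝ) * Complex.I) I :=
      hw'.add contDiffOn_const
    refine ge_of_tendsto (tendsto_integral_segEnergy hz hwk.continuousOn)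
      (eventually_nhdsWithin_of_forall fun ε hε => ?_)
    obtain ⟨L, hL, hLε⟩ := h.exists_mem_joiningLengths_le hc hd hz' hwk hzT
      (fun θ hθ => by rw [polarExp_add_period ha hb, hwT θ hθ]) hε
    exact (csInf_le hbdd hL).trans hLε
  obtain ⟨C, hC⟩ := isCompact_Icc.exists_bound_of_continuousOn (s := I)
    (f := fun θ => (z θ).im - (w θ).im)
    ((Complex.continuous_im.comp_continuousOn hz).sub (Complex.continuous_im.comp_continuousOn hw))
  obtain ⟨K, hK⟩ := exists_nat_forall_pi_le hp C
  obtain ⟨k₀, hk₀⟩ := exists_forall_le_of_eq_of_le_abs (K := K)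
    (V := √(∫ θ in (0 : ℝ)..2 * π, (Real.exp (z θ).re + Real.exp (w θ).re) ^ 2))
    (v := fun k : ℤ => √(∫ θ in (0 : ℝ)..2 * π,
      coverSq (z θ) (w θ + (k * (π * a / b) : ℝ) * Complex.I))) (fun k hk => by
      congr 1
      refine integral_I_congr fun θ hθ => ?_
      have := hK k hk _ (hC θ hθ)
      have him : (w θ + (k * (π * a / b) : ℝ) * Complex.I).im = (w θ).im + k * (π * a / b) := by
        simp
      have hre : (w θ + (k * (π * a / b) : ℝ) * Complex.I).re = (w θ).re := by simp
      rw [coverSq, him, hre, ← sub_sub, min_eq_right this, cos_pi]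
      ring)
  refine ⟨hne, ⟨k₀, le_antisymm (le_csInf hne fun L hL => ?_) (hle k₀)⟩, ?_⟩
  · obtain ⟨k, hk⟩ := hlow L hL
    exact (hk₀ k).trans hk
  · rintro _ ⟨k, rfl⟩
    exact hle k

end PolarModel

/-! ### Flatness -/

section LogNear

variable {a b : ℝ}

theorem exists_polarExp_eq (ha : 0 < a) (hb : 0 < b) (hab : a ^ 2 ≤ 4 * b ^ 2) {q : E 3}
    (hq : q ∈ cone a b) : ∃ z, polarExp a b z = q := by
  obtain ⟨ℓ, -, h⟩ := exists_contDiffOn_polarExp (X := ℝ) ha hb hab (convex_singleton 0)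
    (f := fun _ => q) contDiffOn_const fun _ _ => hq
  exact ⟨ℓ 0, h 0 rfl⟩

/-- The quotient of the first two coordinates of a point `q` of the cone, as a complex number, by
those of `polarExp a b z₀`. -/
def coneRatio (a b : ℝ) (z₀ : ℂ) (q : E 3) : ℂ :=
  ((2 * b / a : ℝ) : ℂ) * (q 0 + q 1 * Complex.I)
    * Complex.exp (-(z₀.re + (2 * b / a * z₀.im : ℝ) * Complex.I))

/-- The logarithmic coordinate of `q` whose imaginary part is at most half a period away from that
of `z₀`. It is a smooth function of `q` where `coneRatio` avoids the closed negative real axis. -/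
def logNear (a b : ℝ) (z₀ : ℂ) (q : E 3) : ℂ :=
  z₀ + ((Complex.log (coneRatio a b z₀ q)).re : ℂ)
    + ((Complex.log (coneRatio a b z₀ q)).im / (2 * b / a) : ℝ) * Complex.I

theorem coneRatio_polarExp (ha : 0 < a) (hb : 0 < b) (z₀ z : ℂ) :
    coneRatio a b z₀ (polarExp a b z)
      = Complex.exp ⟨z.re - z₀.re, 2 * b / a * (z.im - z₀.im)⟩ := by
  have hm : 2 * b / a ≠ 0 := by positivity
  set m := 2 * b / a
  have h1 : (m : ℂ) * (polarExp a b z 0 + polarExp a b z 1 * Complex.I)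
      = Complex.exp ⟨z.re, m * z.im⟩ := by
    have e0 : polarExp a b z 0 = Real.exp z.re / m * cos (m * z.im) := rfl
    have e1 : polarExp a b z 1 = Real.exp z.re / m * sin (m * z.im) := rfl
    rw [e0, e1]
    apply Complex.ext
    · rw [Complex.re_ofReal_mul, Complex.exp_re]
      simp only [Complex.add_re, Complex.ofReal_re, Complex.re_ofReal_mul, Complex.I_re, mul_zero,
        add_zero]
      field_simp
    · rw [Complex.im_ofReal_mul, Complex.exp_im]
      simp only [Complex.add_im, Complex.ofReal_im, Complex.im_ofReal_mul, Complex.I_im, mul_one,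
        zero_add]
      field_simp
  rw [coneRatio, h1, ← Complex.exp_add]
  congr 1
  apply Complex.ext <;> simp
  · ring
  · ring

theorem polarExp_logNear (ha : 0 < a) (hb : 0 < b) (hab : a ^ 2 ≤ 4 * b ^ 2) (z₀ : ℂ) {q : E 3}
    (hq : q ∈ cone a b) : polarExp a b (logNear a b z₀ q) = q := by
  obtain ⟨z, rfl⟩ := exists_polarExp_eq ha hb hab hq
  have hr := coneRatio_polarExp ha hb z₀ z
  have h0 : coneRatio a b z₀ (polarExp a b z) ≠ 0 := hr ▸ Complex.exp_ne_zero _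
  have hm : 2 * b / a ≠ 0 := by positivity
  have hlog := Complex.exp_log h0
  nth_rewrite 2 [hr] at hlog
  obtain ⟨k, hk⟩ := Complex.exp_eq_exp_iff_exists_int.1 hlog
  have hre : (Complex.log (coneRatio a b z₀ (polarExp a b z))).re = z.re - z₀.re := by
    simpa using congr(($hk).re)
  have him : (Complex.log (coneRatio a b z₀ (polarExp a b z))).im
      = 2 * b / a * (z.im - z₀.im) + k * (2 * π) := by simpa using congr(($hk).im)
  refine (polarExp_eq_iff ha hb).2 ⟨?_, k, ?_⟩
  · simp [logNear, hre, -Complex.ofReal_div]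
  · rw [logNear]
    simp only [Complex.add_im, Complex.ofReal_im, Complex.im_ofReal_mul, Complex.I_im, him]
    field_simp
    ring

theorem coneRatio_mem_slitPlane (ha : 0 < a) (hb : 0 < b) {z₀ z : ℂ}
    (h : |z.im - z₀.im| < π / (2 * b / a)) :
    coneRatio a b z₀ (polarExp a b z) ∈ Complex.slitPlane := by
  have hm : 0 < 2 * b / a := by positivity
  rw [coneRatio_polarExp ha hb]
  refine exp_mem_slitPlane ?_
  rwa [abs_mul, abs_of_pos hm, mul_comm, ← lt_div_iff₀ hm]

theorem logNear_polarExp (ha : 0 < a) (hb : 0 < b) {z₀ z : ℂ}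
    (h : |z.im - z₀.im| < π / (2 * b / a)) : logNear a b z₀ (polarExp a b z) = z := by
  have hm : 0 < 2 * b / a := by positivity
  have h' : |2 * b / a * (z.im - z₀.im)| < π := by
    rwa [abs_mul, abs_of_pos hm, mul_comm, ← lt_div_iff₀ hm]
  rw [logNear, coneRatio_polarExp ha hb, Complex.log_exp (abs_lt.1 h').1 (abs_lt.1 h').2.le,
    mul_div_cancel_left₀ _ hm.ne']
  apply Complex.ext <;> simp

theorem abs_logNear_sub_lt (ha : 0 < a) (hb : 0 < b) {z₀ : ℂ} {q : E 3}
    (h : coneRatio a b z₀ q ∈ Complex.slitPlane) :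
    |(logNear a b z₀ q).im - z₀.im| < π / (2 * b / a) := by
  have hm : 0 < 2 * b / a := by positivity
  have h1 : (logNear a b z₀ q).im - z₀.im = (coneRatio a b z₀ q).arg / (2 * b / a) := by
    simp [logNear, Complex.log_im, -Complex.ofReal_div]
  rw [h1, abs_div, abs_of_pos hm]
  refine div_lt_div_of_pos_right (abs_lt.2 ⟨Complex.neg_pi_lt_arg _, ?_⟩) hm
  exact lt_of_le_of_ne (Complex.arg_le_pi _) (Complex.mem_slitPlane_iff_arg.1 h).1

variable {X : Type*} [NormedAddCommGroup X] [NormedSpace ℝ X]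

theorem contDiffOn_coneRatio {A : Set X} {z₀ : X → ℂ} {q : X → E 3} (hz : ContDiffOn ℝ ∞ z₀ A)
    (hq : ContDiffOn ℝ ∞ q A) : ContDiffOn ℝ ∞ (fun x => coneRatio a b (z₀ x) (q x)) A := by
  have hR : ∀ {f : X → ℝ}, ContDiffOn ℝ ∞ f A → ContDiffOn ℝ ∞ (fun x => (f x : ℂ)) A :=
    fun h => Complex.ofRealCLM.contDiff.comp_contDiffOn h
  have hre : ContDiffOn ℝ ∞ (fun x => (z₀ x).re) A := Complex.reCLM.contDiff.comp_contDiffOn hz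
  have him : ContDiffOn ℝ ∞ (fun x => (z₀ x).im) A := Complex.imCLM.contDiff.comp_contDiffOn hz
  have hq' := contDiffOn_euclidean.1 hq
  exact (contDiffOn_const.mul ((hR (hq' 0)).add ((hR (hq' 1)).mul contDiffOn_const))).mul
    (contDiffOn_cexp ((hR hre).add ((hR (contDiffOn_const.mul him)).mul contDiffOn_const)).neg)

theorem contDiffOn_logNear {A : Set X} {z₀ : X → ℂ} {q : X → E 3} (hz : ContDiffOn ℝ ∞ z₀ A)
    (hq : ContDiffOn ℝ ∞ q A) (h : ∀ x ∈ A, coneRatio a b (z₀ x) (q x) ∈ Complex.slitPlane) :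
    ContDiffOn ℝ ∞ (fun x => logNear a b (z₀ x) (q x)) A := by
  have hR : ∀ {f : X → ℝ}, ContDiffOn ℝ ∞ f A → ContDiffOn ℝ ∞ (fun x => (f x : ℂ)) A :=
    fun h => Complex.ofRealCLM.contDiff.comp_contDiffOn h
  have hl : ContDiffOn ℝ ∞ (fun x => Complex.log (coneRatio a b (z₀ x) (q x))) A := by
    intro x hx
    exact ContDiffAt.comp_contDiffWithinAt x (contDiffAt_clog (h x hx))
      (contDiffOn_coneRatio hz hq x hx)
  exact (hz.add (hR (Complex.reCLM.contDiff.comp_contDiffOn hl))).add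
    ((hR ((Complex.imCLM.contDiff.comp_contDiffOn hl).div_const _)).mul contDiffOn_const)

theorem norm_coneRatio_sub_le (ha : 0 < a) (hb : 0 < b) (z₀ : ℂ) (q q' : E 3) :
    ‖coneRatio a b z₀ q - coneRatio a b z₀ q'‖ ≤ 2 * b / a * Real.exp (-z₀.re) * ‖q - q'‖ := by
  have hm : 0 < 2 * b / a := by positivity
  have e : coneRatio a b z₀ q - coneRatio a b z₀ q' = ((2 * b / a : ℝ) : ℂ)
      * Complex.exp (-(z₀.re + (2 * b / a * z₀.im : ℝ) * Complex.I))
      * ((q - q') 0 + (q - q') 1 * Complex.I) := by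
    simp [coneRatio]
    ring
  have h1 : ‖(((q - q') 0 : ℂ) + (q - q') 1 * Complex.I)‖ ≤ ‖q - q'‖ := by
    rw [← sq_le_sq₀ (norm_nonneg _) (norm_nonneg _), norm_sq_E3, Complex.sq_norm,
      Complex.normSq_add_mul_I]
    nlinarith [sq_nonneg ((q - q') 2)]
  rw [e, norm_mul, norm_mul, Complex.norm_real, Real.norm_of_nonneg hm.le, Complex.norm_exp]
  simp only [Complex.neg_re, Complex.add_re, Complex.ofReal_re, Complex.re_ofReal_mul,
    Complex.I_re, mul_zero, add_zero]
  gcongr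

end LogNear

/-- A compact curve in an open set has a uniform distance to the complement. -/
theorem exists_forall_mem_of_norm_sub_lt {K : ℝ → ℂ} (hK : ContinuousOn K I) {O : Set ℂ}
    (hO : IsOpen O) (h : ∀ θ ∈ I, K θ ∈ O) :
    ∃ δ > 0, ∀ θ ∈ I, ∀ y, ‖y - K θ‖ < δ → y ∈ O := by
  obtain ⟨δ, hδ, hs⟩ := (isCompact_Icc.image_of_continuousOn hK).exists_thickening_subset_open hO
    (image_subset_iff.2 h)
  refine ⟨δ, hδ, fun θ hθ y hy => hs (Metric.mem_thickening_iff.2 ⟨K θ, ⟨θ, hθ, rfl⟩, ?_⟩)⟩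
  rwa [dist_eq_norm]

/-- The identification of `ℂ` with the Euclidean plane. -/
def planeEquiv : ℂ ≃ₗᵢ[ℝ] E 2 := Complex.orthonormalBasisOneI.repr

theorem contDiffOn_planeEquiv {X : Type*} [NormedAddCommGroup X] [NormedSpace ℝ X] {A : Set X}
    {f : X → ℂ} (hf : ContDiffOn ℝ ∞ f A) : ContDiffOn ℝ ∞ (fun x => planeEquiv (f x)) A :=
  planeEquiv.contDiff.comp_contDiffOn hf

theorem contDiffOn_planeEquiv_symm {X : Type*} [NormedAddCommGroup X] [NormedSpace ℝ X]
    {A : Set X} {f : X → E 2} (hf : ContDiffOn ℝ ∞ f A) :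
    ContDiffOn ℝ ∞ (fun x => planeEquiv.symm (f x)) A :=
  planeEquiv.symm.contDiff.comp_contDiffOn hf

theorem isOpen_sector (δ : ℝ) : IsOpen (Complex.slitPlane ∩ {z | |z.arg| < δ}) := by
  have : ContinuousOn (fun z : ℂ => |z.arg|) Complex.slitPlane := fun z hz =>
    (Complex.continuousAt_arg hz).continuousWithinAt.abs
  exact this.isOpen_inter_preimage Complex.isOpen_slitPlane isOpen_Iio

theorem exp_sub_mem_sector {z z₀ : ℂ} {δ : ℝ} (hδ : δ ≤ π) (h : |z.im - z₀.im| < δ) :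
    Complex.exp (z - z₀) ∈ Complex.slitPlane ∩ {z | |z.arg| < δ} ∧
      Complex.log (Complex.exp (z - z₀)) = z - z₀ := by
  have h' := h.trans_le hδ
  have e : Complex.log (Complex.exp (z - z₀)) = z - z₀ :=
    Complex.log_exp (abs_lt.1 h').1 (abs_lt.1 h').2.le
  refine ⟨⟨exp_mem_slitPlane (x := z.re - z₀.re) (y := z.im - z₀.im) h', ?_⟩, e⟩
  rw [Set.mem_ofPred_eq, ← Complex.log_im, e]
  exact h

namespace PolarModel

variable {a b : ℝ} {n : ℕ} {M : Set (ℝ → E n)} {rel : (ℝ → E n) → (ℝ → E n) → Prop}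
  {G : (ℝ → E n) → (ℝ → E n) → (ℝ → E n) → ℝ} {T : (ℝ → E n) → ℝ → E 3}

/-- The flat chart around `c₀` sends `c` to `exp ℓ`, where `ℓ` is the lift of `c` close to a lift
`ℓ₀` of `c₀`. Its domain `U` consists of the curves with a lift in the sector around `ℓ₀` of half
the period on both sides. The period is at most `2π` because `a ≤ 2b`, so `exp` is injective on the
sector. -/
theorem isFlat (h : PolarModel a b M rel G T) (hM : ∀ c ∈ M, c ∈ smoothCurves n)
    (ha : 0 < a) (hb : 0 < b) (hab : a ^ 2 ≤ 4 * b ^ 2) : IsFlat M rel G := by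
  intro c₀ hc₀
  have hm : 0 < 2 * b / a := by positivity
  have hm1 : 1 ≤ 2 * b / a := by
    rw [one_le_div ha]
    nlinarith
  have hδπ : π / (2 * b / a) ≤ π := div_le_self pi_pos.le hm1
  obtain ⟨ℓ₀, hℓ₀, hT₀⟩ := h.exists_lift_single hM ha hb hab hc₀
  set U : Set (ℝ → E n) := {c | c ∈ M ∧ ∀ θ ∈ I, coneRatio a b (ℓ₀ θ) (T c θ) ∈ Complex.slitPlane}
  set L : (ℝ → E n) → ℝ → ℂ := fun c θ => logNear a b (ℓ₀ θ) (T c θ)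
  set D : (ℝ → E n) → ℝ → E 2 := fun c θ => planeEquiv (Complex.exp (L c θ))
  have hL : ∀ c ∈ M, ∀ θ ∈ I, polarExp a b (L c θ) = T c θ := fun c hc θ hθ =>
    polarExp_logNear ha hb hab _ (h.mem_cone hc θ hθ)
  have hLlt : ∀ c ∈ U, ∀ θ ∈ I, |(L c θ).im - (ℓ₀ θ).im| < π / (2 * b / a) := fun c hc θ hθ =>
    abs_logNear_sub_lt ha hb (hc.2 θ hθ)
  have hsat : ∀ c ∈ U, ∀ d ∈ M, (∀ θ ∈ I, T c θ = T d θ) → d ∈ U := fun c hc d hd hcd =>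
    ⟨hd, fun θ hθ => hcd θ hθ ▸ hc.2 θ hθ⟩
  have hℓ₀' : ContDiffOn ℝ ∞ (fun q : ℝ × ℝ => ℓ₀ q.2) (univ ×ˢ I) :=
    hℓ₀.comp (f := fun q : ℝ × ℝ => q.2) (by fun_prop) fun q hq => hq.2
  have hLs : ∀ c ∈ U, ContDiffOn ℝ ∞ (L c) I := fun c hc =>
    contDiffOn_logNear hℓ₀ (h.contDiffOn_transform_single hM hc.1) hc.2
  -- a logarithmic coordinate in the sector around `ℓ₀` belongs to a curve in `U`
  have hin : ∀ d ∈ M, ∀ ℓ : ℝ → ℂ, (∀ θ ∈ I, T d θ = polarExp a b (ℓ θ)) →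
      (∀ θ ∈ I, |(ℓ θ).im - (ℓ₀ θ).im| < π / (2 * b / a)) → d ∈ U ∧ ∀ θ ∈ I, L d θ = ℓ θ := by
    intro d hd ℓ hdℓ hlt
    refine ⟨⟨hd, fun θ hθ => ?_⟩, fun θ hθ => ?_⟩
    · rw [hdℓ θ hθ]
      exact coneRatio_mem_slitPlane ha hb (hlt θ hθ)
    · simp only [L]
      rw [hdℓ θ hθ, logNear_polarExp ha hb (hlt θ hθ)]
  refine ⟨U, D, ?_, ⟨fun c hc => hc.1, fun f hf => ?_⟩, fun c hc d hd hcd =>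
    hsat c hc d hd ((h.rel_iff hc.1 hd).1 hcd), fun c hc d hd => ?_, ⟨?_, ?_⟩, fun γ hγ => ?_,
    fun γ hγU hγ => ?_, fun γ hγ t => ?_⟩
  · refine (hin c₀ hc₀ ℓ₀ (fun θ hθ => (hT₀ θ hθ).symm) fun θ _ => ?_).1
    rw [sub_self, abs_zero]
    positivity
  · -- `U` is open
    obtain ⟨δ, hδ, hδU⟩ := exists_forall_mem_of_norm_sub_lt
      (contDiffOn_coneRatio (a := a) (b := b) hℓ₀
        (h.contDiffOn_transform_single hM hf.1)).continuousOn Complex.isOpen_slitPlane hf.2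
    obtain ⟨C, hC⟩ := isCompact_Icc.exists_bound_of_continuousOn (s := I)
      (f := fun θ => 2 * b / a * Real.exp (-(ℓ₀ θ).re))
      (continuousOn_const.mul (Complex.continuous_re.comp_continuousOn hℓ₀.continuousOn).neg.rexp)
    have hC1 : 0 < |C| + 1 := by positivity
    obtain ⟨N, ε, hε, hN⟩ := h.continuous_transform hf.1 (δ / (|C| + 1)) (by positivity)
    refine ⟨N, ε, hε, fun g hg hgf => ⟨hg, fun θ hθ => hδU θ hθ _ ?_⟩⟩
    have h1 := hN g hg hgf θ hθ
    have h2 : 2 * b / a * Real.exp (-(ℓ₀ θ).re) ≤ |C| :=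
      (le_abs_self _).trans ((hC θ hθ).trans (le_abs_self C))
    rw [lt_div_iff₀ hC1] at h1
    refine (norm_coneRatio_sub_le ha hb _ _ _).trans_lt (lt_of_le_of_lt ?_ h1)
    rw [mul_comm]
    exact mul_le_mul_of_nonneg_left (by linarith) (norm_nonneg _)
  · -- `D` is injective
    rw [h.rel_iff hc.1 hd.1]
    constructor
    · intro hcd θ hθ
      have h1 : Complex.exp (L c θ) = Complex.exp (L d θ) := planeEquiv.injective (hcd hθ)
      have h2 : Complex.exp (L c θ - ℓ₀ θ) = Complex.exp (L d θ - ℓ₀ θ) := by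
        rw [Complex.exp_sub, Complex.exp_sub, h1]
      have h3 := congrArg Complex.log h2
      rw [(exp_sub_mem_sector hδπ (hLlt c hc θ hθ)).2,
        (exp_sub_mem_sector hδπ (hLlt d hd θ hθ)).2] at h3
      rw [← hL c hc.1 θ hθ, ← hL d hd.1 θ hθ, sub_left_injective h3]
    · intro hcd θ hθ
      simp only [D, L, hcd θ hθ]
  · -- the values of `D` are smooth curves
    rintro g ⟨c, hc, hg⟩
    exact (contDiffOn_planeEquiv (contDiffOn_cexp (hLs c hc))).congr hg
  · -- the image of `D` is open
    rintro f ⟨c, hc, hfc⟩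
    have hK : ContinuousOn (fun θ => Complex.exp (L c θ - ℓ₀ θ)) I :=
      (contDiffOn_cexp ((hLs c hc).sub hℓ₀)).continuousOn
    obtain ⟨δ, hδ, hδU⟩ := exists_forall_mem_of_norm_sub_lt hK (isOpen_sector (π / (2 * b / a)))
      fun θ hθ => (exp_sub_mem_sector hδπ (hLlt c hc θ hθ)).1
    obtain ⟨C, hC⟩ := isCompact_Icc.exists_bound_of_continuousOn (s := I)
      (f := fun θ => Complex.exp (-ℓ₀ θ)) (contDiffOn_cexp hℓ₀.neg).continuousOn
    have hC1 : 0 < |C| + 1 := by positivity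
    refine ⟨0, δ / (|C| + 1), by positivity, fun g hg hgf => ?_⟩
    set k : ℝ → ℂ := fun θ => planeEquiv.symm (g θ) * Complex.exp (-ℓ₀ θ)
    have hkO : ∀ θ ∈ I, k θ ∈ Complex.slitPlane ∩ {z | |z.arg| < π / (2 * b / a)} := by
      intro θ hθ
      refine hδU θ hθ _ ?_
      have h1 : ‖g θ - f θ‖ < δ / (|C| + 1) := by simpa using hgf 0 le_rfl θ hθ
      have h2 : k θ - Complex.exp (L c θ - ℓ₀ θ)
          = planeEquiv.symm (g θ - f θ) * Complex.exp (-ℓ₀ θ) := by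
        rw [hfc hθ, map_sub, LinearIsometryEquiv.symm_apply_apply, sub_mul, ← Complex.exp_add,
          ← sub_eq_add_neg]
      rw [h2, norm_mul, LinearIsometryEquiv.norm_map]
      have h3 := (hC θ hθ).trans (le_abs_self C)
      rw [lt_div_iff₀ hC1] at h1
      nlinarith [norm_nonneg (g θ - f θ)]
    have hk : ContDiffOn ℝ ∞ k I :=
      (contDiffOn_planeEquiv_symm hg).mul (contDiffOn_cexp hℓ₀.neg)
    have hlog : ContDiffOn ℝ ∞ (fun θ => ℓ₀ θ + Complex.log (k θ)) I := hℓ₀.add fun θ hθ =>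
      (contDiffAt_clog (hkO θ hθ).1).comp_contDiffWithinAt θ (hk θ hθ)
    obtain ⟨γ, -, hγM, hγT⟩ := h.exists_family (P := ℝ) convex_univ (by simp)
      (hlog.comp (f := fun q : ℝ × ℝ => q.2) (by fun_prop) fun q hq => hq.2)
    obtain ⟨hdU, hdL⟩ := hin (γ 0) (hγM 0 (mem_univ _)) _ (hγT 0 (mem_univ _)) fun θ hθ => by
      simpa [Complex.log_im] using (hkO θ hθ).2
    refine ⟨γ 0, hdU, fun θ hθ => ?_⟩
    simp only [D]
    rw [hdL θ hθ]
    simp only [Function.comp_apply]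
    rw [Complex.exp_add, Complex.exp_log (Complex.slitPlane_ne_zero (hkO θ hθ).1), mul_comm,
      mul_assoc, ← Complex.exp_add, neg_add_cancel, Complex.exp_zero, mul_one,
      LinearIsometryEquiv.apply_symm_apply]
  · -- `D` is smooth
    have hs : ContDiffOn ℝ ∞ (fun q : ℝ × ℝ => D (γ q.1) q.2) (univ ×ˢ I) :=
      contDiffOn_planeEquiv (contDiffOn_cexp (contDiffOn_logNear hℓ₀'
        (h.contDiffOn_transform convex_univ (by simp) hγ.1 fun t ht => (hγ.2 t ht).1)
        fun q hq => (hγ.2 q.1 hq.1).2 q.2 hq.2))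
    exact ⟨hs, fun t ht => hs.comp (f := fun θ : ℝ => (t, θ)) (by fun_prop) fun θ hθ => ⟨ht, hθ⟩⟩
  · -- the inverse of `D` is smooth
    have hk : ContDiffOn ℝ ∞ (fun q : ℝ × ℝ =>
        planeEquiv.symm (D (γ q.1) q.2) * Complex.exp (-ℓ₀ q.2)) (univ ×ˢ I) :=
      (contDiffOn_planeEquiv_symm hγ.1).mul (contDiffOn_cexp hℓ₀'.neg)
    have hke : ∀ t, ∀ θ ∈ I, planeEquiv.symm (D (γ t) θ) * Complex.exp (-ℓ₀ θ)
        = Complex.exp (L (γ t) θ - ℓ₀ θ) := fun t θ _ => by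
      simp only [D, LinearIsometryEquiv.symm_apply_apply]
      rw [← Complex.exp_add, ← sub_eq_add_neg]
    have hLγ : ContDiffOn ℝ ∞ (fun q : ℝ × ℝ => L (γ q.1) q.2) (univ ×ˢ I) := by
      have : ContDiffOn ℝ ∞ (fun q : ℝ × ℝ => ℓ₀ q.2 + Complex.log
          (planeEquiv.symm (D (γ q.1) q.2) * Complex.exp (-ℓ₀ q.2))) (univ ×ˢ I) := by
        refine hℓ₀'.add fun q hq => (contDiffAt_clog ?_).comp_contDiffWithinAt q (hk q hq)
        rw [hke q.1 q.2 hq.2]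
        exact (exp_sub_mem_sector hδπ (hLlt _ (hγU q.1) q.2 hq.2)).1.1
      refine this.congr fun q hq => ?_
      rw [hke q.1 q.2 hq.2, (exp_sub_mem_sector hδπ (hLlt _ (hγU q.1) q.2 hq.2)).2,
        add_sub_cancel]
    obtain ⟨γ', hγ', hγM, hγT⟩ := h.exists_family (P := ℝ) convex_univ (by simp) hLγ
    have hTT : ∀ t, ∀ θ ∈ I, T (γ' t) θ = T (γ t) θ := fun t θ hθ => by
      rw [hγT t (mem_univ t) θ hθ, hL _ (hγU t).1 θ hθ]
    exact ⟨γ', ⟨hγ', fun t ht => hsat _ (hγU t) _ (hγM t ht) fun θ hθ => (hTT t θ hθ).symm⟩,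
      fun t => (h.rel_iff (hγM t (mem_univ t)) (hγU t).1).2 (hTT t)⟩
  · -- `D` is isometric
    have hLγ : ContDiffOn ℝ ∞ (fun q : ℝ × ℝ => L (γ q.1) q.2) (univ ×ˢ I) :=
      contDiffOn_logNear hℓ₀'
        (h.contDiffOn_transform convex_univ (by simp) hγ.1 fun t ht => (hγ.2 t ht).1)
        fun q hq => (hγ.2 q.1 hq.1).2 q.2 hq.2
    rw [h.metric_eq convex_univ (by simp) ⟨hγ.1, fun t ht => (hγ.2 t ht).1⟩
      (ℓ := fun t θ => L (γ t) θ) hLγ (fun t ht θ hθ => (hL _ (hγ.2 t ht).1 θ hθ).symm) t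
      (mem_univ t), l2Metric, speedSq]
    refine integral_I_congr fun θ hθ => ?_
    have hd : DifferentiableWithinAt ℝ (fun τ => Complex.exp (L (γ τ) θ)) univ t :=
      (contDiffOn_slice (Z := fun t θ => Complex.exp (L (γ t) θ)) (contDiffOn_cexp hLγ)
        hθ).differentiableOn (by simp) t (mem_univ t)
    have hd' : HasDerivWithinAt (fun τ => D (γ τ) θ)
        (planeEquiv (derivWithin (fun τ => Complex.exp (L (γ τ) θ)) univ t)) univ t :=
      (planeEquiv.toContinuousLinearEquiv.hasFDerivAt).comp_hasDerivWithinAt t hd.hasDerivWithinAt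
    rw [timeDeriv, hd'.derivWithin uniqueDiffWithinAt_univ, real_inner_self_eq_norm_sq,
      LinearIsometryEquiv.norm_map]

end PolarModel

/-! ### The two spaces of curves -/

section Spaces

variable {a b : ℝ}

/-- The value of the transform at a parameter where the velocity is `w`. -/
def transformVec (a b : ℝ) (w : E 2) : E 3 :=
  √‖w‖ • !₂[a * (‖w‖⁻¹ • w) 0, a * (‖w‖⁻¹ • w) 1, √(4 * b ^ 2 - a ^ 2)]

theorem contDiffOn_transformVec : ContDiffOn ℝ ∞ (transformVec a b) {0}ᶜ := by
  have hn : ContDiffOn ℝ ∞ (fun w : E 2 => ‖w‖) {0}ᶜ := fun w hw =>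
    (contDiffAt_norm ℝ hw).contDiffWithinAt
  have hn0 : ∀ w ∈ ({0}ᶜ : Set (E 2)), ‖w‖ ≠ 0 := fun w hw => norm_ne_zero_iff.2 hw
  have hi : ContDiffOn ℝ ∞ (fun w : E 2 => ‖w‖⁻¹ • w) {0}ᶜ := (hn.inv hn0).smul contDiffOn_id
  have hi' := contDiffOn_euclidean.1 hi
  refine (hn.sqrt hn0).smul (contDiffOn_euclidean.2 fun i => ?_)
  fin_cases i
  · exact contDiffOn_const.mul (hi' 0)
  · exact contDiffOn_const.mul (hi' 1)
  · exact contDiffOn_const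

/-- A primitive of a continuous function, as a curve with prescribed velocity. -/
theorem velocity_primitive {n : ℕ} {f : ℝ → E n} (hf : ContinuousOn f I) {θ : ℝ} (hθ : θ ∈ I) :
    velocity (fun θ => ∫ u in (0 : ℝ)..θ, f u) θ = f θ := by
  have : Fact (θ ∈ Icc 0 (2 * π)) := ⟨hθ⟩
  have hint : IntervalIntegrable f volume 0 θ :=
    (hf.mono (by rw [uIcc_of_le hθ.1]; exact Icc_subset_Icc le_rfl hθ.2)).intervalIntegrable
  exact (intervalIntegral.integral_hasDerivWithinAt_right (s := Icc 0 (2 * π))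
    (t := Icc 0 (2 * π)) hint
    (hf.stronglyMeasurableAtFilter_nhdsWithin measurableSet_Icc θ) (hf θ hθ)).derivWithin
      (uniqueDiffOn_I θ hθ)

/-- Integrating the velocity `velocityExp ℓ` realizes every family of lifts by immersions that
start at the origin. -/
theorem exists_family_immersions (ha : 0 < a) (hb : 0 < b) {P : Type} [NormedAddCommGroup P]
    [NormedSpace ℝ P] {S : Set P} (hS : Convex ℝ S) (hS' : (interior S).Nonempty) {ℓ : P × ℝ → ℂ}
    (hℓ : ContDiffOn ℝ ∞ ℓ (S ×ˢ I)) :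
    ∃ γ : P → ℝ → E 2, ContDiffOn ℝ ∞ (fun q : P × ℝ => γ q.1 q.2) (S ×ˢ I) ∧
      (∀ p ∈ S, γ p ∈ immersions) ∧
      ∀ p ∈ S, ∀ θ ∈ I, RTransform a b (γ p) θ = polarExp a b (ℓ (p, θ)) := by
  have hV : ContDiffOn ℝ ∞ (fun q => velocityExp a b (ℓ q)) (S ×ˢ I) :=
    contDiff_velocityExp.comp_contDiffOn hℓ
  have hγ := contDiffOn_primitive (F := fun q => velocityExp a b (ℓ q)) two_pi_pos hS hS' hV
  have hvel : ∀ p ∈ S, ∀ θ ∈ I,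
      velocity (fun θ => ∫ u in (0 : ℝ)..θ, velocityExp a b (ℓ (p, u))) θ
        = velocityExp a b (ℓ (p, θ)) := fun p hp θ hθ =>
    velocity_primitive (hV.continuousOn.comp (f := fun θ : ℝ => (p, θ)) (by fun_prop)
      fun u hu => ⟨hp, hu⟩) hθ
  refine ⟨fun p θ => ∫ u in (0 : ℝ)..θ, velocityExp a b (ℓ (p, u)), hγ, fun p hp => ⟨?_, ?_⟩,
    fun p hp θ hθ => RTransform_eq_polarExp ha hb (hvel p hp θ hθ)⟩
  · exact hγ.comp (f := fun θ : ℝ => (p, θ)) (by fun_prop) fun θ hθ => ⟨hp, hθ⟩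
  · intro θ hθ
    rw [hvel p hp θ hθ]
    exact velocityExp_ne_zero hb _

theorem contDiffOn_RTransform {P : Type*} [NormedAddCommGroup P] [NormedSpace ℝ P] {S : Set P}
    (hS : Convex ℝ S) (hS' : (interior S).Nonempty) {γ : P → ℝ → E 2}
    (hγ : ContDiffOn ℝ ∞ (fun q : P × ℝ => γ q.1 q.2) (S ×ˢ I)) (hM : ∀ p ∈ S, γ p ∈ immersions) :
    ContDiffOn ℝ ∞ (fun q : P × ℝ => RTransform a b (γ q.1) q.2) (S ×ˢ I) :=
  contDiffOn_transformVec.comp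
    (contDiffOn_derivWithin_snd (f := fun q : P × ℝ => γ q.1 q.2) hγ (uniqueDiffOn_convex hS hS')
      uniqueDiffOn_I) fun q hq => (hM q.1 hq.1).2 q.2 hq.2

theorem contDiffOn_RTransform_single {c : ℝ → E 2} (hc : c ∈ immersions) :
    ContDiffOn ℝ ∞ (RTransform a b c) I :=
  contDiffOn_transformVec.comp (hc.1.derivWithin uniqueDiffOn_I le_rfl) hc.2

theorem sameModTra_iff_velocity {c d : ℝ → E 2} (hc : c ∈ immersions) (hd : d ∈ immersions) :
    SameModTra c d ↔ ∀ θ ∈ I, velocity c θ = velocity d θ := by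
  have hdc : DifferentiableOn ℝ c I := hc.1.differentiableOn (by simp)
  have hdd : DifferentiableOn ℝ d I := hd.1.differentiableOn (by simp)
  constructor
  · rintro ⟨p, hp⟩ θ hθ
    rw [velocity, velocity, derivWithin_congr (f₁ := d) (fun u hu => hp u hu) (hp θ hθ),
      derivWithin_add_const]
  · intro h
    have h0 : (0 : ℝ) ∈ I := ⟨le_rfl, two_pi_pos.le⟩
    refine ⟨d 0 - c 0, fun θ hθ => ?_⟩
    have := convex_I.is_const_of_fderivWithin_eq_zero (𝕜 := ℝ) (f := fun θ => d θ - c θ)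
      (hdd.sub hdc) (fun u hu => ?_) hθ h0
    · rw [← sub_eq_iff_eq_add', this]
    · ext1
      rw [fderivWithin_derivWithin, derivWithin_fun_sub (hdd u hu) (hdc u hu)]
      simpa [velocity, sub_eq_zero] using (h u hu).symm

theorem RTransform_eq_iff_velocity (ha : 0 < a) (hb : 0 < b) {c d : ℝ → E 2} {θ : ℝ}
    (hc : velocity c θ ≠ 0) (hd : velocity d θ ≠ 0) :
    RTransform a b c θ = RTransform a b d θ ↔ velocity c θ = velocity d θ := by
  obtain ⟨z, hz⟩ := exists_velocityExp_eq ha hb hd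
  rw [RTransform_eq_polarExp ha hb hz.symm, ← hz]
  exact ⟨velocity_eq_velocityExp ha hb hc, RTransform_eq_polarExp ha hb⟩

/-- For `ℓ = x + i y`, the arc-length derivative of the variation field has tangential component
`2 x'` and normal component `m y'`, `m = 2b/a`, where the prime is the time derivative. Since
`|c'| = e^{2x} / (4b²)`, the elastic energy density is `e^{2x} (x'² + y'²)`, the squared speed of
`exp ℓ`. -/
theorem elasticMetric_timeDeriv (ha : 0 < a) (hb : 0 < b) {J : Set ℝ} (hJ : Convex ℝ J)
    (hJ' : (interior J).Nonempty) {γ : ℝ → ℝ → E 2} (hγ : IsSmoothPath immersions J γ)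
    {ℓ : ℝ → ℝ → ℂ} (hℓ : ContDiffOn ℝ ∞ (fun q : ℝ × ℝ => ℓ q.1 q.2) (J ×ˢ I))
    (hT : ∀ t ∈ J, ∀ θ ∈ I, RTransform a b (γ t) θ = polarExp a b (ℓ t θ)) {t : ℝ} (ht : t ∈ J) :
    elasticMetric a b (γ t) (timeDeriv J γ t) (timeDeriv J γ t)
      = speedSq J (fun t θ => Complex.exp (ℓ t θ)) t := by
  have uJ := uniqueDiffOn_convex hJ hJ'
  refine integral_I_congr fun θ hθ => ?_
  have hv : ∀ τ ∈ J, velocity (γ τ) θ = velocityExp a b (ℓ τ θ) := fun τ hτ =>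
    velocity_eq_velocityExp ha hb ((hγ.2 τ hτ).2 θ hθ) (hT τ hτ θ hθ)
  have hd := ((contDiffOn_slice hℓ hθ).differentiableOn (by simp) t ht).hasDerivWithinAt
  set ℓ' := derivWithin (fun τ => ℓ τ θ) J t
  have hw : velocity (timeDeriv J γ t) θ
      = (2 * ℓ'.re) • velocityExp a b (ℓ t θ) + (2 * b / a * ℓ'.im) •
        !₂[-(velocityExp a b (ℓ t θ) 1), velocityExp a b (ℓ t θ) 0] := by
    rw [← (hasDerivWithinAt_velocityExp hd).derivWithin (uJ t ht)]
    refine (derivWithin_derivWithin_comm hγ.1 hJ hJ' convex_I interior_I_nonempty ht hθ).trans ?_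
    exact derivWithin_congr hv (hv t ht)
  have hN : ‖velocityExp a b (ℓ t θ)‖ = Real.exp (2 * (ℓ t θ).re) / (4 * b ^ 2) :=
    norm_velocityExp _
  have hu := velocityExp_smul (a := a) hb (ℓ t θ)
  have hNp : 0 < ‖velocityExp a b (ℓ t θ)‖ := norm_pos_iff.2 (velocityExp_ne_zero hb _)
  have hcs := Real.cos_sq_add_sin_sq (2 * b / a * (ℓ t θ).im)
  -- the tangential and normal components of the arc-length derivative
  have hu0 : ‖velocityExp a b (ℓ t θ)‖⁻¹ * velocityExp a b (ℓ t θ) 0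
      = cos (2 * b / a * (ℓ t θ).im) := by simpa using congrArg (· 0) hu
  have hu1 : ‖velocityExp a b (ℓ t θ)‖⁻¹ * velocityExp a b (ℓ t θ) 1
      = sin (2 * b / a * (ℓ t θ).im) := by simpa using congrArg (· 1) hu
  have hA : arcDeriv (γ t) (timeDeriv J γ t) θ
      = !₂[2 * ℓ'.re * cos (2 * b / a * (ℓ t θ).im)
            - 2 * b / a * ℓ'.im * sin (2 * b / a * (ℓ t θ).im),
          2 * ℓ'.re * sin (2 * b / a * (ℓ t θ).im)
            + 2 * b / a * ℓ'.im * cos (2 * b / a * (ℓ t θ).im)] := by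
    rw [arcDeriv, hw, hv t ht, ← hu0, ← hu1]
    ext i
    fin_cases i
    · simp
      ring
    · simp
      ring
  have hU : unitTangent (γ t) θ
      = !₂[cos (2 * b / a * (ℓ t θ).im), sin (2 * b / a * (ℓ t θ).im)] := by
    rw [unitTangent, hv t ht, hu]
  have hin : ∀ x y : E 2, inner ℝ x y = x 0 * y 0 + x 1 * y 1 := fun x y => by
    simp [PiLp.inner_apply, Fin.sum_univ_two, mul_comm]
  have h1 : inner ℝ (arcDeriv (γ t) (timeDeriv J γ t) θ) (unitTangent (γ t) θ) = 2 * ℓ'.re := by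
    rw [hA, hU, hin]
    simp
    linear_combination (2 * ℓ'.re) * hcs
  have h2 : inner ℝ (arcDeriv (γ t) (timeDeriv J γ t) θ) (unitNormal (γ t) θ)
      = 2 * b / a * ℓ'.im := by
    rw [hA, unitNormal, hU, hin]
    simp
    linear_combination (2 * b / a * ℓ'.im) * hcs
  rw [(hasDerivWithinAt_cexp_comp hd).derivWithin (uJ t ht), h1, h2, hv t ht, hN, norm_mul, mul_pow,
    Complex.norm_exp, Complex.sq_norm, Complex.normSq_apply, two_mul (ℓ t θ).re, Real.exp_add]
  field_simp
  ring

/-- The transform depends continuously on the velocity, uniformly near the compact image of `c'`, so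
first derivatives suffice. -/
theorem continuous_RTransform {c : ℝ → E 2} (hc : c ∈ immersions) {δ : ℝ} (hδ : 0 < δ) :
    ∃ N : ℕ, ∃ ε > 0, ∀ g ∈ immersions,
      (∀ j ≤ N, ∀ θ ∈ I, ‖iteratedDerivWithin j (g - c) I θ‖ < ε) →
      ∀ θ ∈ I, ‖RTransform a b g θ - RTransform a b c θ‖ < δ := by
  have hvc : ContinuousOn (velocity c) I :=
    (hc.1.derivWithin uniqueDiffOn_I (m := ∞) le_rfl).continuousOn
  have hK : IsCompact (velocity c '' I) := isCompact_Icc.image_of_continuousOn hvc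
  have huc := hK.uniformContinuousAt_of_continuousAt (transformVec a b) (fun w hw => by
    obtain ⟨θ, hθ, rfl⟩ := hw
    exact contDiffOn_transformVec.continuousOn.continuousAt
      (isOpen_compl_singleton.mem_nhds (hc.2 θ hθ))) (Metric.dist_mem_uniformity hδ)
  obtain ⟨ε, hε, hεU⟩ := Metric.mem_uniformity_dist.1 huc
  refine ⟨1, ε, hε, fun g hg hgc θ hθ => ?_⟩
  have h1 := hgc 1 le_rfl θ hθ
  rw [iteratedDerivWithin_one, derivWithin_sub (hg.1.differentiableOn (by simp) θ hθ)
    (hc.1.differentiableOn (by simp) θ hθ), ← dist_eq_norm, dist_comm] at h1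
  rw [← dist_eq_norm, dist_comm]
  exact hεU h1 ⟨θ, hθ, rfl⟩

theorem polarModel_immersions (ha : 0 < a) (hb : 0 < b) (hab : a ^ 2 ≤ 4 * b ^ 2) :
    PolarModel a b immersions SameModTra (elasticMetric a b) (RTransform a b) where
  contDiffOn_transform hS hS' _ hγ hM := contDiffOn_RTransform hS hS' hγ hM
  mem_cone hc θ hθ := RTransform_mem_cone ha hb hab (hc.2 θ hθ)
  rel_iff hc hd := (sameModTra_iff_velocity hc hd).trans (forall₂_congr fun θ hθ =>
    (RTransform_eq_iff_velocity ha hb (hc.2 θ hθ) (hd.2 θ hθ)).symm)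
  exists_family hS hS' _ hℓ := exists_family_immersions ha hb hS hS' hℓ
  metric_eq hJ hJ' _ hγ _ hℓ hT _ ht := elasticMetric_timeDeriv ha hb hJ hJ' hγ hℓ hT ht
  continuous_transform hc _ hδ := continuous_RTransform hc hδ

theorem imR_subset_smoothCurves {q : ℝ → E 3} (hq : q ∈ imR a b) : q ∈ smoothCurves 3 := by
  obtain ⟨c, hc, h⟩ := hq
  exact (contDiffOn_RTransform_single hc).congr h

theorem l2Metric_timeDeriv (ha : 0 < a) (hb : 0 < b) (hab : a ^ 2 ≤ 4 * b ^ 2) {J : Set ℝ}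
    (uJ : UniqueDiffOn ℝ J) {γ : ℝ → ℝ → E 3} {ℓ : ℝ → ℝ → ℂ}
    (hℓ : ContDiffOn ℝ ∞ (fun q : ℝ × ℝ => ℓ q.1 q.2) (J ×ˢ I))
    (hT : ∀ t ∈ J, ∀ θ ∈ I, γ t θ = polarExp a b (ℓ t θ)) {t : ℝ} (ht : t ∈ J) :
    l2Metric (γ t) (timeDeriv J γ t) (timeDeriv J γ t)
      = speedSq J (fun t θ => Complex.exp (ℓ t θ)) t := by
  refine integral_I_congr fun θ hθ => ?_
  rw [real_inner_self_eq_norm_sq, timeDeriv,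
    derivWithin_congr (fun τ hτ => hT τ hτ θ hθ) (hT t ht θ hθ),
    norm_derivWithin_polarExp ha hb hab (uJ t ht)
      ((contDiffOn_slice hℓ hθ).differentiableOn (by simp) t ht)]

theorem polarModel_imR (ha : 0 < a) (hb : 0 < b) (hab : a ^ 2 ≤ 4 * b ^ 2) :
    PolarModel a b (imR a b) SameCurve l2Metric (fun q => q) where
  contDiffOn_transform _ _ _ hγ _ := hγ
  mem_cone hq θ hθ := by
    obtain ⟨c, hc, h⟩ := hq
    rw [h hθ]
    exact RTransform_mem_cone ha hb hab (hc.2 θ hθ)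
  rel_iff _ _ := Iff.rfl
  exists_family hS hS' ℓ hℓ := by
    obtain ⟨γ, -, hγM, hγT⟩ := exists_family_immersions ha hb hS hS' hℓ
    exact ⟨fun p θ => polarExp a b (ℓ (p, θ)), contDiff_polarExp.comp_contDiffOn hℓ,
      fun p hp => ⟨γ p, hγM p hp, fun θ hθ => (hγT p hp θ hθ).symm⟩, fun _ _ _ _ => rfl⟩
  metric_eq hJ hJ' _ _ _ hℓ hT _ ht :=
    l2Metric_timeDeriv ha hb hab (uniqueDiffOn_convex hJ hJ') hℓ hT ht
  continuous_transform _ δ hδ := ⟨0, δ, hδ, fun g _ hg θ hθ => by simpa using hg 0 le_rfl θ hθ⟩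

end Spaces

/-! ### Geodesics and distances of the two spaces -/

section Conclusions

variable {a b : ℝ} {J : Set ℝ}

theorem isSmoothPath_RTransform (hJ : Convex ℝ J) (hJ' : (interior J).Nonempty)
    {γ : ℝ → ℝ → E 2} (hγ : IsSmoothPath immersions J γ) :
    IsSmoothPath (imR a b) J (fun t => RTransform a b (γ t)) :=
  ⟨contDiffOn_RTransform hJ hJ' hγ.1 hγ.2, fun t ht => ⟨γ t, hγ.2 t ht, fun _ _ => rfl⟩⟩

/-- A path of immersions and its image under the transform have the same logarithmic lift. -/
theorem isGeodesic_immersions_iff (ha : 0 < a) (hb : 0 < b) (hab : a ^ 2 ≤ 4 * b ^ 2)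
    (hJ : Convex ℝ J) (hJ' : (interior J).Nonempty) {γ : ℝ → ℝ → E 2}
    (hγ : IsSmoothPath immersions J γ) :
    IsGeodesic immersions SameModTra (elasticMetric a b) J γ ↔
      IsGeodesic (imR a b) SameCurve l2Metric J (fun t => RTransform a b (γ t)) := by
  have h := polarModel_immersions ha hb hab
  obtain ⟨ℓ, hℓ, hT, -⟩ := h.exists_lift ha hb hab hJ hJ' hγ.1 hγ.2
    (B := ∅) isPreconnected_empty (empty_subset _) (ℓ₀ := 0) (continuousOn_empty _) (by simp)
  rw [h.isGeodesic_iff ha hb hab hJ hγ (ℓ := fun t θ => ℓ (t, θ)) hℓ hT,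
    (polarModel_imR ha hb hab).isGeodesic_iff ha hb hab hJ (isSmoothPath_RTransform hJ hJ' hγ)
      (ℓ := fun t θ => ℓ (t, θ)) hℓ hT]

theorem exists_isGeodesic_immersions (ha : 0 < a) (hb : 0 < b) (hab : a ^ 2 ≤ 4 * b ^ 2)
    (hJ : Convex ℝ J) (hJ' : (interior J).Nonempty) {q : ℝ → ℝ → E 3}
    (hq : IsGeodesic (imR a b) SameCurve l2Metric J q) :
    ∃ γ : ℝ → ℝ → E 2, IsGeodesic immersions SameModTra (elasticMetric a b) J γ ∧
      ∀ t ∈ J, SameCurve (RTransform a b (γ t)) (q t) := by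
  have h := polarModel_immersions ha hb hab
  have h' := polarModel_imR ha hb hab
  obtain ⟨ℓ, hℓ, hT, -⟩ := h'.exists_lift ha hb hab hJ hJ' hq.1.1 hq.1.2
    (B := ∅) isPreconnected_empty (empty_subset _) (ℓ₀ := 0) (continuousOn_empty _) (by simp)
  obtain ⟨γ, hγ, hγM, hγT⟩ := h.exists_family hJ hJ' hℓ
  refine ⟨γ, ?_, fun t ht θ hθ => (hγT t ht θ hθ).trans (hT t ht θ hθ).symm⟩
  rw [h.isGeodesic_iff ha hb hab hJ ⟨hγ, hγM⟩ (ℓ := fun t θ => ℓ (t, θ)) hℓ hγT]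
  exact (h'.isGeodesic_iff ha hb hab hJ hq.1 (ℓ := fun t θ => ℓ (t, θ)) hℓ hT).1 hq

theorem isGeodesic_imR_iff (ha : 0 < a) (hb : 0 < b) (hab : a ^ 2 ≤ 4 * b ^ 2)
    (hJ : Convex ℝ J) (hJ' : (interior J).Nonempty) {q : ℝ → ℝ → E 3}
    (hq : IsSmoothPath (imR a b) J q) :
    IsGeodesic (imR a b) SameCurve l2Metric J q ↔
      ∀ θ ∈ I, IsConeGeodesic a b J (fun t => q t θ) := by
  have h := polarModel_imR ha hb hab
  obtain ⟨ℓ, hℓ, hT, -⟩ := h.exists_lift ha hb hab hJ hJ' hq.1 hq.2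
    (B := ∅) isPreconnected_empty (empty_subset _) (ℓ₀ := 0) (continuousOn_empty _) (by simp)
  have h0 : (0 : ℝ) ∈ I := ⟨le_rfl, two_pi_pos.le⟩
  have hpt : ∀ θ ∈ I, IsConeGeodesic a b J (fun t => q t θ) ↔ ∀ t₀ ∈ J, ∀ t₁ ∈ J, t₀ < t₁ →
      AffineOnIcc t₀ t₁ (fun t _ => Complex.exp (ℓ (t, θ))) := fun θ hθ =>
    isConeGeodesic_iff ha hb hab hJ (ℓ := fun t => ℓ (t, θ))
      (contDiffOn_slice (Z := fun t θ => ℓ (t, θ)) hℓ hθ) fun t ht => hT t ht θ hθ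
  rw [h.isGeodesic_iff ha hb hab hJ hq (ℓ := fun t θ => ℓ (t, θ)) hℓ hT, forall₂_congr hpt]
  -- `AffineOnIcc` for a path that is constant in `θ` is tested at the parameter `0`
  exact ⟨fun H θ hθ t₀ ht₀ t₁ ht₁ h01 _ _ t ht => H t₀ ht₀ t₁ ht₁ h01 θ hθ t ht,
    fun H t₀ ht₀ t₁ ht₁ h01 θ hθ t ht => H θ hθ t₀ ht₀ t₁ ht₁ h01 0 h0 t ht⟩

/-- The logarithmic coordinate of a polar lift. -/
theorem IsPolarLift.polarExp_eq {q : ℝ → E 3} {r φ : ℝ → ℝ} (h : IsPolarLift a b q r φ) :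
    ContinuousOn (fun θ => (⟨Real.log (r θ), φ θ⟩ : ℂ)) I ∧
      ∀ θ ∈ I, polarExp a b ⟨Real.log (r θ), φ θ⟩ = q θ := by
  refine ⟨?_, fun θ hθ => ?_⟩
  · have := (Complex.continuous_ofReal.comp_continuousOn
      (h.1.log fun θ hθ => (h.2.2 θ hθ).1.ne')).add
      ((Complex.continuous_ofReal.comp_continuousOn h.2.1).mul
        (continuousOn_const (c := Complex.I)))
    refine this.congr fun θ _ => ?_
    apply Complex.ext <;> simp
  · rw [polarExp, Real.exp_log (h.2.2 θ hθ).1, (h.2.2 θ hθ).2]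

theorem exists_isPolarLift (ha : 0 < a) (hb : 0 < b) (hab : a ^ 2 ≤ 4 * b ^ 2) {c : ℝ → E 2}
    (hc : c ∈ immersions) : ∃ r φ : ℝ → ℝ, IsPolarLift a b (RTransform a b c) r φ := by
  obtain ⟨ℓ, hℓ, hT⟩ := (polarModel_immersions ha hb hab).exists_lift_single (fun _ h => h.1)
    ha hb hab hc
  exact ⟨fun θ => Real.exp (ℓ θ).re, fun θ => (ℓ θ).im,
    (Complex.continuous_re.comp_continuousOn hℓ.continuousOn).rexp,
    Complex.continuous_im.comp_continuousOn hℓ.continuousOn,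
    fun θ hθ => ⟨Real.exp_pos _, hT θ hθ⟩⟩

theorem isLeast_geodesicDist_immersions (ha : 0 < a) (hb : 0 < b) (hab : a ^ 2 ≤ 4 * b ^ 2)
    {c d : ℝ → E 2} (hc : c ∈ immersions) (hd : d ∈ immersions) {r φ r' φ' : ℝ → ℝ}
    (hl : IsPolarLift a b (RTransform a b c) r φ) (hl' : IsPolarLift a b (RTransform a b d) r' φ') :
    (joiningLengths immersions SameModTra (elasticMetric a b) c d).Nonempty ∧
      IsLeast (Set.range fun k : ℤ => √(∫ θ in (0 : ℝ)..(2 * π),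
          liftDist a b (r θ) (φ θ) (r' θ) (φ' θ + k * (π * a / b)) ^ 2))
        (geodesicDist immersions SameModTra (elasticMetric a b) c d) := by
  have key := (polarModel_immersions ha hb hab).isLeast_geodesicDist (fun _ h => h.1) ha hb hab
    hc hd hl.polarExp_eq.1 hl'.polarExp_eq.1 hl.polarExp_eq.2 hl'.polarExp_eq.2
  have e : ∀ k : ℤ, ∫ θ in (0 : ℝ)..(2 * π),
      liftDist a b (r θ) (φ θ) (r' θ) (φ' θ + k * (π * a / b)) ^ 2
      = ∫ θ in (0 : ℝ)..(2 * π), coverSq ⟨Real.log (r θ), φ θ⟩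
        (⟨Real.log (r' θ), φ' θ⟩ + (k * (π * a / b) : ℝ) * Complex.I) := fun k =>
    integral_I_congr fun θ hθ => by
      rw [liftDist_eq ha hb hab (hl.2.2 θ hθ).1 (hl'.2.2 θ hθ).1, Real.sq_sqrt (coverSq_nonneg _ _)]
      congr 1
      apply Complex.ext <;> simp [-Complex.ofReal_mul, -Complex.ofReal_div]
  simp_rw [e]
  exact key

end Conclusions

end ElasticCurves

end

open ElasticCurves
theorem mainTheorem1 (a b : ℝ) (ha : 0 < a) (hb : 0 < b) (hab : a ^ 2 ≤ 4 * b ^ 2) :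
    -- the elastic metric is flat, and so is the `L²`-metric on the image of the transform
    (IsFlat immersions SameModTra (elasticMetric a b) ∧ IsFlat (imR a b) SameCurve l2Metric) ∧
    -- geodesics are the preimages of the geodesics on the image
    (∀ J : Set ℝ, J.OrdConnected → (interior J).Nonempty →
      (∀ γ : ℝ → ℝ → E 2, IsSmoothPath immersions J γ →
        (IsGeodesic immersions SameModTra (elasticMetric a b) J γ ↔
          IsGeodesic (imR a b) SameCurve l2Metric J (fun t => RTransform a b (γ t)))) ∧
      (∀ q : ℝ → ℝ → E 3, IsGeodesic (imR a b) SameCurve l2Metric J q →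
        ∃ γ : ℝ → ℝ → E 2, IsGeodesic immersions SameModTra (elasticMetric a b) J γ ∧
          ∀ t ∈ J, SameCurve (RTransform a b (γ t)) (q t))) ∧
    -- a path in the image is a geodesic iff it is pointwise a geodesic of the cone
    (∀ J : Set ℝ, J.OrdConnected → (interior J).Nonempty →
      ∀ q : ℝ → ℝ → E 3, IsSmoothPath (imR a b) J q →
        (IsGeodesic (imR a b) SameCurve l2Metric J q ↔
          ∀ θ ∈ I, IsConeGeodesic a b J (fun t => q t θ))) ∧
    -- the distance on the cone is a minimum over the winding index `k`, with the law of cosines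
    (∀ r φ r' φ' : ℝ, 0 < r → 0 < r' →
      liftDist a b r φ r' φ' ^ 2
          = r ^ 2 + r' ^ 2 - 2 * r * r' * Real.cos (min |φ - φ'| Real.pi) ∧
      IsLeast (Set.range fun k : ℤ => liftDist a b r φ r' (φ' + k * (Real.pi * a / b)))
        (coneDist a b (polar a b r φ) (polar a b r' φ'))) ∧
    -- the geodesic distance: continuous lifts, and the minimum over `k` is taken only once
    (∀ c ∈ immersions, ∃ r φ : ℝ → ℝ, IsPolarLift a b (RTransform a b c) r φ) ∧
    (∀ c ∈ immersions, ∀ d ∈ immersions, ∀ r φ r' φ' : ℝ → ℝ,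
      IsPolarLift a b (RTransform a b c) r φ → IsPolarLift a b (RTransform a b d) r' φ' →
      (joiningLengths immersions SameModTra (elasticMetric a b) c d).Nonempty ∧
      IsLeast
        (Set.range fun k : ℤ => √(∫ θ in (0 : ℝ)..(2 * Real.pi),
          liftDist a b (r θ) (φ θ) (r' θ) (φ' θ + k * (Real.pi * a / b)) ^ 2))
        (geodesicDist immersions SameModTra (elasticMetric a b) c d)) := by
  have him := polarModel_immersions ha hb hab
  refine ⟨⟨him.isFlat (fun _ h => h.1) ha hb hab,
      (polarModel_imR ha hb hab).isFlat (fun _ h => imR_subset_smoothCurves h) ha hb hab⟩,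
    fun J hJ hJ' => ⟨fun γ hγ => isGeodesic_immersions_iff ha hb hab hJ.convex hJ' hγ,
      fun q hq => exists_isGeodesic_immersions ha hb hab hJ.convex hJ' hq⟩,
    fun J hJ hJ' q hq => isGeodesic_imR_iff ha hb hab hJ.convex hJ' hq,
    fun r φ r' φ' hr hr' => ⟨liftDist_sq ha hb hab hr hr', isLeast_coneDist ha hb hab hr hr'⟩,
    fun c hc => exists_isPolarLift ha hb hab hc,
    fun c hc d hd r φ r' φ' hl hl' => isLeast_geodesicDist_immersions ha hb hab hc hd hl hl'⟩
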